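/- Let $A$ be a unital $C^*$-algebra, $G$ a discrete group and $(\rho,\sigma)$ a twisted action of $G$ on $A$: maps $\rho:G\to\operatorname{Aut}(A)$ and $\sigma:G\times G\to U(A)$ with $\rho_x(\sigma_{y,z})=\sigma_{x,y}\sigma_{xy,z}\sigma_{x,yz}^*$, $\rho_x\rho_y=\operatorname{Ad}(\sigma_{x,y})\rho_{xy}$, $\sigma_{x,e}=\sigma_{e,x}=1$ and $\rho_e=\operatorname{id}$. Let $(\mathcal A,H,D,\pi)$ be an odd spectral triple on $A$ with $\pi$ faithful: $\mathcal A\subseteq A$ is a dense unital $*$-subalgebra, $\pi:A\to\mathbb B(H)$ a faithful unital representation, $D$ a self-adjoint operator on $H$ with $(1+D^2)^{-1/2}$ compact, and every $\pi(a)$ with $a\in\mathcal A$ preserves $\operatorname{Dom}D$ and has bounded commutator with $D$. Suppose that the twisted action is smooth ($\rho_x(\mathcal A)\subseteq\mathcal A$ and $\sigma_{x,y}\in\mathcal A$ for all $x,y$) and that the triple is twisted equivariant: there are unitaries $U_g$ $(g\in G)$ on $H$ with $U_xU_y=\pi(\sigma_{x,y})U_{xy}$ and $\pi(\rho_x(a))=U_x\pi(a)U_x^*$,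 which preserve $\operatorname{Dom}D$ and for which each $[D,U_g]$ is bounded. Let $V$ be a finite-dimensional Hilbert space and let $\ell:G\to\mathbb B(V)$ be a function with self-adjoint values that is translation bounded ($\sup_x\|\ell(x)-\ell(y^{-1}x)\|<\infty$ for every $y$) and proper ($\ell(g)=0$ iff $g=e$; the union of the spectra of all $\ell(x)$ is a closed discrete subset of $\mathbb R$; each of its points lies in the spectrum of $\ell(x)$ for only finitely many $x$). Let $A\rtimes G$ be the full twisted crossed product and $A\rtimes_rG$ the reduced one, the latter being generated by the operators $a\delta_x$ on $\ell^2(G,H)$, $(a\delta_x)(\xi\otimes\delta_y)=\pi(\rho_{y^{-1}x^{-1}}(a)\sigma_{y^{-1}x^{-1},x})\xi\otimes\delta_{xy}$. Let $C_c(G,\mathcal A)\subseteq A\rtimes_rG$ be the set of finite sums $\sum_g a_g\delta_g$ with $a_g\in\mathcal A$, and let $C^*_r(G)$ be generated by the left translations $\delta_g=\lambda_g$ on $\ell^2(G)$. Let $B\subseteq\mathbb B(H)$ be the $C^*$-algebra generated by the operators $\pi(a)U_g$, and $\mathcal B\subseteq B$ the set of finite sums $\sum_g\pi(a_g)U_g$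 with $a_g\in\mathcal A$. Let $M_\ell$ be the closure of $\delta_x\otimes v\mapsto\delta_x\otimes\ell(x)v$ on $\mathbb C G\otimes V$. All $C^*$-tensor products are minimal. Then the following hold. 1. The integrated form of $(\pi,U)$ is a unital $*$-homomorphism $\pi\times U:A\rtimes G\to\mathbb B(H)$, $a\delta_g\mapsto\pi(a)U_g$, with image $B$. 2. There is an injective unital $*$-homomorphism $\phi_A^r:A\rtimes_rG\to(A\rtimes G)\otimes C_r^*(G)$ with $\phi_A^r(a\delta_g)=a\delta_g\otimes\delta_g$. The map $(\pi\times U)\otimes\operatorname{id}:(A\rtimes G)\otimes C_r^*(G)\to B\otimes C_r^*(G)$ exists, and we put $\psi_A=((\pi\times U)\otimes\operatorname{id})\circ\phi_A^r:A\rtimes_rG\to B\otimes C^*_r(G)$. 3. The equivariant construction gives an even spectral triple $(C_c(G,\mathcal A),\widetilde H,\widetilde D,\hat\pi\times\hat L)$ on $A\rtimes_rG$. Here $\widetilde H=(H\otimes\ell^2(G)\otimes V)^{\oplus2}$ with the standard grading. The representation is two copies of $a\delta_h\mapsto\pi(a)U_h\otimes\lambda_h\otimes1_V$, which is well defined on $A\rtimes_rG$.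 The operator $\widetilde D$ is the closure of $\begin{pmatrix}0&D\otimes1-i\,1\otimes M_\ell\\ D\otimes1+i\,1\otimes M_\ell&0\end{pmatrix}$ on two copies of the algebraic tensor product $\operatorname{Dom}D\otimes\mathbb C G\otimes V$. 4. $(\mathcal B,H,D)$, with the inclusion $B\subseteq\mathbb B(H)$, is an odd spectral triple on $B$. Likewise $(C_c(G),\ell^2(G)\otimes V,M_\ell)$, with the representation $\delta_g\mapsto\lambda_g\otimes1_V$, is an odd spectral triple on $C_r^*(G)$. Their exterior product exists and is an even spectral triple on $B\otimes C_r^*(G)$. It has smooth algebra $\mathcal B\otimes_{\rm alg}C_c(G)$, acts on $\widetilde H$ with the standard grading by two copies of the tensor product representation, and its Dirac operator is the closure of the same matrix on two copies of $\operatorname{Dom}D\otimes_{\rm alg}\operatorname{Dom}M_\ell$. 5. The triple in 3 is the restriction via $\psi_A$ of the exterior product in 4: $\psi_A$ is injective, maps $C_c(G,\mathcal A)$ into $\mathcal B\otimes_{\rm alg}C_c(G)$, and the representation of the triple in 3 is that of the exterior product composed with $\psi_A$, while the Hilbert spaces, gradings and Dirac operators coincide. -/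

import Mathlib

open scoped TensorProduct

universe u v w w'

noncomputable section

/-! ### Hilbert space tensor products, direct sums and weighted shifts -/

/-- The Hilbert space tensor product: the completion of the algebraic tensor product. -/
def HilbertTensor (E : Type u) (F : Type v) [NormedAddCommGroup E] [InnerProductSpace ℂ E]
    [NormedAddCommGroup F] [InnerProductSpace ℂ F] : Type (max u v) :=
  UniformSpace.Completion (E ⊗[ℂ] F)

namespace HilbertTensor

variable (E : Type u) (F : Type v) [NormedAddCommGroup E] [InnerProductSpace ℂ E]
  [NormedAddCommGroup F] [InnerProductSpace ℂ F]

instance instNormedAddCommGroup : NormedAddCommGroup (HilbertTensor E F) :=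
  inferInstanceAs (NormedAddCommGroup (UniformSpace.Completion (E ⊗[ℂ] F)))

instance instInnerProductSpace : InnerProductSpace ℂ (HilbertTensor E F) :=
  inferInstanceAs (InnerProductSpace ℂ (UniformSpace.Completion (E ⊗[ℂ] F)))

instance instCompleteSpace : CompleteSpace (HilbertTensor E F) :=
  inferInstanceAs (CompleteSpace (UniformSpace.Completion (E ⊗[ℂ] F)))

/-- The isometric inclusion of the algebraic tensor product. -/
def incl : E ⊗[ℂ] F →ₗᵢ[ℂ] HilbertTensor E F :=
  (UniformSpace.Completion.toComplₗᵢ : E ⊗[ℂ] F →ₗᵢ[ℂ] UniformSpace.Completion (E ⊗[ℂ] F))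

theorem denseRange_incl : DenseRange (incl E F) :=
  UniformSpace.Completion.denseRange_coe (α := E ⊗[ℂ] F)

end HilbertTensor

/-- The Hilbert space direct sum `K ⊕ K`. -/
abbrev Double (K : Type u) [NormedAddCommGroup K] [InnerProductSpace ℂ K] : Type u :=
  WithLp 2 (K × K)

/-- The Hilbert space `ℓ²(G)`. -/
abbrev L2 (G : Type u) : Type u := lp (fun _ : G => ℂ) 2

section Operators

variable {E : Type u} {F : Type v} [NormedAddCommGroup E] [InnerProductSpace ℂ E]
  [NormedAddCommGroup F] [InnerProductSpace ℂ F]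

/-- The bounded operator `S ⊗ T` on the Hilbert space tensor product. -/
def tensorOp (S : E →L[ℂ] E) (T : F →L[ℂ] F) : HilbertTensor E F →L[ℂ] HilbertTensor E F :=
  ((HilbertTensor.incl E F).toContinuousLinearMap.comp (TensorProduct.mapL S T)).extend
    (HilbertTensor.incl E F).toContinuousLinearMap

theorem tensorOp_incl (S : E →L[ℂ] E) (T : F →L[ℂ] F) (t : E ⊗[ℂ] F) :
    tensorOp S T (HilbertTensor.incl E F t) = HilbertTensor.incl E F (TensorProduct.mapL S T t) :=
  ContinuousLinearMap.extend_eq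
    ((HilbertTensor.incl E F).toContinuousLinearMap.comp (TensorProduct.mapL S T))
    (e := (HilbertTensor.incl E F).toContinuousLinearMap)
    (HilbertTensor.denseRange_incl E F) (HilbertTensor.incl E F).isometry.isUniformInducing t

theorem tensorOp_ext {X Y : HilbertTensor E F →L[ℂ] HilbertTensor E F}
    (h : ∀ t : E ⊗[ℂ] F, X (HilbertTensor.incl E F t) = Y (HilbertTensor.incl E F t)) : X = Y :=
  DFunLike.coe_injective <|
    (HilbertTensor.denseRange_incl E F).equalizer X.continuous Y.continuous (funext h)

theorem tensorOp_mul (S S' : E →L[ℂ] E) (T T' : F →L[ℂ] F) :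
    tensorOp (S * S') (T * T') = tensorOp S T * tensorOp S' T' :=
  tensorOp_ext fun t => by
    simp only [mul_apply_eq_comp, tensorOp_incl, TensorProduct.mapL_mul]

theorem tensorOp_one : tensorOp (1 : E →L[ℂ] E) (1 : F →L[ℂ] F) = 1 :=
  tensorOp_ext fun t => by
    rw [tensorOp_incl]
    exact congrArg _ (DFunLike.congr_fun (TensorProduct.mapL_id_id (𝕜 := ℂ)) t)

theorem tensorOp_add_left (S S' : E →L[ℂ] E) (T : F →L[ℂ] F) :
    tensorOp (S + S') T = tensorOp S T + tensorOp S' T :=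
  tensorOp_ext fun t => by
    simp only [add_apply, tensorOp_incl, TensorProduct.mapL_add_left, map_add]

theorem tensorOp_smul_left (c : ℂ) (S : E →L[ℂ] E) (T : F →L[ℂ] F) :
    tensorOp (c • S) T = c • tensorOp S T :=
  tensorOp_ext fun t => by
    simp only [smul_apply, tensorOp_incl, TensorProduct.mapL_smul_left, map_smul]

theorem tensorOp_star [CompleteSpace E] [CompleteSpace F] (S : E →L[ℂ] E) (T : F →L[ℂ] F) :
    tensorOp (star S) (star T) = star (tensorOp S T) := by
  rw [ContinuousLinearMap.star_eq_adjoint (tensorOp S T), ContinuousLinearMap.eq_adjoint_iff]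
  intro x y
  refine (HilbertTensor.denseRange_incl E F).induction_on₂ (isClosed_eq (by fun_prop) (by fun_prop))
    (fun s t => ?_) x y
  rw [tensorOp_incl, tensorOp_incl, LinearIsometry.inner_map_map, LinearIsometry.inner_map_map]
  induction s using TensorProduct.induction_on with
  | zero => simp
  | add a b ha hb => simp only [map_add, inner_add_left, ha, hb]
  | tmul a b =>
    induction t using TensorProduct.induction_on with
    | zero => simp
    | add c d hc hd => simp only [map_add, inner_add_right, hc, hd]
    | tmul c d =>
      simp [ContinuousLinearMap.star_eq_adjoint, ContinuousLinearMap.adjoint_inner_left]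

/-- The amplification `S ↦ S ⊗ 1`, as a unital `*`-homomorphism. -/
def amplify (E : Type u) (F : Type v) [NormedAddCommGroup E] [InnerProductSpace ℂ E]
    [NormedAddCommGroup F] [InnerProductSpace ℂ F] [CompleteSpace E] [CompleteSpace F] :
    (E →L[ℂ] E) →⋆ₐ[ℂ] (HilbertTensor E F →L[ℂ] HilbertTensor E F) where
  toFun S := tensorOp S 1
  map_one' := tensorOp_one
  map_mul' S S' := by rw [← tensorOp_mul, one_mul]
  map_zero' := by simpa using tensorOp_smul_left (0 : ℂ) (0 : E →L[ℂ] E) (1 : F →L[ℂ] F)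
  map_add' S S' := tensorOp_add_left S S' 1
  commutes' c := by
    rw [Algebra.algebraMap_eq_smul_one, Algebra.algebraMap_eq_smul_one, tensorOp_smul_left,
      tensorOp_one]
  map_star' S := by rw [← tensorOp_star, star_one]

/-- The operator `T ⊕ T` on `E ⊕ E`. -/
def doubleOp (T : E →L[ℂ] E) : Double E →L[ℂ] Double E :=
  (WithLp.prodContinuousLinearEquiv 2 ℂ E E).symm.toContinuousLinearMap ∘L
    (T.prodMap T) ∘L (WithLp.prodContinuousLinearEquiv 2 ℂ E E).toContinuousLinearMap

/-- The standard grading `(ξ, η) ↦ (ξ, -η)` of `E ⊕ E`. -/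
def stdGrading (E : Type u) [NormedAddCommGroup E] [InnerProductSpace ℂ E] :
    Double E →L[ℂ] Double E :=
  (WithLp.prodContinuousLinearEquiv 2 ℂ E E).symm.toContinuousLinearMap ∘L
    ((1 : E →L[ℂ] E).prodMap (-1 : E →L[ℂ] E)) ∘L
      (WithLp.prodContinuousLinearEquiv 2 ℂ E E).toContinuousLinearMap

end Operators

section Shift

variable {ι : Type u} {E : ι → Type v} [∀ i, NormedAddCommGroup (E i)]
  [∀ i, InnerProductSpace ℂ (E i)]

theorem shift_memℓp (e : ι ≃ ι) (T : ∀ i, E (e i) →L[ℂ] E i) (C : ℝ)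
    (hC : ∀ i, ‖T i‖ ≤ C) (f : lp E 2) : Memℓp (fun i => T i (f (e i))) 2 := by
  have hf : Summable fun i => ‖f (e i)‖ ^ (2 : ℕ) := by
    have h := (lp.memℓp f).summable (by simp)
    have h' : Summable fun i => ‖f i‖ ^ (2 : ℕ) := by simpa using h
    exact (e.summable_iff (f := fun i => ‖f i‖ ^ (2 : ℕ))).mpr h'
  refine memℓp_gen ?_
  refine Summable.of_nonneg_of_le (fun i => by positivity) (fun i => ?_) (hf.mul_left (C ^ 2))
  have h1 : ‖T i (f (e i))‖ ≤ C * ‖f (e i)‖ :=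
    ((T i).le_opNorm _).trans (mul_le_mul_of_nonneg_right (hC i) (norm_nonneg _))
  have h2 : ‖T i (f (e i))‖ ^ 2 ≤ (C * ‖f (e i)‖) ^ 2 := by gcongr
  simpa [mul_pow] using h2

/-- The underlying linear map of the weighted shift. -/
def weightedShiftₗ (e : ι ≃ ι) (T : ∀ i, E (e i) →L[ℂ] E i) (C : ℝ)
    (hC : ∀ i, ‖T i‖ ≤ C) : lp E 2 →ₗ[ℂ] lp E 2 where
  toFun f := ⟨fun i => T i (f (e i)), shift_memℓp e T C hC f⟩
  map_add' f g := by
    ext i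
    exact (T i).map_add (f (e i)) (g (e i))
  map_smul' c f := by
    ext i
    exact (T i).map_smul c (f (e i))

theorem norm_weightedShiftₗ_le (e : ι ≃ ι) (T : ∀ i, E (e i) →L[ℂ] E i) (C : ℝ)
    (hC : ∀ i, ‖T i‖ ≤ C) (f : lp E 2) : ‖weightedShiftₗ e T C hC f‖ ≤ |C| * ‖f‖ := by
  have h2 : (0 : ℝ) < (2 : ENNReal).toReal := by simp
  refine lp.norm_le_of_forall_sum_le h2 (by positivity) fun s => ?_
  have h1 : ∀ i ∈ s, ‖weightedShiftₗ e T C hC f i‖ ^ (2 : ENNReal).toReal ≤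
      |C| ^ (2 : ENNReal).toReal * ‖f (e i)‖ ^ (2 : ENNReal).toReal := by
    intro i _
    rw [← Real.mul_rpow (abs_nonneg _) (norm_nonneg _)]
    refine Real.rpow_le_rpow (norm_nonneg _) ?_ h2.le
    exact ((T i).le_opNorm _).trans
      (mul_le_mul_of_nonneg_right ((hC i).trans (le_abs_self C)) (norm_nonneg _))
  refine (Finset.sum_le_sum h1).trans ?_
  rw [← Finset.mul_sum, Real.mul_rpow (abs_nonneg _) (norm_nonneg _)]
  refine mul_le_mul_of_nonneg_left ?_ (by positivity)
  have h3 := lp.sum_rpow_le_norm_rpow h2 f (s.map e.toEmbedding)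
  rwa [Finset.sum_map] at h3

/-- The weighted shift `(X f)(i) = Tᵢ (f (e i))` on `⨁₂ Eᵢ`, for a permutation `e` and uniformly
bounded operators `Tᵢ`. -/
def weightedShift (e : ι ≃ ι) (T : ∀ i, E (e i) →L[ℂ] E i) (C : ℝ)
    (hC : ∀ i, ‖T i‖ ≤ C) : lp E 2 →L[ℂ] lp E 2 :=
  (weightedShiftₗ e T C hC).mkContinuous |C| (norm_weightedShiftₗ_le e T C hC)

theorem weightedShift_apply (e : ι ≃ ι) (T : ∀ i, E (e i) →L[ℂ] E i) (C : ℝ)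
    (hC : ∀ i, ‖T i‖ ≤ C) (f : lp E 2) (i : ι) : weightedShift e T C hC f i = T i (f (e i)) :=
  rfl

end Shift

/-! ### Concrete C*-algebras -/

section CStar

variable {K : Type u} [NormedAddCommGroup K] [InnerProductSpace ℂ K] [CompleteSpace K]
  {L : Type v} [NormedAddCommGroup L] [InnerProductSpace ℂ L] [CompleteSpace L]

/-- The closed unital `*`-algebra of operators generated by a set `s`. -/
def cstarGen (s : Set (K →L[ℂ] K)) : StarSubalgebra ℂ (K →L[ℂ] K) :=
  (StarAlgebra.adjoin ℂ s).topologicalClosure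

theorem mem_cstarGen {s : Set (K →L[ℂ] K)} {T : K →L[ℂ] K} (hT : T ∈ s) : T ∈ cstarGen s :=
  StarSubalgebra.le_topologicalClosure _ (StarAlgebra.subset_adjoin ℂ s hT)

theorem isClosed_cstarGen (s : Set (K →L[ℂ] K)) : IsClosed (cstarGen s : Set (K →L[ℂ] K)) :=
  StarSubalgebra.isClosed_topologicalClosure _

instance instCompleteCstarGen (s : Set (K →L[ℂ] K)) : CompleteSpace (cstarGen s) :=
  (isClosed_cstarGen s).completeSpace_coe

/-- The unital C*-algebra of operators generated by a set `s`, as a type. -/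
def OpAlg (s : Set (K →L[ℂ] K)) : Type u := cstarGen s

instance OpAlg.instCStarAlgebra (s : Set (K →L[ℂ] K)) : CStarAlgebra (OpAlg s) :=
  { (inferInstance : NormedRing (cstarGen s)), (inferInstance : StarRing (cstarGen s)),
    (inferInstance : CompleteSpace (cstarGen s)), (inferInstance : CStarRing (cstarGen s)),
    (inferInstance : NormedAlgebra ℂ (cstarGen s)),
    (inferInstance : StarModule ℂ (cstarGen s)) with }

/-- The inclusion of the C*-algebra generated by `s` in the algebra of all bounded operators. -/
def OpAlg.val (s : Set (K →L[ℂ] K)) : OpAlg s →⋆ₐ[ℂ] (K →L[ℂ] K) := (cstarGen s).subtype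

/-- An element of `s`, as an element of the C*-algebra generated by `s`. -/
def OpAlg.gen {s : Set (K →L[ℂ] K)} (T : K →L[ℂ] K) (hT : T ∈ s) : OpAlg s := ⟨T, mem_cstarGen hT⟩

/-- The operators `b ⊗ c`. -/
def tensorGen (s : Set (K →L[ℂ] K)) (t : Set (L →L[ℂ] L)) :
    Set (HilbertTensor K L →L[ℂ] HilbertTensor K L) :=
  {T | ∃ (b : OpAlg s) (c : OpAlg t), T = tensorOp (OpAlg.val s b) (OpAlg.val t c)}

/-- The minimal (spatial) tensor product of two C*-algebras of operators on `K` and `L`: the closed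
span of the operators `b ⊗ c` on the Hilbert space tensor product of `K` and `L`. -/
abbrev MinTensor (s : Set (K →L[ℂ] K)) (t : Set (L →L[ℂ] L)) : Type (max u v) :=
  OpAlg (tensorGen s t)

/-- The elementary tensor `b ⊗ c` in the minimal tensor product. -/
def MinTensor.tmul {s : Set (K →L[ℂ] K)} {t : Set (L →L[ℂ] L)} (b : OpAlg s) (c : OpAlg t) :
    MinTensor s t :=
  OpAlg.gen (tensorOp (OpAlg.val s b) (OpAlg.val t c)) ⟨b, c, rfl⟩

end CStar

/-! ### Spectral triples -/

section Triples

/-- `[D, T]` is defined on the domain of `D` and extends to a bounded operator. -/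
def HasBoundedCommutator {H : Type v} [NormedAddCommGroup H] [InnerProductSpace ℂ H]
    (D : H →ₗ.[ℂ] H) (T : H →L[ℂ] H) : Prop :=
  ∃ h : ∀ ξ : D.domain, T ξ ∈ D.domain,
    ∃ C : H →L[ℂ] H, ∀ ξ : D.domain, D ⟨T ξ, h ξ⟩ - T (D ξ) = C ξ

/-- `S = (1 + D²)^(-1/2)`: the positive bounded operator whose square inverts `1 + D²`. -/
def IsInvSqrtOneAddSq {H : Type v} [NormedAddCommGroup H] [InnerProductSpace ℂ H] [CompleteSpace H]
    (D : H →ₗ.[ℂ] H) (S : H →L[ℂ] H) : Prop :=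
  S.IsPositive ∧ ∀ ξ : H, ∃ (h₁ : S (S ξ) ∈ D.domain) (h₂ : D ⟨S (S ξ), h₁⟩ ∈ D.domain),
    S (S ξ) + D ⟨D ⟨S (S ξ), h₁⟩, h₂⟩ = ξ

/-- The data `(𝒜, H, D, π)` of a candidate spectral triple on `A`. -/
structure TripleData (A : Type u) [CStarAlgebra A] (H : Type v) [NormedAddCommGroup H]
    [InnerProductSpace ℂ H] [CompleteSpace H] where
  /-- the smooth subalgebra -/
  alg : Submodule ℂ A
  /-- the representation -/
  rep : A →⋆ₐ[ℂ] (H →L[ℂ] H)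
  /-- the Dirac operator -/
  dirac : H →ₗ.[ℂ] H

/-- The data of a candidate even spectral triple on `A`. -/
structure EvenTripleData (A : Type u) [CStarAlgebra A] (H : Type v) [NormedAddCommGroup H]
    [InnerProductSpace ℂ H] [CompleteSpace H] extends TripleData A H where
  /-- the grading operator -/
  grading : H →L[ℂ] H

variable {A : Type u} [CStarAlgebra A] {H : Type v} [NormedAddCommGroup H]
    [InnerProductSpace ℂ H] [CompleteSpace H]

/-- Odd spectral triples on the unital C*-algebra `A`. -/
structure IsSpectralTriple (T : TripleData A H) : Prop where
  one_mem : (1 : A) ∈ T.alg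
  mul_mem : ∀ a ∈ T.alg, ∀ b ∈ T.alg, a * b ∈ T.alg
  star_mem : ∀ a ∈ T.alg, star a ∈ T.alg
  dense : Dense (T.alg : Set A)
  selfAdjoint : IsSelfAdjoint T.dirac
  compact : ∃ S : H →L[ℂ] H, IsInvSqrtOneAddSq T.dirac S ∧ IsCompactOperator S
  commutator : ∀ a ∈ T.alg, HasBoundedCommutator T.dirac (T.rep a)

/-- Even spectral triples on the unital C*-algebra `A`. -/
structure IsEvenSpectralTriple (T : EvenTripleData A H) : Prop
    extends IsSpectralTriple T.toTripleData where
  grading_selfAdjoint : IsSelfAdjoint T.grading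
  grading_sq : T.grading * T.grading = 1
  grading_comm : ∀ a : A, T.rep a * T.grading = T.grading * T.rep a
  grading_dirac : ∃ h : ∀ ξ : T.dirac.domain, T.grading ξ ∈ T.dirac.domain,
    ∀ ξ : T.dirac.domain, T.dirac ⟨T.grading ξ, h ξ⟩ = -T.grading (T.dirac ξ)

/-- `Q` is the pullback of the (even) triple `P` under the smooth unital morphism `ψ`. -/
structure IsPullback {A' : Type w} [CStarAlgebra A'] (ψ : A' →⋆ₐ[ℂ] A) (P : EvenTripleData A H)
    (Q : EvenTripleData A' H) : Prop where
  smooth : ∀ a ∈ Q.alg, ψ a ∈ P.alg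
  rep : Q.rep = P.rep.comp ψ
  dirac : Q.dirac = P.dirac
  grading : Q.grading = P.grading

/-- `Q` is the restriction of `P` via `ψ`: the pullback under a unital inclusion. -/
def IsRestriction {A' : Type w} [CStarAlgebra A'] (ψ : A' →⋆ₐ[ℂ] A) (P : EvenTripleData A H)
    (Q : EvenTripleData A' H) : Prop :=
  Function.Injective ψ ∧ IsPullback ψ P Q

end Triples

/-! ### The exterior product of odd triples -/

/-- The operator `e t ↦ d t` with domain the range of an injective linear map `e`. -/
def pmapOfParam {X : Type u} {E : Type v} [AddCommGroup X] [Module ℂ X] [AddCommGroup E]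
    [Module ℂ E] (e : X →ₗ[ℂ] E) (he : Function.Injective e) (d : X →ₗ[ℂ] E) : E →ₗ.[ℂ] E where
  domain := LinearMap.range e
  toFun := d ∘ₗ (LinearEquiv.ofInjective e he).symm.toLinearMap

section Exterior

variable {H₁ : Type u} [NormedAddCommGroup H₁] [InnerProductSpace ℂ H₁]
  {H₂ : Type v} [NormedAddCommGroup H₂] [InnerProductSpace ℂ H₂]

/-- The inclusion of the algebraic tensor product of two subspaces in the Hilbert space tensor
product. -/
def coreIncl (E : Submodule ℂ H₁) (F : Submodule ℂ H₂) : E ⊗[ℂ] F →ₗ[ℂ] HilbertTensor H₁ H₂ :=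
  (HilbertTensor.incl H₁ H₂).toLinearMap ∘ₗ TensorProduct.map E.subtype F.subtype

theorem coreIncl_injective (E : Submodule ℂ H₁) (F : Submodule ℂ H₂) :
    Function.Injective (coreIncl E F) :=
  (HilbertTensor.incl H₁ H₂).injective.comp
    (TensorProduct.map_injective_of_flat_flat _ _ E.injective_subtype F.injective_subtype)

/-- `D₁ ⊗ 1 + c (1 ⊗ D₂)` on the algebraic tensor product of the domains. -/
def tensorSum (D₁ : H₁ →ₗ.[ℂ] H₁) (D₂ : H₂ →ₗ.[ℂ] H₂) (c : ℂ) :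
    D₁.domain ⊗[ℂ] D₂.domain →ₗ[ℂ] HilbertTensor H₁ H₂ :=
  (HilbertTensor.incl H₁ H₂).toLinearMap ∘ₗ
    (TensorProduct.map D₁.toFun D₂.domain.subtype +
      c • TensorProduct.map D₁.domain.subtype D₂.toFun)

/-- The inclusion of two copies of the algebraic tensor product of two subspaces. -/
def doubleIncl (E : Submodule ℂ H₁) (F : Submodule ℂ H₂) :
    (E ⊗[ℂ] F) × (E ⊗[ℂ] F) →ₗ[ℂ] Double (HilbertTensor H₁ H₂) :=
  (WithLp.linearEquiv 2 ℂ (HilbertTensor H₁ H₂ × HilbertTensor H₁ H₂)).symm.toLinearMap ∘ₗ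
    (coreIncl E F).prodMap (coreIncl E F)

theorem doubleIncl_injective (E : Submodule ℂ H₁) (F : Submodule ℂ H₂) :
    Function.Injective (doubleIncl E F) :=
  (WithLp.linearEquiv 2 ℂ (HilbertTensor H₁ H₂ × HilbertTensor H₁ H₂)).symm.injective.comp
    ((coreIncl_injective E F).prodMap (coreIncl_injective E F))

/-- The matrix `((0, D₁ ⊗ 1 - i 1 ⊗ D₂), (D₁ ⊗ 1 + i 1 ⊗ D₂, 0))` on two copies of the algebraic
tensor product of the domains. -/
def prodDiracCore (D₁ : H₁ →ₗ.[ℂ] H₁) (D₂ : H₂ →ₗ.[ℂ] H₂) :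
    Double (HilbertTensor H₁ H₂) →ₗ.[ℂ] Double (HilbertTensor H₁ H₂) :=
  pmapOfParam (doubleIncl D₁.domain D₂.domain) (doubleIncl_injective _ _)
    ((WithLp.linearEquiv 2 ℂ (HilbertTensor H₁ H₂ × HilbertTensor H₁ H₂)).symm.toLinearMap ∘ₗ
      LinearMap.prod (tensorSum D₁ D₂ (-Complex.I) ∘ₗ LinearMap.snd ℂ _ _)
        (tensorSum D₁ D₂ Complex.I ∘ₗ LinearMap.fst ℂ _ _))

/-- The closure of the above operator. -/
def prodDirac (D₁ : H₁ →ₗ.[ℂ] H₁) (D₂ : H₂ →ₗ.[ℂ] H₂) :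
    Double (HilbertTensor H₁ H₂) →ₗ.[ℂ] Double (HilbertTensor H₁ H₂) :=
  (prodDiracCore D₁ D₂).closure

variable [CompleteSpace H₁] [CompleteSpace H₂]
  {K₁ : Type w} [NormedAddCommGroup K₁] [InnerProductSpace ℂ K₁] [CompleteSpace K₁]
  {K₂ : Type w'} [NormedAddCommGroup K₂] [InnerProductSpace ℂ K₂] [CompleteSpace K₂]

/-- `P` is the exterior product of the odd triples `T₁`, `T₂` on C*-algebras of operators. The
values of the representation on elementary tensors determine it. -/
structure IsExteriorProduct {s₁ : Set (K₁ →L[ℂ] K₁)} {s₂ : Set (K₂ →L[ℂ] K₂)}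
    (T₁ : TripleData (OpAlg s₁) H₁) (T₂ : TripleData (OpAlg s₂) H₂)
    (P : EvenTripleData (MinTensor s₁ s₂) (Double (HilbertTensor H₁ H₂))) : Prop where
  alg : P.alg = Submodule.span ℂ {t | ∃ b ∈ T₁.alg, ∃ c ∈ T₂.alg, t = MinTensor.tmul b c}
  rep : ∀ b c, P.rep (MinTensor.tmul b c) = doubleOp (tensorOp (T₁.rep b) (T₂.rep c))
  dirac : P.dirac = prodDirac T₁.dirac T₂.dirac
  grading : P.grading = stdGrading _

end Exterior

/-! ### Twisted dynamical systems and crossed products -/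

/-- A twisted action `(ρ, σ)` of the discrete group `G` on the unital C*-algebra `A`. -/
structure TwistedSystem (A : Type u) [CStarAlgebra A] (G : Type v) [Group G] where
  ρ : G → (A ≃⋆ₐ[ℂ] A)
  σ : G → G → unitary A
  cocycle : ∀ x y z, ρ x (σ y z : A) = (σ x y : A) * (σ (x * y) z : A) * star (σ x (y * z) : A)
  action : ∀ x y a, ρ x (ρ y a) = (σ x y : A) * ρ (x * y) a * star (σ x y : A)
  σ_one_right : ∀ x, σ x 1 = 1
  σ_one_left : ∀ x, σ 1 x = 1
  ρ_one : ∀ a, ρ 1 a = a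

/-- The twisted action restricts to the subalgebra `𝒜`. -/
def TwistedSystem.IsSmooth {A : Type u} [CStarAlgebra A] {G : Type v} [Group G]
    (S : TwistedSystem A G) (𝒜 : Submodule ℂ A) : Prop :=
  (∀ x, ∀ a ∈ 𝒜, S.ρ x a ∈ 𝒜) ∧ ∀ x y, (S.σ x y : A) ∈ 𝒜

/-- Twisted covariant representations on the Hilbert space `K`. -/
structure CovariantRep {A : Type u} [CStarAlgebra A] {G : Type v} [Group G] (S : TwistedSystem A G)
    (K : Type w) [NormedAddCommGroup K] [InnerProductSpace ℂ K] [CompleteSpace K] where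
  π : A →⋆ₐ[ℂ] (K →L[ℂ] K)
  U : G → unitary (K →L[ℂ] K)
  mul : ∀ x y, (U x : K →L[ℂ] K) * U y = π (S.σ x y) * U (x * y)
  cov : ∀ x a, π (S.ρ x a) = (U x : K →L[ℂ] K) * π a * star (U x : K →L[ℂ] K)

/-- The operator `π(a) Uₓ`, image of `a δₓ` under the integrated form. -/
def CovariantRep.op {A : Type u} [CStarAlgebra A] {G : Type v} [Group G] {S : TwistedSystem A G}
    {K : Type w} [NormedAddCommGroup K] [InnerProductSpace ℂ K] [CompleteSpace K]
    (R : CovariantRep S K) (a : A) (x : G) : K →L[ℂ] K :=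
  R.π a * R.U x

theorem CovariantRep.norm_op_le {A : Type u} [CStarAlgebra A] {G : Type v} [Group G]
    {S : TwistedSystem A G} {K : Type w} [NormedAddCommGroup K] [InnerProductSpace ℂ K]
    [CompleteSpace K] (R : CovariantRep S K) (a : A) (x : G) : ‖R.op a x‖ ≤ ‖a‖ := by
  rw [CovariantRep.op, CStarRing.norm_mul_coe_unitary]
  exact NonUnitalStarAlgHom.norm_apply_le R.π a

section Crossed

variable {A G : Type u} [CStarAlgebra A] [Group G]

/-- All twisted covariant representations on Hilbert spaces. -/
structure SomeCovariantRep (S : TwistedSystem A G) : Type (u + 1) where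
  K : Type u
  [group : NormedAddCommGroup K]
  [inner : InnerProductSpace ℂ K]
  [complete : CompleteSpace K]
  rep : CovariantRep S K

attribute [instance] SomeCovariantRep.group SomeCovariantRep.inner SomeCovariantRep.complete

/-- The Hilbert space of the universal covariant representation. -/
abbrev UnivSpace (S : TwistedSystem A G) : Type (u + 1) :=
  lp (fun R : SomeCovariantRep S => R.K) 2

/-- The image of `a δₓ` in the universal covariant representation, the direct sum of all the
covariant representations. -/
def univOp (S : TwistedSystem A G) (a : A) (x : G) : UnivSpace S →L[ℂ] UnivSpace S :=
  weightedShift (E := fun R : SomeCovariantRep S => R.K) (Equiv.refl _)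
    (fun R => R.rep.op a x) ‖a‖ (fun R => R.rep.norm_op_le a x)

/-- Generators of the full twisted crossed product. -/
def univGen (S : TwistedSystem A G) : Set (UnivSpace S →L[ℂ] UnivSpace S) :=
  {T | ∃ a x, T = univOp S a x}

/-- The full twisted crossed product `A ⋊ G`: the C*-algebra generated by the universal covariant
representation, so that its norm is the supremum over all covariant representations. -/
abbrev FullCrossed (S : TwistedSystem A G) : Type (u + 1) :=
  OpAlg (univGen S)

/-- The element `a δₓ` of the full twisted crossed product. -/
def fullδ (S : TwistedSystem A G) (a : A) (x : G) : FullCrossed S :=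
  OpAlg.gen (univOp S a x) ⟨a, x, rfl⟩

variable {H : Type u} [NormedAddCommGroup H] [InnerProductSpace ℂ H] [CompleteSpace H]

/-- The left regular representation on `ℓ²(G, H)` induced by `π`:
`(a δₓ)(ξ ⊗ δ_y) = π(ρ_{y⁻¹x⁻¹}(a) σ_{y⁻¹x⁻¹,x}) ξ ⊗ δ_{xy}`, that is
`((a δₓ) f)(z) = π(ρ_{z⁻¹}(a) σ_{z⁻¹,x}) f(x⁻¹z)`. -/
def regOp (S : TwistedSystem A G) (π : A →⋆ₐ[ℂ] (H →L[ℂ] H)) (a : A) (x : G) :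
    lp (fun _ : G => H) 2 →L[ℂ] lp (fun _ : G => H) 2 :=
  weightedShift (E := fun _ : G => H) (Equiv.mulLeft x⁻¹)
    (fun z => π (S.ρ z⁻¹ a * S.σ z⁻¹ x)) ‖a‖ (fun z => by
      refine (NonUnitalStarAlgHom.norm_apply_le π _).trans ?_
      rw [CStarRing.norm_mul_coe_unitary]
      exact NonUnitalStarAlgHom.norm_apply_le (S.ρ z⁻¹).toStarAlgHom a)

/-- Generators of the reduced twisted crossed product. -/
def regGen (S : TwistedSystem A G) (π : A →⋆ₐ[ℂ] (H →L[ℂ] H)) :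
    Set (lp (fun _ : G => H) 2 →L[ℂ] lp (fun _ : G => H) 2) :=
  {T | ∃ a x, T = regOp S π a x}

/-- The reduced twisted crossed product `A ⋊_r G`, defined by a faithful representation `π`. -/
abbrev ReducedCrossed (S : TwistedSystem A G) (π : A →⋆ₐ[ℂ] (H →L[ℂ] H)) : Type u :=
  OpAlg (regGen S π)

/-- The element `a δₓ` of the reduced twisted crossed product. -/
def redδ (S : TwistedSystem A G) (π : A →⋆ₐ[ℂ] (H →L[ℂ] H)) (a : A) (x : G) :
    ReducedCrossed S π :=
  OpAlg.gen (regOp S π a x) ⟨a, x, rfl⟩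

/-- Generators of the C*-algebra of a covariant representation. -/
def repGen {S : TwistedSystem A G} (R : CovariantRep S H) : Set (H →L[ℂ] H) :=
  {T | ∃ a x, T = R.op a x}

/-- The C*-algebra `B ⊆ 𝔹(H)` generated by the operators `π(a) Uₓ`. -/
abbrev RepAlg {S : TwistedSystem A G} (R : CovariantRep S H) : Type u :=
  OpAlg (repGen R)

/-- The element `π(a) Uₓ` of `B`. -/
def repδ {S : TwistedSystem A G} (R : CovariantRep S H) (a : A) (x : G) : RepAlg R :=
  OpAlg.gen (R.op a x) ⟨a, x, rfl⟩

end Crossed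

/-! ### The reduced group C*-algebra and length functions -/

section Fibre

variable {G : Type u} {V : Type v} [NormedAddCommGroup V] [InnerProductSpace ℂ V]

open Classical in
/-- `δₓ ∈ ℓ²(G)`. -/
def L2.δ (x : G) : L2 G := lp.single 2 x (1 : ℂ)

/-- The embedding `ℂG ⊗ V → ℓ²(G) ⊗ V`, `∑ δₓ ⊗ vₓ ↦ ∑ δₓ ⊗ vₓ`, composed with a fibrewise
operator `m` on `V`. -/
def fibreMap (m : G → V →ₗ[ℂ] V) : (G →₀ V) →ₗ[ℂ] HilbertTensor (L2 G) V :=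
  Finsupp.lsum ℂ fun x =>
    (HilbertTensor.incl (L2 G) V).toLinearMap ∘ₗ
      (TensorProduct.mk ℂ (L2 G) V (L2.δ x)) ∘ₗ m x

theorem fibreMap_injective :
    Function.Injective (fibreMap (G := G) fun _ => (LinearMap.id : V →ₗ[ℂ] V)) := by
  classical
  rw [← LinearMap.ker_eq_bot, LinearMap.ker_eq_bot']
  intro f hf
  ext y
  have key : ∀ (g : G →₀ V) (w : V),
      inner ℂ (HilbertTensor.incl (L2 G) V (L2.δ y ⊗ₜ[ℂ] w))
        (fibreMap (fun _ => (LinearMap.id : V →ₗ[ℂ] V)) g) = inner ℂ w (g y) := by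
    intro g w
    induction g using Finsupp.induction_linear with
    | zero => simp
    | add a b ha hb => rw [map_add, inner_add_right, ha, hb, Finsupp.add_apply, inner_add_right]
    | single x v =>
      simp only [fibreMap, Finsupp.lsum_single, LinearMap.comp_apply, TensorProduct.mk_apply,
        LinearMap.id_apply, LinearIsometry.coe_toLinearMap,
        LinearIsometry.inner_map_map, TensorProduct.inner_tmul, L2.δ, lp.inner_single_left,
        lp.single_apply, Finsupp.single_apply]
      by_cases h : x = y
      · subst h; simp
      · simp [h, Ne.symm h]
  have h0 := key f (f y)
  rw [hf, inner_zero_right] at h0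
  exact inner_self_eq_zero.mp h0.symm

end Fibre

section Length

variable {G : Type u} [Group G]

/-- The left regular representation `λ_g δₓ = δ_{gx}` on `ℓ²(G)`. -/
def leftReg (g : G) : L2 G →L[ℂ] L2 G :=
  weightedShift (E := fun _ : G => ℂ) (Equiv.mulLeft g⁻¹) (fun _ => ContinuousLinearMap.id ℂ ℂ) 1
    (fun _ => ContinuousLinearMap.norm_id_le)

/-- Generators of the reduced group C*-algebra. -/
def grpGen (G : Type u) [Group G] : Set (L2 G →L[ℂ] L2 G) :=
  {T | ∃ g, T = leftReg g}

/-- The reduced group C*-algebra `C*_r(G)`. -/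
abbrev ReducedGroupAlg (G : Type u) [Group G] : Type u :=
  OpAlg (grpGen G)

/-- The element `δ_g` of `C*_r(G)`. -/
def grpδ (g : G) : ReducedGroupAlg G :=
  OpAlg.gen (leftReg g) ⟨g, rfl⟩

variable {V : Type v} [NormedAddCommGroup V] [InnerProductSpace ℂ V]

/-- The union of the spectra of the self-adjoint operators `ℓ(x)`. -/
def lengthSpectrum (ℓ : G → V →L[ℂ] V) : Set ℝ :=
  {t | ∃ x, (t : ℂ) ∈ spectrum ℂ (ℓ x)}

/-- Proper translation bounded functions with values in the self-adjoint operators on `V`. -/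
structure IsProperLength [CompleteSpace V] (ℓ : G → V →L[ℂ] V) : Prop where
  selfAdjoint : ∀ x, IsSelfAdjoint (ℓ x)
  translation : ∀ y, ∃ C : ℝ, ∀ x, ‖ℓ x - ℓ (y⁻¹ * x)‖ ≤ C
  eq_zero_iff : ∀ x, ℓ x = 0 ↔ x = 1
  closed : IsClosed (lengthSpectrum ℓ)
  discrete : IsDiscrete (lengthSpectrum ℓ)
  finite : ∀ t ∈ lengthSpectrum ℓ, {x | (t : ℂ) ∈ spectrum ℂ (ℓ x)}.Finite

/-- Multiplication by `ℓ`, `δₓ ⊗ v ↦ δₓ ⊗ ℓ(x) v`, on the algebraic tensor product `ℂG ⊗ V`. -/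
def lengthCore (ℓ : G → V →L[ℂ] V) : HilbertTensor (L2 G) V →ₗ.[ℂ] HilbertTensor (L2 G) V :=
  pmapOfParam (fibreMap fun _ => (LinearMap.id : V →ₗ[ℂ] V)) fibreMap_injective
    (fibreMap fun x => (ℓ x).toLinearMap)

/-- The Dirac operator `M_ℓ`: the closure of multiplication by `ℓ`. -/
def lengthDirac (ℓ : G → V →L[ℂ] V) : HilbertTensor (L2 G) V →ₗ.[ℂ] HilbertTensor (L2 G) V :=
  (lengthCore ℓ).closure

/-- The triple `(C_c(G), ℓ²(G) ⊗ V, M_ℓ, λ)` on `C*_r(G)`, where `λ(δ_g) = λ_g ⊗ 1`. -/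
def groupTriple [CompleteSpace V] (ℓ : G → V →L[ℂ] V) :
    TripleData (ReducedGroupAlg G) (HilbertTensor (L2 G) V) where
  alg := Submodule.span ℂ (Set.range grpδ)
  rep := (amplify (L2 G) V).comp (OpAlg.val (grpGen G))
  dirac := lengthDirac ℓ

end Length

/-! ### The equivariant construction -/

section Equivariant

variable {A G : Type u} [CStarAlgebra A] [Group G]
  {H : Type u} [NormedAddCommGroup H] [InnerProductSpace ℂ H] [CompleteSpace H]

/-- The triple `(ℬ, H, D)` on `B`, with `ℬ` the finite sums of `π(a) U_g`, `a ∈ 𝒜`. -/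
def repTriple {S : TwistedSystem A G} (R : CovariantRep S H) (𝒜 : Submodule ℂ A)
    (D : H →ₗ.[ℂ] H) : TripleData (RepAlg R) H where
  alg := Submodule.span ℂ {b | ∃ a ∈ 𝒜, ∃ g, b = repδ R a g}
  rep := OpAlg.val (repGen R)
  dirac := D

variable {V : Type v} [NormedAddCommGroup V] [InnerProductSpace ℂ V] [CompleteSpace V]

/-- `Q` is the triple `(C_c(G, 𝒜), H̃, D̃, π̂ × L̂)` on `A ⋊_r G` given by the equivariant construction.
The representation is two copies of `a δ_h ↦ π(a) U_h ⊗ λ_h ⊗ 1`, whose values on the elements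
`a δ_h` determine it. -/
structure IsEquivariantTriple {S : TwistedSystem A G} (R : CovariantRep S H) (𝒜 : Submodule ℂ A)
    (D : H →ₗ.[ℂ] H) (ℓ : G → V →L[ℂ] V)
    (Q : EvenTripleData (ReducedCrossed S R.π) (Double (HilbertTensor H (HilbertTensor (L2 G) V)))) :
    Prop where
  alg : Q.alg = Submodule.span ℂ {t | ∃ a ∈ 𝒜, ∃ g, t = redδ S R.π a g}
  rep : ∀ a h, Q.rep (redδ S R.π a h) =
    doubleOp (tensorOp (R.op a h) (tensorOp (leftReg h) (1 : V →L[ℂ] V)))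
  dirac : Q.dirac = prodDirac D (lengthCore ℓ)
  grading : Q.grading = stdGrading _

end Equivariant

end

/-!
An operator with compact resolvent is diagonal in a Hilbert basis, with real eigenvalues tending to
infinity in absolute value; conversely every such diagonal operator is self-adjoint with compact
resolvent, and is the closure of its restriction to any core containing the basis. If `D` and `M_ℓ`
have eigenbases `bᵢ`, `cⱼ` with eigenvalues `μᵢ`, `νⱼ`, then on the span of `(bᵢ ⊗ cⱼ, 0)` and
`(0, bᵢ ⊗ cⱼ)` the exterior product operator has the matrix `((0, μᵢ - i νⱼ), (μᵢ + i νⱼ, 0))`, with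
eigenvalues `± |μᵢ + i νⱼ|`, so it is again of this form. The `cⱼ` can be taken in `ℂG ⊗ V`, so the
cores of the equivariant triple and of the exterior product define the same operator.

The integrated form `π × U` is the compression of the universal representation to one of its
summands. For injectivity of `ψ_A` and the existence of the coaction we use Fell absorption: the
unitary `k ⊗ δ_z ↦ U_{z⁻¹} k ⊗ δ_z` conjugates `π(a) U_x ⊗ λ_x` into the regular representation
induced by `π`. The finite corners of the operators in the latter are matrices over `A`, on which a
faithful representation is isometric, so their norms do not depend on the choice of `π`.
-/

noncomputable section

/-! ### Elementary tensors in Hilbert space tensor products -/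

namespace HilbertTensor

section Elementary

variable {E F : Type*} [NormedAddCommGroup E] [InnerProductSpace ℂ E]
  [NormedAddCommGroup F] [InnerProductSpace ℂ F]

/-- The elementary tensor `x ⊗ y` of the Hilbert space tensor product, as a continuous bilinear
map. -/
def tmulL : E →L[ℂ] F →L[ℂ] HilbertTensor E F :=
  (ContinuousLinearMap.compL ℂ F (E ⊗[ℂ] F) (HilbertTensor E F)
    (incl E F).toContinuousLinearMap).comp (TensorProduct.mkL ℂ E F)

theorem incl_tmul (x : E) (y : F) : incl E F (x ⊗ₜ y) = tmulL x y := rfl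

theorem inner_tmulL (x x' : E) (y y' : F) :
    inner ℂ (tmulL x y) (tmulL x' y') = inner ℂ x x' * inner ℂ y y' := by
  rw [← incl_tmul, ← incl_tmul, LinearIsometry.inner_map_map, TensorProduct.inner_tmul]

theorem norm_tmulL (x : E) (y : F) : ‖tmulL x y‖ = ‖x‖ * ‖y‖ := by
  rw [← incl_tmul, LinearIsometry.norm_map, TensorProduct.norm_tmul]

theorem tensorOp_tmulL (S : E →L[ℂ] E) (T : F →L[ℂ] F) (x : E) (y : F) :
    tensorOp S T (tmulL x y) = tmulL (S x) (T y) := by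
  rw [← incl_tmul, tensorOp_incl, TensorProduct.mapL_tmul, incl_tmul]

theorem dense_span_image2_tmulL {s : Set E} {t : Set F}
    (hs : Dense (Submodule.span ℂ s : Set E)) (ht : Dense (Submodule.span ℂ t : Set F)) :
    Dense (Submodule.span ℂ (Set.image2 (fun x y => tmulL x y) s t) :
      Set (HilbertTensor E F)) := by
  set P := Submodule.span ℂ (Set.image2 (fun x y => tmulL x y) s t)
  have span_mem (x : E) (hx : x ∈ Submodule.span ℂ s) (y : F) (hy : y ∈ Submodule.span ℂ t) :
      tmulL x y ∈ P := by
    have := Submodule.apply_mem_map₂ (tmulL (E := E) (F := F)).toLinearMap₁₂ hx hy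
    rwa [Submodule.map₂_span_span] at this
  have tmul_mem (x : E) (y : F) : tmulL x y ∈ P.topologicalClosure :=
    map_mem_closure₂ (f := fun x y => tmulL x y) (by fun_prop) (hs x) (ht y) span_mem
  have incl_mem : Set.range (incl E F) ⊆ P.topologicalClosure := by
    rintro _ ⟨z, rfl⟩
    induction z using TensorProduct.induction_on with
    | zero => rw [map_zero]; exact zero_mem P.topologicalClosure
    | add a b ha hb => rw [map_add]; exact add_mem ha hb
    | tmul x y => exact tmul_mem x y
  exact fun z => closure_minimal incl_mem isClosed_closure (denseRange_incl E F z)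

theorem topologicalClosure_eq_top_of_tmulL_mem {s : Set E} {t : Set F}
    (hs : Dense (Submodule.span ℂ s : Set E)) (ht : Dense (Submodule.span ℂ t : Set F))
    {P : Submodule ℂ (HilbertTensor E F)} (h : ∀ x ∈ s, ∀ y ∈ t, tmulL x y ∈ P) :
    P.topologicalClosure = ⊤ :=
  Submodule.dense_iff_topologicalClosure_eq_top.mp <|
    (dense_span_image2_tmulL hs ht).mono <| Submodule.span_le.mpr <| Set.image2_subset_iff.mpr h

theorem clm_ext_of_dense {K : Type*} [NormedAddCommGroup K] [NormedSpace ℂ K]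
    {X Y : HilbertTensor E F →L[ℂ] K} {s : Set E} {t : Set F}
    (hs : Dense (Submodule.span ℂ s : Set E)) (ht : Dense (Submodule.span ℂ t : Set F))
    (h : ∀ x ∈ s, ∀ y ∈ t, X (tmulL x y) = Y (tmulL x y)) : X = Y :=
  ContinuousLinearMap.ext_on (dense_span_image2_tmulL hs ht) (Set.forall_mem_image2.mpr h)

theorem clm_ext {K : Type*} [NormedAddCommGroup K] [NormedSpace ℂ K]
    {X Y : HilbertTensor E F →L[ℂ] K} (h : ∀ x y, X (tmulL x y) = Y (tmulL x y)) : X = Y :=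
  clm_ext_of_dense (s := Set.univ) (t := Set.univ) (by simp) (by simp) fun x _ y _ => h x y

end Elementary

section Isometry

variable {E F E' F' : Type*} [NormedAddCommGroup E] [InnerProductSpace ℂ E]
  [NormedAddCommGroup F] [InnerProductSpace ℂ F] [NormedAddCommGroup E'] [InnerProductSpace ℂ E']
  [NormedAddCommGroup F'] [InnerProductSpace ℂ F']

/-- The continuous linear extension of `f ⊗ g` to the Hilbert space tensor products, for isometries
`f` and `g`. -/
def mapCLM (f : E →ₗᵢ[ℂ] E') (g : F →ₗᵢ[ℂ] F') : HilbertTensor E F →L[ℂ] HilbertTensor E' F' :=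
  ((incl E' F').comp (TensorProduct.mapIsometry f g)).toContinuousLinearMap.extend
    (incl E F).toContinuousLinearMap

theorem mapCLM_incl (f : E →ₗᵢ[ℂ] E') (g : F →ₗᵢ[ℂ] F') (z : E ⊗[ℂ] F) :
    mapCLM f g (incl E F z) = incl E' F' (TensorProduct.mapIsometry f g z) :=
  ContinuousLinearMap.extend_eq
    ((incl E' F').comp (TensorProduct.mapIsometry f g)).toContinuousLinearMap
    (e := (incl E F).toContinuousLinearMap) (denseRange_incl E F)
    (incl E F).isometry.isUniformInducing z

/-- The tensor product `f ⊗ g` of two isometries. -/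
def mapIsometry (f : E →ₗᵢ[ℂ] E') (g : F →ₗᵢ[ℂ] F') :
    HilbertTensor E F →ₗᵢ[ℂ] HilbertTensor E' F' where
  toLinearMap := (mapCLM f g).toLinearMap
  norm_map' x := by
    refine (denseRange_incl E F).induction_on x
      (isClosed_eq (mapCLM f g).continuous.norm continuous_norm) fun z => ?_
    simp [mapCLM_incl]

theorem mapIsometry_tmulL (f : E →ₗᵢ[ℂ] E') (g : F →ₗᵢ[ℂ] F') (x : E) (y : F) :
    mapIsometry f g (tmulL x y) = tmulL (f x) (g y) :=
  mapCLM_incl f g (x ⊗ₜ y)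

/-- The isometry `y ↦ x ⊗ y` for a unit vector `x`. -/
def tmulLeft (F : Type*) [NormedAddCommGroup F] [InnerProductSpace ℂ F] (x : E) (hx : ‖x‖ = 1) :
    F →ₗᵢ[ℂ] HilbertTensor E F where
  toLinearMap := (tmulL x).toLinearMap
  norm_map' y := by
    rw [ContinuousLinearMap.coe_coe, norm_tmulL, hx, one_mul]

end Isometry

section Associator

variable (E F V : Type*) [NormedAddCommGroup E] [InnerProductSpace ℂ E] [NormedAddCommGroup F]
  [InnerProductSpace ℂ F] [NormedAddCommGroup V] [InnerProductSpace ℂ V]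

/-- The inclusion of the algebraic tensor product `(E ⊗ F) ⊗ V`. -/
def inclLeft : (E ⊗[ℂ] F) ⊗[ℂ] V →ₗᵢ[ℂ] HilbertTensor (HilbertTensor E F) V :=
  (incl (HilbertTensor E F) V).comp (TensorProduct.mapIsometry (incl E F) .id)

/-- The inclusion of the algebraic tensor product `E ⊗ (F ⊗ V)`. -/
def inclRight : E ⊗[ℂ] (F ⊗[ℂ] V) →ₗᵢ[ℂ] HilbertTensor E (HilbertTensor F V) :=
  (incl E (HilbertTensor F V)).comp (TensorProduct.mapIsometry .id (incl F V))

theorem denseRange_inclLeft : DenseRange (inclLeft E F V) := by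
  have hdense : Dense (Submodule.span ℂ (Set.range (incl E F)) : Set (HilbertTensor E F)) :=
    (denseRange_incl E F).mono Submodule.subset_span
  refine (dense_span_image2_tmulL hdense (t := Set.univ) (by simp)).mono ?_
  refine Submodule.span_le (p := LinearMap.range (inclLeft E F V).toLinearMap).mpr ?_
  rintro _ ⟨_, ⟨z, rfl⟩, v, -, rfl⟩
  exact ⟨z ⊗ₜ v, rfl⟩

theorem denseRange_inclRight : DenseRange (inclRight E F V) := by
  have hdense : Dense (Submodule.span ℂ (Set.range (incl F V)) : Set (HilbertTensor F V)) :=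
    (denseRange_incl F V).mono Submodule.subset_span
  refine (dense_span_image2_tmulL (s := Set.univ) (by simp) hdense).mono ?_
  refine Submodule.span_le (p := LinearMap.range (inclRight E F V).toLinearMap).mpr ?_
  rintro _ ⟨x, -, _, ⟨z, rfl⟩, rfl⟩
  exact ⟨x ⊗ₜ z, rfl⟩

theorem norm_inclRight_assoc (z : (E ⊗[ℂ] F) ⊗[ℂ] V) :
    ‖inclRight E F V (TensorProduct.assoc ℂ E F V z)‖ = ‖inclLeft E F V z‖ := by
  rw [LinearIsometry.norm_map, LinearIsometry.norm_map, TensorProduct.norm_assoc]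

/-- The associativity isomorphism of Hilbert space tensor products. -/
def assoc :
    HilbertTensor (HilbertTensor E F) V ≃ₗᵢ[ℂ] HilbertTensor E (HilbertTensor F V) :=
  (TensorProduct.assoc ℂ E F V).extendOfIsometry (inclLeft E F V).toLinearMap
    (inclRight E F V).toLinearMap (denseRange_inclLeft E F V) (denseRange_inclRight E F V)
    (norm_inclRight_assoc E F V)

variable {E F V}

theorem assoc_tmulL (x : E) (y : F) (v : V) :
    assoc E F V (tmulL (tmulL x y) v) = tmulL x (tmulL y v) :=
  LinearEquiv.extendOfIsometry_eq (TensorProduct.assoc ℂ E F V) (inclLeft E F V).toLinearMap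
    (inclRight E F V).toLinearMap (denseRange_inclLeft E F V) (denseRange_inclRight E F V)
    (norm_inclRight_assoc E F V) ((x ⊗ₜ y) ⊗ₜ v)

theorem clm_ext₃ {K : Type*} [NormedAddCommGroup K] [NormedSpace ℂ K]
    {X Y : HilbertTensor (HilbertTensor E F) V →L[ℂ] K}
    (h : ∀ x y v, X (tmulL (tmulL x y) v) = Y (tmulL (tmulL x y) v)) : X = Y :=
  clm_ext_of_dense (s := Set.image2 (fun x y => tmulL x y) Set.univ Set.univ) (t := Set.univ)
    (dense_span_image2_tmulL (by simp) (by simp)) (by simp)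
    (Set.forall_mem_image2.mpr fun x _ y _ v _ => h x y v)

end Associator

end HilbertTensor

section TensorOp

open HilbertTensor

variable {E : Type u} {F : Type v} [NormedAddCommGroup E] [InnerProductSpace ℂ E]
  [NormedAddCommGroup F] [InnerProductSpace ℂ F]

theorem tensorOp_add_right (S : E →L[ℂ] E) (T T' : F →L[ℂ] F) :
    tensorOp S (T + T') = tensorOp S T + tensorOp S T' :=
  clm_ext fun x y => by simp [tensorOp_tmulL]

theorem tensorOp_smul_right (c : ℂ) (S : E →L[ℂ] E) (T : F →L[ℂ] F) :
    tensorOp S (c • T) = c • tensorOp S T :=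
  clm_ext fun x y => by simp [tensorOp_tmulL]

theorem norm_tensorOp_le (S : E →L[ℂ] E) (T : F →L[ℂ] F) : ‖tensorOp S T‖ ≤ ‖S‖ * ‖T‖ := by
  refine ContinuousLinearMap.opNorm_le_bound _ (by positivity) fun z => ?_
  refine (denseRange_incl E F).induction_on z (isClosed_le (by fun_prop) (by fun_prop)) fun t => ?_
  rw [tensorOp_incl, LinearIsometry.norm_map, LinearIsometry.norm_map]
  exact (TensorProduct.mapL S T).le_of_opNorm_le (TensorProduct.norm_mapL_le S T) t

/-- `(S, T) ↦ S ⊗ T` as a bilinear map. -/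
def tensorOpₗ (E : Type u) (F : Type v) [NormedAddCommGroup E] [InnerProductSpace ℂ E]
    [NormedAddCommGroup F] [InnerProductSpace ℂ F] :
    (E →L[ℂ] E) →ₗ[ℂ] (F →L[ℂ] F) →ₗ[ℂ] (HilbertTensor E F →L[ℂ] HilbertTensor E F) :=
  LinearMap.mk₂ ℂ tensorOp tensorOp_add_left tensorOp_smul_left tensorOp_add_right
    tensorOp_smul_right

theorem continuous_tensorOp :
    Continuous fun p : (E →L[ℂ] E) × (F →L[ℂ] F) => tensorOp p.1 p.2 :=
  ((tensorOpₗ E F).mkContinuous₂ 1 fun S T => by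
    rw [one_mul]
    exact norm_tensorOp_le S T).continuous₂

/-- The unital `*`-homomorphism `X ↦ X ⊗ 1` from operators on `E ⊗ F` to operators on
`E ⊗ (F ⊗ V)`. -/
def assocHom (E F V : Type*) [NormedAddCommGroup E] [InnerProductSpace ℂ E] [NormedAddCommGroup F]
    [InnerProductSpace ℂ F] [NormedAddCommGroup V] [InnerProductSpace ℂ V] [CompleteSpace V] :
    (HilbertTensor E F →L[ℂ] HilbertTensor E F) →⋆ₐ[ℂ]
      (HilbertTensor E (HilbertTensor F V) →L[ℂ] HilbertTensor E (HilbertTensor F V)) :=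
  (HilbertTensor.assoc E F V).conjStarAlgEquiv.toStarAlgHom.comp
    (amplify (HilbertTensor E F) V)

theorem assocHom_tensorOp {V : Type*} [NormedAddCommGroup V] [InnerProductSpace ℂ V]
    [CompleteSpace V] (X : E →L[ℂ] E) (Y : F →L[ℂ] F) :
    assocHom E F V (tensorOp X Y) = tensorOp X (tensorOp Y 1) := by
  let J := (HilbertTensor.assoc E F V).toContinuousLinearEquiv.toContinuousLinearMap
  have intertwines : J ∘L tensorOp (tensorOp X Y) 1 = tensorOp X (tensorOp Y 1) ∘L J :=
    clm_ext₃ fun x y v => by simp [J, tensorOp_tmulL, assoc_tmulL]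
  ext z
  simpa [J, assocHom, amplify] using
    DFunLike.congr_fun intertwines ((HilbertTensor.assoc E F V).symm z)

end TensorOp

/-! ### Diagonal operators -/

section Diagonal

variable {ι E : Type*} [NormedAddCommGroup E] [InnerProductSpace ℂ E]
  (b : HilbertBasis ι ℂ E) (μ : ι → ℝ)

/-- The graph of the maximal diagonal operator with eigenvalues `μᵢ`. -/
def diagGraph : Submodule ℂ (E × E) where
  carrier := {p | ∀ i, b.repr p.2 i = (μ i : ℂ) * b.repr p.1 i}
  add_mem' {p q} hp hq i := by simpa [mul_add] using congrArg₂ (· + ·) (hp i) (hq i)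
  zero_mem' i := by simp
  smul_mem' c p hp i := by simpa [mul_left_comm] using congrArg (c * ·) (hp i)

/-- The maximal diagonal operator with eigenvalues `μᵢ` with respect to the Hilbert basis `b`. -/
def diagOp : E →ₗ.[ℂ] E := (diagGraph b μ).toLinearPMap

theorem eq_of_forall_repr_eq {x y : E} (h : ∀ i, b.repr x i = b.repr y i) : x = y :=
  b.repr.injective (lp.ext (funext h))

theorem mem_graph_diagOp_iff {x y : E} :
    (x, y) ∈ (diagOp b μ).graph ↔ ∀ i, b.repr y i = (μ i : ℂ) * b.repr x i := by
  have graph_eq : (diagOp b μ).graph = diagGraph b μ :=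
    Submodule.toLinearPMap_graph_eq _ fun p hp hzero =>
      eq_of_forall_repr_eq b fun i => by simpa [hzero] using hp i
  rw [graph_eq]
  rfl

theorem isClosed_diagOp : (diagOp b μ).IsClosed := by
  have graph_eq : ((diagOp b μ).graph : Set (E × E)) =
      ⋂ i, {p | inner ℂ (b i) p.2 = (μ i : ℂ) * inner ℂ (b i) p.1} := by
    ext ⟨x, y⟩
    rw [SetLike.mem_coe, mem_graph_diagOp_iff, Set.mem_iInter]
    simp only [b.repr_apply_apply]
    rfl
  rw [LinearPMap.IsClosed, graph_eq]
  exact isClosed_iInter fun i => isClosed_eq (by fun_prop) (by fun_prop)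

theorem basis_mem_graph_diagOp (i : ι) : (b i, (μ i : ℂ) • b i) ∈ (diagOp b μ).graph := by
  classical
  refine (mem_graph_diagOp_iff b μ).mpr fun j => ?_
  simp only [map_smul, b.repr_self, lp.coeFn_smul, Pi.smul_apply, smul_eq_mul, lp.single_apply]
  obtain rfl | hji := eq_or_ne j i <;> simp [*]

theorem dense_span_range_hilbertBasis : Dense (Submodule.span ℂ (Set.range b) : Set E) :=
  Submodule.dense_iff_topologicalClosure_eq_top.mpr b.dense_span

theorem dense_domain_diagOp : Dense ((diagOp b μ).domain : Set E) := by
  refine (dense_span_range_hilbertBasis b).mono (Submodule.span_le.mpr ?_)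
  rintro _ ⟨i, rfl⟩
  exact LinearPMap.mem_domain_of_mem_graph (basis_mem_graph_diagOp b μ i)

theorem isSelfAdjoint_diagOp [CompleteSpace E] : IsSelfAdjoint (diagOp b μ) := by
  rw [LinearPMap.isSelfAdjoint_def]
  apply LinearPMap.eq_of_eq_graph
  rw [LinearPMap.adjoint_graph_eq_graph_adjoint (dense_domain_diagOp b μ)]
  ext ⟨x, y⟩
  rw [Submodule.mem_adjoint_iff, mem_graph_diagOp_iff]
  constructor
  · intro h i
    have hi := h _ _ (basis_mem_graph_diagOp b μ i)
    rw [sub_eq_zero, inner_smul_left, Complex.conj_ofReal] at hi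
    rw [b.repr_apply_apply, b.repr_apply_apply, hi]
  · intro h x' y' h'
    rw [mem_graph_diagOp_iff] at h'
    rw [sub_eq_zero, ← b.repr.inner_map_map, ← b.repr.inner_map_map x', lp.inner_eq_tsum,
      lp.inner_eq_tsum]
    refine tsum_congr fun i => ?_
    simp only [RCLike.inner_apply, h' i, h i, map_mul, Complex.conj_ofReal]
    ring

variable {b μ}

section Symmetric

variable {T : E →ₗ.[ℂ] E}

theorem inner_eq_of_isFormalAdjoint {T' : E →ₗ.[ℂ] E} (hT : T.IsFormalAdjoint T') {x y x' y' : E}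
    (h : (x, y) ∈ T.graph) (h' : (x', y') ∈ T'.graph) : inner ℂ y x' = inner ℂ x y' := by
  obtain ⟨ξ, rfl, rfl⟩ := T.mem_graph_iff.mp h
  obtain ⟨ξ', rfl, rfl⟩ := T'.mem_graph_iff.mp h'
  exact hT ξ ξ'

theorem le_diagOp (hT : T.IsFormalAdjoint T) (hb : ∀ i, (b i, (μ i : ℂ) • b i) ∈ T.graph) :
    T ≤ diagOp b μ := by
  refine LinearPMap.le_of_le_graph ?_
  rintro ⟨x, y⟩ hxy
  refine (mem_graph_diagOp_iff b μ).mpr fun i => ?_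
  rw [b.repr_apply_apply, b.repr_apply_apply, ← inner_eq_of_isFormalAdjoint hT (hb i) hxy,
    inner_smul_left, Complex.conj_ofReal]

theorem isClosable_of_eigenbasis (hT : T.IsFormalAdjoint T)
    (hb : ∀ i, (b i, (μ i : ℂ) • b i) ∈ T.graph) : T.IsClosable :=
  (isClosed_diagOp b μ).isClosable.leIsClosable (le_diagOp hT hb)

theorem closure_eq_diagOp (hT : T.IsFormalAdjoint T)
    (hb : ∀ i, (b i, (μ i : ℂ) • b i) ∈ T.graph) : T.closure = diagOp b μ := by
  apply LinearPMap.eq_of_eq_graph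
  rw [← (isClosable_of_eigenbasis hT hb).graph_closure_eq_closure_graph]
  refine le_antisymm (Submodule.topologicalClosure_minimal _
    (LinearPMap.le_graph_of_le (le_diagOp hT hb)) (isClosed_diagOp b μ)) ?_
  rintro ⟨x, y⟩ hxy
  rw [mem_graph_diagOp_iff] at hxy
  refine mem_closure_of_tendsto ((b.hasSum_repr x).prodMk (b.hasSum_repr y))
    (Filter.Eventually.of_forall fun s => Submodule.sum_mem _ fun i _ => ?_)
  have := T.graph.smul_mem (b.repr x i) (hb i)
  rwa [Prod.smul_mk, smul_smul, mul_comm, ← hxy] at this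

end Symmetric

section Bounded

variable (b)

/-- The bounded diagonal operator with eigenvalues `sᵢ`. -/
def diagCLM (s : ι → ℝ) (C : ℝ) (hs : ∀ i, |s i| ≤ C) : E →L[ℂ] E :=
  b.repr.symm.toContinuousLinearEquiv.toContinuousLinearMap ∘L
    weightedShift (E := fun _ : ι => ℂ) (Equiv.refl ι)
      (fun i => (s i : ℂ) • ContinuousLinearMap.id ℂ ℂ) C
      (fun i => by simpa [norm_smul] using hs i) ∘L
    b.repr.toContinuousLinearEquiv.toContinuousLinearMap

variable (s : ι → ℝ) (C : ℝ) (hs : ∀ i, |s i| ≤ C)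

theorem repr_diagCLM (x : E) (i : ι) :
    b.repr (diagCLM b s C hs x) i = (s i : ℂ) * b.repr x i := by
  change b.repr (b.repr.symm _) i = _
  rw [LinearIsometryEquiv.apply_symm_apply]
  rfl

theorem diagCLM_basis (i : ι) : diagCLM b s C hs (b i) = (s i : ℂ) • b i := by
  classical
  refine eq_of_forall_repr_eq b fun j => ?_
  rw [repr_diagCLM]
  simp only [map_smul, b.repr_self, lp.coeFn_smul, Pi.smul_apply, smul_eq_mul, lp.single_apply]
  obtain rfl | hji := eq_or_ne j i <;> simp [*]

theorem norm_diagCLM_le : ‖diagCLM b s C hs‖ ≤ |C| := by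
  refine ContinuousLinearMap.opNorm_le_bound _ (abs_nonneg _) fun x => ?_
  change ‖b.repr.symm _‖ ≤ _
  rw [LinearIsometryEquiv.norm_map, ← b.repr.norm_map x]
  exact norm_weightedShiftₗ_le (E := fun _ : ι => ℂ) (Equiv.refl ι)
      (fun i => (s i : ℂ) • ContinuousLinearMap.id ℂ ℂ) C
      (fun i => by simpa [norm_smul] using hs i) _

theorem isPositive_diagCLM (hpos : ∀ i, 0 ≤ s i) : (diagCLM b s C hs).IsPositive := by
  rw [ContinuousLinearMap.isPositive_iff_complex]
  intro x
  have inner_eq : inner ℂ (diagCLM b s C hs x) x = ((∑' i, s i * ‖b.repr x i‖ ^ 2 : ℝ) : ℂ) := by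
    rw [← b.repr.inner_map_map, lp.inner_eq_tsum, Complex.ofReal_tsum]
    refine tsum_congr fun i => ?_
    simp only [RCLike.inner_apply, repr_diagCLM, map_mul, Complex.conj_ofReal]
    rw [mul_left_comm, Complex.mul_conj]
    simp [Complex.normSq_eq_norm_sq]
  rw [inner_eq]
  refine ⟨by simp, ?_⟩
  simp only [RCLike.re_to_complex, Complex.ofReal_re]
  exact tsum_nonneg fun i => mul_nonneg (hpos i) (sq_nonneg _)

theorem diagCLM_eq_sum_rankOne (hfin : {i | s i ≠ 0}.Finite) :
    diagCLM b s C hs =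
      ∑ i ∈ hfin.toFinset, (s i : ℂ) • InnerProductSpace.rankOne ℂ (b i) (b i) := by
  classical
  refine ContinuousLinearMap.ext_on (dense_span_range_hilbertBasis b) ?_
  rintro _ ⟨j, rfl⟩
  rw [diagCLM_basis]
  obtain hj | hj := eq_or_ne (s j) 0 <;>
    simp [orthonormal_iff_ite.mp b.orthonormal, sum_apply, hj]

theorem isCompactOperator_rankOne (x y : E) :
    IsCompactOperator (InnerProductSpace.rankOne ℂ x y) :=
  ((isCompactOperator_id (E := ℂ)).comp_clm (innerSL ℂ y)).clm_comp
    (ContinuousLinearMap.toSpanSingleton ℂ x)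

theorem isCompactOperator_diagCLM_of_finite (hfin : {i | s i ≠ 0}.Finite) :
    IsCompactOperator (diagCLM b s C hs) := by
  rw [diagCLM_eq_sum_rankOne b s C hs hfin]
  exact (compactOperator (RingHom.id ℂ) E E).sum_mem fun i _ =>
    Submodule.smul_mem _ _ (isCompactOperator_rankOne (b i) (b i))

theorem isCompactOperator_diagCLM [CompleteSpace E] (hfin : ∀ ε > 0, {i | ε ≤ |s i|}.Finite) :
    IsCompactOperator (diagCLM b s C hs) := by
  classical
  refine (isClosed_setOfPred_isCompactOperator (σ₁₂ := RingHom.id ℂ)).closure_subset_iff.mpr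
    subset_rfl (Metric.mem_closure_iff.mpr fun ε hε => ?_)
  let t : ι → ℝ := fun i => if ε / 2 ≤ |s i| then s i else 0
  have abs_t_le (i) : |t i| ≤ C := by
    by_cases h : ε / 2 ≤ |s i|
    · simpa [t, h] using hs i
    · simpa [t, h] using (abs_nonneg _).trans (hs i)
  have abs_sub_le (i) : |s i - t i| ≤ ε / 2 := by
    by_cases h : ε / 2 ≤ |s i|
    · simpa [t, h] using (half_pos hε).le
    · simpa [t, h] using (not_le.mp h).le
  refine ⟨diagCLM b t C abs_t_le, isCompactOperator_diagCLM_of_finite b t C abs_t_le ?_, ?_⟩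
  · refine (hfin (ε / 2) (half_pos hε)).subset fun i hi => ?_
    by_contra h
    exact hi (if_neg h)
  · have sub_eq : diagCLM b s C hs - diagCLM b t C abs_t_le =
        diagCLM b (fun i => s i - t i) _ abs_sub_le := by
      ext x
      exact eq_of_forall_repr_eq b fun j => by simp [repr_diagCLM, sub_mul]
    rw [dist_eq_norm, sub_eq]
    refine (norm_diagCLM_le b _ _ abs_sub_le).trans_lt ?_
    rw [abs_of_pos (half_pos hε)]
    exact half_lt_self hε

end Bounded

theorem isInvSqrtOneAddSq_iff [CompleteSpace E] {D : E →ₗ.[ℂ] E} {S : E →L[ℂ] E} :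
    IsInvSqrtOneAddSq D S ↔ S.IsPositive ∧
      ∀ ξ, ∃ η, (S (S ξ), η) ∈ D.graph ∧ (η, ξ - S (S ξ)) ∈ D.graph := by
  refine and_congr_right fun _ => forall_congr' fun ξ => ⟨?_, ?_⟩
  · rintro ⟨h₁, h₂, h⟩
    refine ⟨D ⟨_, h₁⟩, D.mem_graph ⟨_, h₁⟩, ?_⟩
    rw [← eq_sub_of_add_eq' h]
    exact D.mem_graph ⟨_, h₂⟩
  · rintro ⟨η, h₁, h₂⟩
    have hx := LinearPMap.mem_domain_of_mem_graph h₁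
    obtain rfl : D ⟨_, hx⟩ = η := D.mem_graph_snd_inj (D.mem_graph ⟨_, hx⟩) h₁ rfl
    have hDx := LinearPMap.mem_domain_of_mem_graph h₂
    have DDx_eq := D.mem_graph_snd_inj (D.mem_graph ⟨_, hDx⟩) h₂ rfl
    exact ⟨hx, hDx, by rw [DDx_eq, add_sub_cancel]⟩

section InvSqrt

variable (b μ)

/-- The eigenvalues `(1 + μᵢ²)^(-1/2)` of `(1 + D²)^(-1/2)`, where `D` has eigenvalues `μᵢ`. -/
def invSqrtOneAddSq (i : ι) : ℝ := (√(1 + μ i ^ 2))⁻¹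

theorem invSqrtOneAddSq_nonneg (i : ι) : 0 ≤ invSqrtOneAddSq μ i :=
  inv_nonneg.mpr (Real.sqrt_nonneg _)

theorem abs_invSqrtOneAddSq_le_one (i : ι) : |invSqrtOneAddSq μ i| ≤ 1 := by
  rw [abs_of_nonneg (invSqrtOneAddSq_nonneg μ i)]
  exact inv_le_one_of_one_le₀ (Real.one_le_sqrt.mpr (by linarith [sq_nonneg (μ i)]))

theorem invSqrtOneAddSq_mul_self (i : ι) :
    invSqrtOneAddSq μ i * invSqrtOneAddSq μ i = (1 + μ i ^ 2)⁻¹ := by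
  rw [invSqrtOneAddSq, ← mul_inv, Real.mul_self_sqrt (by positivity)]

theorem abs_mul_invSqrtOneAddSq_mul_self_le_one (i : ι) :
    |μ i * (invSqrtOneAddSq μ i * invSqrtOneAddSq μ i)| ≤ 1 := by
  have hpos : 0 < 1 + μ i ^ 2 := by positivity
  rw [invSqrtOneAddSq_mul_self, abs_mul, abs_inv, abs_of_pos hpos, ← div_eq_mul_inv,
    div_le_one hpos]
  nlinarith [sq_abs (μ i), sq_nonneg (|μ i| - 1)]

variable [CompleteSpace E]

theorem isInvSqrtOneAddSq_diagCLM :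
    IsInvSqrtOneAddSq (diagOp b μ)
      (diagCLM b (invSqrtOneAddSq μ) 1 (abs_invSqrtOneAddSq_le_one μ)) := by
  refine isInvSqrtOneAddSq_iff.mpr ⟨isPositive_diagCLM b _ 1 _ (invSqrtOneAddSq_nonneg μ),
    fun ξ => ⟨diagCLM b _ 1 (abs_mul_invSqrtOneAddSq_mul_self_le_one μ) ξ,
      (mem_graph_diagOp_iff b μ).mpr fun i => ?_, (mem_graph_diagOp_iff b μ).mpr fun i => ?_⟩⟩
  · simp only [repr_diagCLM, Complex.ofReal_mul]
    ring
  · have one_sub_eq : (1 : ℂ) - (invSqrtOneAddSq μ i : ℂ) * invSqrtOneAddSq μ i =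
        μ i * (μ i * (invSqrtOneAddSq μ i * invSqrtOneAddSq μ i)) := by
      have hpos : 1 + μ i ^ 2 ≠ 0 := by positivity
      norm_cast
      rw [invSqrtOneAddSq_mul_self]
      field_simp
      ring
    simp only [map_sub, lp.coeFn_sub, Pi.sub_apply, repr_diagCLM, Complex.ofReal_mul]
    linear_combination b.repr ξ i * one_sub_eq

theorem exists_isInvSqrtOneAddSq_diagOp (hμ : ∀ N : ℝ, {i | |μ i| ≤ N}.Finite) :
    ∃ S : E →L[ℂ] E, IsInvSqrtOneAddSq (diagOp b μ) S ∧ IsCompactOperator S := by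
  refine ⟨_, isInvSqrtOneAddSq_diagCLM b μ,
    isCompactOperator_diagCLM b _ _ _ fun ε hε => (hμ ε⁻¹).subset fun i hi => ?_⟩
  rw [Set.mem_ofPred_eq, abs_of_nonneg (invSqrtOneAddSq_nonneg μ i)] at hi
  calc |μ i| ≤ √(1 + μ i ^ 2) := Real.abs_le_sqrt (by linarith)
    _ ≤ ε⁻¹ := (le_inv_comm₀ (by positivity) hε).mpr hi

end InvSqrt

end Diagonal

/-! ### Bounded commutators -/

section Commutator

variable {E : Type*} [NormedAddCommGroup E] [InnerProductSpace ℂ E]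

theorem hasBoundedCommutator_iff {D : E →ₗ.[ℂ] E} {T : E →L[ℂ] E} :
    HasBoundedCommutator D T ↔
      ∃ C : E →L[ℂ] E, ∀ x y, (x, y) ∈ D.graph → (T x, T y + C x) ∈ D.graph := by
  constructor
  · rintro ⟨h, C, hC⟩
    refine ⟨C, fun x y hxy => ?_⟩
    obtain ⟨ξ, rfl, rfl⟩ := (LinearPMap.mem_graph_iff D).mp hxy
    exact (LinearPMap.mem_graph_iff D).mpr ⟨⟨T ξ, h ξ⟩, rfl, by rw [← hC ξ]; simp⟩
  · rintro ⟨C, hC⟩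
    refine ⟨fun ξ => LinearPMap.mem_domain_of_mem_graph (hC _ _ (D.mem_graph ξ)), C, fun ξ => ?_⟩
    have h1 := hC _ _ (D.mem_graph ξ)
    have h2 := D.mem_graph ⟨T ξ, LinearPMap.mem_domain_of_mem_graph h1⟩
    rw [D.mem_graph_snd_inj h2 h1 rfl]
    abel

variable {D : E →ₗ.[ℂ] E}

/-- The subspace of bounded operators whose commutator with `D` is bounded. -/
def boundedCommutators (D : E →ₗ.[ℂ] E) : Submodule ℂ (E →L[ℂ] E) where
  carrier := {T | HasBoundedCommutator D T}
  zero_mem' := hasBoundedCommutator_iff.mpr ⟨0, fun x y _ => by simp⟩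
  add_mem' {S T} hS hT := by
    obtain ⟨C, hC⟩ := hasBoundedCommutator_iff.mp hS
    obtain ⟨C', hC'⟩ := hasBoundedCommutator_iff.mp hT
    refine hasBoundedCommutator_iff.mpr ⟨C + C', fun x y h => ?_⟩
    have := D.graph.add_mem (hC x y h) (hC' x y h)
    rw [Prod.mk_add_mk, add_add_add_comm] at this
    exact this
  smul_mem' c T hT := by
    obtain ⟨C, hC⟩ := hasBoundedCommutator_iff.mp hT
    refine hasBoundedCommutator_iff.mpr ⟨c • C, fun x y h => ?_⟩
    have := D.graph.smul_mem c (hC x y h)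
    rw [Prod.smul_mk, smul_add] at this
    exact this

theorem HasBoundedCommutator.mul {S T : E →L[ℂ] E} (hS : HasBoundedCommutator D S)
    (hT : HasBoundedCommutator D T) : HasBoundedCommutator D (S * T) := by
  obtain ⟨C, hC⟩ := hasBoundedCommutator_iff.mp hS
  obtain ⟨C', hC'⟩ := hasBoundedCommutator_iff.mp hT
  refine hasBoundedCommutator_iff.mpr ⟨S * C' + C * T, fun x y h => ?_⟩
  have := hC _ _ (hC' x y h)
  simp only [map_add] at this
  simpa [add_assoc] using this

theorem mem_graph_closure_of_forall_mem_graph (hD : D.IsClosable) (T S₁ S₂ : E →L[ℂ] E)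
    (h : ∀ x y, (x, y) ∈ D.graph → (T x, S₁ y + S₂ x) ∈ D.graph) (x y : E)
    (hxy : (x, y) ∈ D.closure.graph) : (T x, S₁ y + S₂ x) ∈ D.closure.graph := by
  rw [← hD.graph_closure_eq_closure_graph] at hxy ⊢
  have hc : Continuous fun p : E × E => (T p.1, S₁ p.2 + S₂ p.1) := by fun_prop
  exact map_mem_closure (f := fun p : E × E => (T p.1, S₁ p.2 + S₂ p.1)) hc hxy
    fun p hp => h p.1 p.2 hp

theorem HasBoundedCommutator.closure (hD : D.IsClosable) {T : E →L[ℂ] E}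
    (hT : HasBoundedCommutator D T) : HasBoundedCommutator D.closure T := by
  obtain ⟨C, hC⟩ := hasBoundedCommutator_iff.mp hT
  exact hasBoundedCommutator_iff.mpr ⟨C, mem_graph_closure_of_forall_mem_graph hD T T C hC⟩

end Commutator

theorem mem_graph_pmapOfParam {X E : Type*} [AddCommGroup X] [Module ℂ X] [AddCommGroup E]
    [Module ℂ E] (e : X →ₗ[ℂ] E) (he : Function.Injective e) (d : X →ₗ[ℂ] E) {x y : E} :
    (x, y) ∈ (pmapOfParam e he d).graph ↔ ∃ t, e t = x ∧ d t = y := by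
  have apply_param (t) (h : e t ∈ (pmapOfParam e he d).domain) :
      pmapOfParam e he d ⟨e t, h⟩ = d t :=
    congrArg d ((LinearEquiv.ofInjective e he).symm_apply_apply t)
  rw [LinearPMap.mem_graph_iff]
  constructor
  · rintro ⟨⟨_, t, rfl⟩, rfl, rfl⟩
    exact ⟨t, rfl, (apply_param t _).symm⟩
  · rintro ⟨t, rfl, rfl⟩
    exact ⟨⟨e t, t, rfl⟩, rfl, apply_param t _⟩

/-! ### The Dirac operator of an exterior product -/

section OffDiag

variable {E : Type*} [NormedAddCommGroup E] [InnerProductSpace ℂ E]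

theorem doubleOp_toLp (T : E →L[ℂ] E) (x y : E) :
    doubleOp T (WithLp.toLp 2 (x, y)) = WithLp.toLp 2 (T x, T y) := rfl

theorem stdGrading_toLp (x y : E) :
    stdGrading E (WithLp.toLp 2 (x, y)) = WithLp.toLp 2 (x, -y) := rfl

/-- The operator with matrix `((0, P), (Q, 0))` on `E ⊕ E`. -/
def offDiagOp (P Q : E →L[ℂ] E) : Double E →L[ℂ] Double E :=
  (WithLp.prodContinuousLinearEquiv 2 ℂ E E).symm.toContinuousLinearMap ∘L
    ((P ∘L ContinuousLinearMap.snd ℂ E E).prod (Q ∘L ContinuousLinearMap.fst ℂ E E)) ∘L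
      (WithLp.prodContinuousLinearEquiv 2 ℂ E E).toContinuousLinearMap

theorem offDiagOp_toLp (P Q : E →L[ℂ] E) (x y : E) :
    offDiagOp P Q (WithLp.toLp 2 (x, y)) = WithLp.toLp 2 (P y, Q x) := rfl

end OffDiag

section ProdDirac

open HilbertTensor

variable {H₁ : Type u} [NormedAddCommGroup H₁] [InnerProductSpace ℂ H₁]
  {H₂ : Type v} [NormedAddCommGroup H₂] [InnerProductSpace ℂ H₂]
  {D₁ : H₁ →ₗ.[ℂ] H₁} {D₂ : H₂ →ₗ.[ℂ] H₂}

theorem coreIncl_tmul {E : Submodule ℂ H₁} {F : Submodule ℂ H₂} (x : E) (y : F) :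
    coreIncl E F (x ⊗ₜ y) = tmulL (x : H₁) (y : H₂) := rfl

theorem tensorSum_tmul (r : ℂ) (x : D₁.domain) (y : D₂.domain) :
    tensorSum D₁ D₂ r (x ⊗ₜ y) = tmulL (D₁ x) (y : H₂) + r • tmulL (x : H₁) (D₂ y) := by
  simp only [tensorSum, LinearMap.comp_apply, LinearMap.add_apply, LinearMap.smul_apply,
    TensorProduct.map_tmul, map_add, map_smul]
  rfl

theorem mem_graph_prodDiracCore {p q : Double (HilbertTensor H₁ H₂)} :
    (p, q) ∈ (prodDiracCore D₁ D₂).graph ↔ ∃ s t : D₁.domain ⊗[ℂ] D₂.domain,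
      WithLp.toLp 2 (coreIncl _ _ s, coreIncl _ _ t) = p ∧
      WithLp.toLp 2 (tensorSum D₁ D₂ (-Complex.I) t, tensorSum D₁ D₂ Complex.I s) = q := by
  rw [prodDiracCore, mem_graph_pmapOfParam]
  exact Prod.exists

theorem inner_tensorSum_left (h₁ : D₁.IsFormalAdjoint D₁) (h₂ : D₂.IsFormalAdjoint D₂) (r : ℂ)
    (s t : D₁.domain ⊗[ℂ] D₂.domain) :
    inner ℂ (tensorSum D₁ D₂ r s) (coreIncl _ _ t) =
      inner ℂ (coreIncl _ _ s) (tensorSum D₁ D₂ (starRingEnd ℂ r) t) := by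
  induction s using TensorProduct.induction_on with
  | zero => simp
  | add s s' hs hs' => simp only [map_add, inner_add_left, hs, hs']
  | tmul x y =>
    induction t using TensorProduct.induction_on with
    | zero => simp
    | add t t' ht ht' => simp only [map_add, inner_add_right, ht, ht']
    | tmul x' y' =>
      simp only [coreIncl_tmul, tensorSum_tmul, inner_add_left, inner_add_right, inner_smul_left,
        inner_smul_right, inner_tmulL, h₁ x x', h₂ y y']

theorem isFormalAdjoint_prodDiracCore (h₁ : D₁.IsFormalAdjoint D₁) (h₂ : D₂.IsFormalAdjoint D₂) :
    (prodDiracCore D₁ D₂).IsFormalAdjoint (prodDiracCore D₁ D₂) := by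
  intro p q
  obtain ⟨s, t, hp, hp'⟩ := mem_graph_prodDiracCore.mp ((prodDiracCore D₁ D₂).mem_graph p)
  obtain ⟨s', t', hq, hq'⟩ := mem_graph_prodDiracCore.mp ((prodDiracCore D₁ D₂).mem_graph q)
  rw [← hp, ← hp', ← hq, ← hq']
  simp only [WithLp.prod_inner_apply, inner_tensorSum_left h₁ h₂, map_neg, Complex.conj_I, neg_neg]
  exact add_comm _ _

section Restriction

variable {X : H₁ →L[ℂ] H₁} {Y : H₂ →L[ℂ] H₂}

theorem coreIncl_map {E : Submodule ℂ H₁} {F : Submodule ℂ H₂} {X' : E →ₗ[ℂ] E} {Y' : F →ₗ[ℂ] F}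
    (hX : ∀ x, (X' x : H₁) = X x) (hY : ∀ y, (Y' y : H₂) = Y y) (t : E ⊗[ℂ] F) :
    coreIncl E F (TensorProduct.map X' Y' t) = tensorOp X Y (coreIncl E F t) := by
  induction t using TensorProduct.induction_on with
  | zero => simp
  | add s t hs ht => simp only [map_add, hs, ht]
  | tmul x y =>
    rw [TensorProduct.map_tmul, coreIncl_tmul, coreIncl_tmul, tensorOp_tmulL, hX, hY]

theorem tensorSum_map {C₁ : H₁ →L[ℂ] H₁} {C₂ : H₂ →L[ℂ] H₂}
    {X' : D₁.domain →ₗ[ℂ] D₁.domain} {Y' : D₂.domain →ₗ[ℂ] D₂.domain}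
    (hX : ∀ x, (X' x : H₁) = X x) (hY : ∀ y, (Y' y : H₂) = Y y)
    (hC₁ : ∀ x, D₁ (X' x) = X (D₁ x) + C₁ x) (hC₂ : ∀ y, D₂ (Y' y) = Y (D₂ y) + C₂ y)
    (r : ℂ) (t : D₁.domain ⊗[ℂ] D₂.domain) :
    tensorSum D₁ D₂ r (TensorProduct.map X' Y' t) =
      tensorOp X Y (tensorSum D₁ D₂ r t) +
        (tensorOp C₁ Y + r • tensorOp X C₂) (coreIncl _ _ t) := by
  induction t using TensorProduct.induction_on with
  | zero => simp
  | add s t hs ht =>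
    simp only [map_add, hs, ht]
    abel
  | tmul x y =>
    rw [TensorProduct.map_tmul, coreIncl_tmul, tensorSum_tmul, tensorSum_tmul, hC₁, hC₂, hX, hY]
    simp only [map_add, map_smul, add_apply, smul_apply, tensorOp_tmulL, smul_add]
    abel

theorem HasBoundedCommutator.prodDirac (hX : HasBoundedCommutator D₁ X)
    (hY : HasBoundedCommutator D₂ Y) (hcl : (prodDiracCore D₁ D₂).IsClosable) :
    HasBoundedCommutator (prodDirac D₁ D₂) (doubleOp (tensorOp X Y)) := by
  obtain ⟨hX, C₁, hC₁⟩ := hX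
  obtain ⟨hY, C₂, hC₂⟩ := hY
  let X' : D₁.domain →ₗ[ℂ] D₁.domain := (X.toLinearMap ∘ₗ D₁.domain.subtype).codRestrict _ hX
  let Y' : D₂.domain →ₗ[ℂ] D₂.domain := (Y.toLinearMap ∘ₗ D₂.domain.subtype).codRestrict _ hY
  have apply_X' (x) : D₁ (X' x) = X (D₁ x) + C₁ x := eq_add_of_sub_eq' (hC₁ x)
  have apply_Y' (y) : D₂ (Y' y) = Y (D₂ y) + C₂ y := eq_add_of_sub_eq' (hC₂ y)
  refine HasBoundedCommutator.closure hcl (hasBoundedCommutator_iff.mpr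
    ⟨offDiagOp (tensorOp C₁ Y + -Complex.I • tensorOp X C₂)
      (tensorOp C₁ Y + Complex.I • tensorOp X C₂), fun p q hpq => ?_⟩)
  obtain ⟨s, t, rfl, rfl⟩ := mem_graph_prodDiracCore.mp hpq
  refine mem_graph_prodDiracCore.mpr ⟨TensorProduct.map X' Y' s, TensorProduct.map X' Y' t, ?_, ?_⟩
  · rw [coreIncl_map (fun _ => rfl) (fun _ => rfl), coreIncl_map (fun _ => rfl) (fun _ => rfl),
      doubleOp_toLp]
  · rw [tensorSum_map (fun _ => rfl) (fun _ => rfl) apply_X' apply_Y',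
      tensorSum_map (fun _ => rfl) (fun _ => rfl) apply_X' apply_Y', doubleOp_toLp, offDiagOp_toLp]
    rfl

end Restriction

theorem stdGrading_mem_graph_prodDirac (hcl : (prodDiracCore D₁ D₂).IsClosable)
    {p q : Double (HilbertTensor H₁ H₂)} (h : (p, q) ∈ (prodDirac D₁ D₂).graph) :
    (stdGrading _ p, -stdGrading _ q) ∈ (prodDirac D₁ D₂).graph := by
  have mem_core (p q) (hpq : (p, q) ∈ (prodDiracCore D₁ D₂).graph) :
      (stdGrading _ p, (-stdGrading _) q + (0 : _ →L[ℂ] _) p) ∈ (prodDiracCore D₁ D₂).graph := by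
    obtain ⟨s, t, rfl, rfl⟩ := mem_graph_prodDiracCore.mp hpq
    refine mem_graph_prodDiracCore.mpr ⟨s, -t, ?_, ?_⟩
    · rw [stdGrading_toLp, map_neg]
    · rw [map_neg, zero_apply, add_zero, neg_apply, stdGrading_toLp, ← WithLp.toLp_neg,
        Prod.neg_mk, neg_neg]
  have mem_closure := mem_graph_closure_of_forall_mem_graph hcl _ _ _ mem_core p q h
  rwa [zero_apply, add_zero, neg_apply] at mem_closure

theorem stdGrading_anticommutes_prodDirac
    (hcl : (prodDiracCore D₁ D₂).IsClosable) :
    ∃ h : ∀ ξ : (prodDirac D₁ D₂).domain, stdGrading _ ξ.1 ∈ (prodDirac D₁ D₂).domain,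
      ∀ ξ : (prodDirac D₁ D₂).domain,
        prodDirac D₁ D₂ ⟨stdGrading _ ξ.1, h ξ⟩ = -stdGrading _ (prodDirac D₁ D₂ ξ) := by
  have mem_graph (ξ : (prodDirac D₁ D₂).domain) :=
    stdGrading_mem_graph_prodDirac hcl ((prodDirac D₁ D₂).mem_graph ξ)
  exact ⟨fun ξ => LinearPMap.mem_domain_of_mem_graph (mem_graph ξ),
    fun ξ => ((LinearPMap.image_iff _).mpr (mem_graph ξ)).symm⟩

end ProdDirac

/-! ### Eigenvectors of the exterior product operator -/

section Eigen

open HilbertTensor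

/-- The phase of a complex number, with value `1` at `0`. -/
def phase (z : ℂ) : ℂ := Complex.exp (z.arg * Complex.I)

theorem norm_mul_phase (z : ℂ) : (‖z‖ : ℂ) * phase z = z := Complex.norm_mul_exp_arg_mul_I z

theorem conj_phase_mul_phase (z : ℂ) : starRingEnd ℂ (phase z) * phase z = 1 := by
  rw [Complex.conj_mul', phase, Complex.norm_exp_ofReal_mul_I]
  simp

theorem conj_mul_phase (z : ℂ) : starRingEnd ℂ z * phase z = ‖z‖ := by
  conv_lhs => enter [1]; rw [← norm_mul_phase z]
  rw [map_mul, Complex.conj_ofReal, mul_assoc, conj_phase_mul_phase, mul_one]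

variable {ι κ : Type*} {H₁ : Type u} [NormedAddCommGroup H₁] [InnerProductSpace ℂ H₁]
  {H₂ : Type v} [NormedAddCommGroup H₂] [InnerProductSpace ℂ H₂]
  (b : HilbertBasis ι ℂ H₁) (c : HilbertBasis κ ℂ H₂) (μ : ι → ℝ) (ν : κ → ℝ)

/-- The complex number `μᵢ + i νⱼ`, by which `D₁ ⊗ 1 + i 1 ⊗ D₂` acts on `bᵢ ⊗ cⱼ` when
`D₁ bᵢ = μᵢ bᵢ` and `D₂ cⱼ = νⱼ cⱼ`. -/
def eigenPair (p : ι × κ) : ℂ := μ p.1 + ν p.2 * Complex.I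

/-- The eigenvectors of the exterior product operator: on the span of `(bᵢ ⊗ cⱼ, 0)` and
`(0, bᵢ ⊗ cⱼ)` it acts by the matrix `((0, z̄), (z, 0))` with `z = μᵢ + i νⱼ`, whose unit
eigenvectors are `(1, ± z / |z|) / √2`. -/
def prodEigenvector (p : (ι × κ) × ℤˣ) : Double (HilbertTensor H₁ H₂) :=
  (((√2)⁻¹ : ℝ) : ℂ) • WithLp.toLp 2 (tmulL (b p.1.1) (c p.1.2),
    (((p.2 : ℤ) : ℂ) * phase (eigenPair μ ν p.1)) • tmulL (b p.1.1) (c p.1.2))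

theorem inv_sqrt_two_mul_self : (((√2)⁻¹ : ℝ) : ℂ) * (((√2)⁻¹ : ℝ) : ℂ) = 1 / 2 := by
  rw [← Complex.ofReal_mul, ← mul_inv, Real.mul_self_sqrt (by norm_num)]
  norm_num

theorem orthonormal_prodEigenvector : Orthonormal ℂ (prodEigenvector b c μ ν) := by
  classical
  rw [orthonormal_iff_ite]
  rintro ⟨⟨i, j⟩, s⟩ ⟨⟨i', j'⟩, s'⟩
  simp only [prodEigenvector, inner_smul_left, inner_smul_right, WithLp.prod_inner_apply,
    inner_tmulL, orthonormal_iff_ite.mp b.orthonormal, orthonormal_iff_ite.mp c.orthonormal,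
    Complex.conj_ofReal, map_mul, map_intCast]
  by_cases h : i = i' ∧ j = j'
  · obtain ⟨rfl, rfl⟩ := h
    have half_mul_eq : (((s : ℤ) : ℂ) * (s' : ℤ) + 1) * (1 / 2) = if s = s' then 1 else 0 := by
      obtain rfl | rfl := Int.units_eq_one_or s <;> obtain rfl | rfl := Int.units_eq_one_or s' <;>
        norm_num
    simp only [if_true, Prod.mk.injEq, true_and, ← half_mul_eq, ← inv_sqrt_two_mul_self]
    linear_combination ((((√2)⁻¹ : ℝ) : ℂ) * (((√2)⁻¹ : ℝ) : ℂ)) *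
      (((s : ℤ) : ℂ) * (s' : ℤ)) * conj_phase_mul_phase (eigenPair μ ν (i, j))
  · rw [if_neg fun h' => h (Prod.mk.inj (Prod.mk.inj h').1)]
    rcases not_and_or.mp h with h | h <;> simp [h]

theorem topologicalClosure_eq_top_of_toLp_tmulL_mem {s : Set H₁} {t : Set H₂}
    (hs : Dense (Submodule.span ℂ s : Set H₁)) (ht : Dense (Submodule.span ℂ t : Set H₂))
    {P : Submodule ℂ (Double (HilbertTensor H₁ H₂))}
    (hl : ∀ x ∈ s, ∀ y ∈ t, WithLp.toLp 2 (tmulL x y, 0) ∈ P)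
    (hr : ∀ x ∈ s, ∀ y ∈ t, WithLp.toLp 2 (0, tmulL x y) ∈ P) :
    P.topologicalClosure = ⊤ := by
  let e := (WithLp.prodContinuousLinearEquiv 2 ℂ (HilbertTensor H₁ H₂)
    (HilbertTensor H₁ H₂)).symm.toContinuousLinearMap
  have mem_of_comap (f : HilbertTensor H₁ H₂ →L[ℂ] Double (HilbertTensor H₁ H₂))
      (hf : ∀ x ∈ s, ∀ y ∈ t, f (tmulL x y) ∈ P) (x) : f x ∈ P.topologicalClosure :=
    have x_mem : x ∈ (P.comap f.toLinearMap).topologicalClosure :=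
      (topologicalClosure_eq_top_of_tmulL_mem hs ht hf).ge Submodule.mem_top
    map_mem_closure f.continuous x_mem fun _ h => h
  refine eq_top_iff.mpr fun p _ => ?_
  have p_eq : p = (e ∘L ContinuousLinearMap.inl ℂ _ _) p.fst +
      (e ∘L ContinuousLinearMap.inr ℂ _ _) p.snd := by
    rw [ContinuousLinearMap.comp_apply, ContinuousLinearMap.comp_apply, ← map_add,
      ContinuousLinearMap.inl_apply, ContinuousLinearMap.inr_apply, Prod.mk_add_mk, add_zero,
      zero_add]
    rfl
  rw [p_eq]
  exact add_mem (mem_of_comap _ hl _) (mem_of_comap _ hr _)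

theorem toLp_tmulL_zero_eq (i : ι) (j : κ) :
    WithLp.toLp 2 (tmulL (b i) (c j), 0) = (((√2)⁻¹ : ℝ) : ℂ) •
      (prodEigenvector b c μ ν ((i, j), 1) + prodEigenvector b c μ ν ((i, j), -1)) := by
  simp only [prodEigenvector, ← smul_add, smul_smul, inv_sqrt_two_mul_self, ← WithLp.toLp_add,
    ← WithLp.toLp_smul, Prod.mk_add_mk, Prod.smul_mk]
  congr 2
  · module
  · simp

theorem toLp_zero_tmulL_eq (i : ι) (j : κ) :
    WithLp.toLp 2 (0, tmulL (b i) (c j)) =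
      (starRingEnd ℂ (phase (eigenPair μ ν (i, j))) * (((√2)⁻¹ : ℝ) : ℂ)) •
        (prodEigenvector b c μ ν ((i, j), 1) - prodEigenvector b c μ ν ((i, j), -1)) := by
  simp only [prodEigenvector, smul_smul, ← WithLp.toLp_sub, ← WithLp.toLp_smul,
    Prod.mk_sub_mk, Prod.smul_mk, sub_self, smul_zero, ← sub_smul]
  congr 2
  conv_lhs => rw [← one_smul ℂ (tmulL (b i) (c j))]
  congr 1
  have half_eq := inv_sqrt_two_mul_self
  push_cast at half_eq ⊢
  linear_combination (-1 : ℂ) * conj_phase_mul_phase (eigenPair μ ν (i, j)) -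
    2 * starRingEnd ℂ (phase (eigenPair μ ν (i, j))) * phase (eigenPair μ ν (i, j)) * half_eq

theorem topologicalClosure_span_prodEigenvector :
    (Submodule.span ℂ (Set.range (prodEigenvector b c μ ν))).topologicalClosure = ⊤ := by
  have mem_span (p) := Submodule.subset_span (R := ℂ) (Set.mem_range_self
    (f := prodEigenvector b c μ ν) p)
  refine topologicalClosure_eq_top_of_toLp_tmulL_mem (dense_span_range_hilbertBasis b)
    (dense_span_range_hilbertBasis c) ?_ ?_ <;> rintro _ ⟨i, rfl⟩ _ ⟨j, rfl⟩
  · rw [toLp_tmulL_zero_eq b c μ ν]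
    exact Submodule.smul_mem _ _ (add_mem (mem_span _) (mem_span _))
  · rw [toLp_zero_tmulL_eq b c μ ν]
    exact Submodule.smul_mem _ _ (sub_mem (mem_span _) (mem_span _))

/-- The Hilbert basis of eigenvectors of the exterior product operator. -/
def prodEigenbasis : HilbertBasis ((ι × κ) × ℤˣ) ℂ (Double (HilbertTensor H₁ H₂)) :=
  HilbertBasis.mk (orthonormal_prodEigenvector b c μ ν)
    (topologicalClosure_span_prodEigenvector b c μ ν).ge

/-- The eigenvalues `± |μᵢ + i νⱼ|` of the exterior product operator. -/
def prodEigenvalue (p : (ι × κ) × ℤˣ) : ℝ := (p.2 : ℤ) * ‖eigenPair μ ν p.1‖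

theorem abs_prodEigenvalue (p : (ι × κ) × ℤˣ) :
    |prodEigenvalue μ ν p| = ‖eigenPair μ ν p.1‖ := by
  rw [prodEigenvalue, abs_mul, abs_norm, ← Int.cast_abs, Int.isUnit_iff_abs_eq.mp p.2.isUnit,
    Int.cast_one, one_mul]

theorem finite_prodEigenvalue (hμ : ∀ N : ℝ, {i | |μ i| ≤ N}.Finite)
    (hν : ∀ N : ℝ, {j | |ν j| ≤ N}.Finite) (N : ℝ) :
    {p | |prodEigenvalue μ ν p| ≤ N}.Finite := by
  refine (((hμ N).prod (hν N)).prod Set.finite_univ).subset ?_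
  rintro ⟨p, s⟩ (h : |prodEigenvalue μ ν (p, s)| ≤ N)
  rw [abs_prodEigenvalue] at h
  refine ⟨⟨le_trans ?_ h, le_trans ?_ h⟩, trivial⟩
  · simpa [eigenPair] using Complex.abs_re_le_norm (eigenPair μ ν p)
  · simpa [eigenPair] using Complex.abs_im_le_norm (eigenPair μ ν p)

variable {b c μ ν} {D₁ : H₁ →ₗ.[ℂ] H₁} {D₂ : H₂ →ₗ.[ℂ] H₂}

theorem tensorSum_tmul_of_eigenvector {x : D₁.domain} {y : D₂.domain} {m n : ℂ}
    (hx : D₁ x = m • (x : H₁)) (hy : D₂ y = n • (y : H₂)) (r : ℂ) :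
    tensorSum D₁ D₂ r (x ⊗ₜ y) = (m + r * n) • tmulL (x : H₁) (y : H₂) := by
  simp only [tensorSum_tmul, hx, hy, map_smul, smul_apply, smul_smul, add_smul]

theorem prodEigenvector_mem_graph
    (hb : ∀ i, (b i, (μ i : ℂ) • b i) ∈ D₁.graph) (hc : ∀ j, (c j, (ν j : ℂ) • c j) ∈ D₂.graph)
    (p : (ι × κ) × ℤˣ) :
    (prodEigenvector b c μ ν p, (prodEigenvalue μ ν p : ℂ) • prodEigenvector b c μ ν p) ∈
      (prodDiracCore D₁ D₂).graph := by
  obtain ⟨⟨i, j⟩, s⟩ := p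
  obtain ⟨x, hx, D₁x⟩ := (LinearPMap.mem_graph_iff _).mp (hb i)
  obtain ⟨y, hy, D₂y⟩ := (LinearPMap.mem_graph_iff _).mp (hc j)
  dsimp only at hx D₁x hy D₂y
  rw [← hx] at D₁x
  rw [← hy] at D₂y
  set z := eigenPair μ ν (i, j) with hz
  have add_I_mul : (μ i : ℂ) + Complex.I * ν j = z := by rw [hz, eigenPair, mul_comm]
  have sub_I_mul : (μ i : ℂ) + -Complex.I * ν j = starRingEnd ℂ z := by
    simp [hz, eigenPair, mul_comm]
  have sign_mul_self : (((s : ℤ) : ℂ)) * (s : ℤ) = 1 := by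
    obtain rfl | rfl := Int.units_eq_one_or s <;> simp
  rw [prodEigenvector, smul_comm]
  refine (prodDiracCore D₁ D₂).graph.smul_mem (((√2)⁻¹ : ℝ) : ℂ) (mem_graph_prodDiracCore.mpr
    ⟨x ⊗ₜ y, (((s : ℤ) : ℂ) * phase z) • x ⊗ₜ y, ?_, ?_⟩)
  · rw [map_smul, coreIncl_tmul, hx, hy]
  · rw [map_smul, tensorSum_tmul_of_eigenvector D₁x D₂y, tensorSum_tmul_of_eigenvector D₁x D₂y,
      add_I_mul, sub_I_mul, hx, hy, ← WithLp.toLp_smul, Prod.smul_mk, smul_smul, smul_smul,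
      prodEigenvalue, ← hz]
    congr 3
    · rw [mul_assoc, mul_comm (phase z), conj_mul_phase]
      push_cast
      rfl
    · push_cast
      linear_combination -norm_mul_phase z - (‖z‖ : ℂ) * phase z * sign_mul_self

theorem isClosable_prodDiracCore (h₁ : D₁.IsFormalAdjoint D₁) (h₂ : D₂.IsFormalAdjoint D₂)
    (hb : ∀ i, (b i, (μ i : ℂ) • b i) ∈ D₁.graph) (hc : ∀ j, (c j, (ν j : ℂ) • c j) ∈ D₂.graph) :
    (prodDiracCore D₁ D₂).IsClosable :=
  isClosable_of_eigenbasis (b := prodEigenbasis b c μ ν) (isFormalAdjoint_prodDiracCore h₁ h₂)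
    fun p => by
      rw [prodEigenbasis, HilbertBasis.coe_mk]
      exact prodEigenvector_mem_graph hb hc p

theorem prodDirac_eq_diagOp (h₁ : D₁.IsFormalAdjoint D₁) (h₂ : D₂.IsFormalAdjoint D₂)
    (hb : ∀ i, (b i, (μ i : ℂ) • b i) ∈ D₁.graph) (hc : ∀ j, (c j, (ν j : ℂ) • c j) ∈ D₂.graph) :
    prodDirac D₁ D₂ = diagOp (prodEigenbasis b c μ ν) (prodEigenvalue μ ν) :=
  closure_eq_diagOp (isFormalAdjoint_prodDiracCore h₁ h₂) fun p => by
    rw [prodEigenbasis, HilbertBasis.coe_mk]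
    exact prodEigenvector_mem_graph hb hc p

end Eigen

/-! ### Eigenbases of operators with compact resolvent -/

section CompactResolvent

theorem finite_setOf_le_abs_eigenvalue {ι E : Type*} [NormedAddCommGroup E]
    [InnerProductSpace ℂ E] {K : E →L[ℂ] E} (hK : IsCompactOperator K) {e : ι → E}
    (he : Orthonormal ℂ e) {μ : ι → ℝ} (h : ∀ i, K (e i) = (μ i : ℂ) • e i) {c : ℝ} (hc : 0 < c) :
    {i | c ≤ |μ i|}.Finite := by
  by_contra hinf
  have norm_sub_sq_eq {i j} (hij : i ≠ j) :
      ‖K (e i) - K (e j)‖ ^ 2 = |μ i| ^ 2 + |μ j| ^ 2 := by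
    have inner_eq_zero : inner ℂ (K (e i)) (K (e j)) = 0 := by
      rw [h, h, inner_smul_left, inner_smul_right, he.2 hij, mul_zero, mul_zero]
    rw [@norm_sub_sq ℂ, inner_eq_zero, h, h, norm_smul, norm_smul, he.1, he.1]
    simp
  obtain ⟨C, hC, hsub⟩ := hK.image_closedBall_subset_compact (f := K.toLinearMap) 1
  have emb := Set.Infinite.natEmbedding _ hinf
  have hmem (n) : K (e (emb n)) ∈ C := hsub ⟨e (emb n), by simp [he.1], rfl⟩
  obtain ⟨a, -, φ, hφ, hlim⟩ := hC.tendsto_subseq hmem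
  obtain ⟨N, hN⟩ := Metric.cauchySeq_iff'.mp hlim.cauchySeq c hc
  have dist_lt : ‖K (e (emb (φ (N + 1)))) - K (e (emb (φ N)))‖ < c := by
    rw [← dist_eq_norm]
    exact hN (N + 1) N.le_succ
  have hne : (emb (φ (N + 1)) : ι) ≠ emb (φ N) := fun heq =>
    N.succ_ne_self (hφ.injective (emb.injective (Subtype.ext heq)))
  have hle : c ≤ |μ (emb (φ (N + 1)))| := (emb (φ (N + 1))).2
  nlinarith [norm_sub_sq_eq hne, sq_nonneg |μ (emb (φ N))|, norm_nonneg
    (K (e (emb (φ (N + 1)))) - K (e (emb (φ N))))]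

theorem exists_hilbertBasis_of_orthogonalFamily {τ : Type} {E : Type v} [NormedAddCommGroup E]
    [InnerProductSpace ℂ E] [CompleteSpace E] {V : τ → Submodule ℂ E} [∀ t, CompleteSpace (V t)]
    (hV : OrthogonalFamily ℂ (fun t => V t) fun t => (V t).subtypeₗᵢ)
    (hbot : (⨆ t, V t)ᗮ = ⊥) :
    ∃ (ι : Type v) (b : HilbertBasis ι ℂ E) (t : ι → τ), ∀ i, b i ∈ V (t i) := by
  choose w β _ using fun t => exists_hilbertBasis ℂ (V t)
  let e : (Σ t, w t) → E := fun a => (V a.1).subtypeₗᵢ (β a.1 a.2)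
  have he : Orthonormal ℂ e := hV.orthonormal_sigma_orthonormal fun t => (β t).orthonormal
  have orthogonal_eq_bot : (Submodule.span ℂ (Set.range e))ᗮ = ⊥ := by
    refine eq_bot_iff.mpr fun x hx => hbot.le ((Submodule.mem_orthogonal' _ _).mpr fun y hy => ?_)
    suffices ⨆ t, V t ≤ LinearMap.ker (innerSL ℂ x).toLinearMap from this hy
    refine iSup_le fun t z hz => ?_
    have restrict_eq_zero : innerSL ℂ x ∘L (V t).subtypeL = 0 := by
      refine ContinuousLinearMap.ext_on (dense_span_range_hilbertBasis (β t)) ?_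
      rintro _ ⟨a, rfl⟩
      exact (Submodule.mem_orthogonal' _ _).mp hx _ (Submodule.subset_span ⟨⟨t, a⟩, rfl⟩)
    exact DFunLike.congr_fun restrict_eq_zero ⟨z, hz⟩
  refine ⟨_, HilbertBasis.mkOfOrthogonalEqBot he orthogonal_eq_bot, Sigma.fst, fun a => ?_⟩
  rw [HilbertBasis.coe_mkOfOrthogonalEqBot]
  exact (β a.1 a.2).2

variable {E : Type v} [NormedAddCommGroup E] [InnerProductSpace ℂ E] {D : E →ₗ.[ℂ] E}

/-- The eigenspace of an unbounded operator for a real eigenvalue. -/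
def pmapEigenspace (D : E →ₗ.[ℂ] E) (t : ℝ) : Submodule ℂ E :=
  D.graph.comap (LinearMap.prod LinearMap.id ((t : ℂ) • LinearMap.id))

theorem mem_pmapEigenspace {t : ℝ} {x : E} :
    x ∈ pmapEigenspace D t ↔ (x, (t : ℂ) • x) ∈ D.graph := Iff.rfl

theorem isClosed_pmapEigenspace (hD : D.IsClosed) (t : ℝ) :
    IsClosed (pmapEigenspace D t : Set E) :=
  IsClosed.preimage (f := fun x : E => (x, (t : ℂ) • x)) (by fun_prop) hD

theorem orthogonalFamily_pmapEigenspace (hD : D.IsFormalAdjoint D) :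
    OrthogonalFamily ℂ (fun t => pmapEigenspace D t) fun t => (pmapEigenspace D t).subtypeₗᵢ := by
  rintro s t hst ⟨x, hx⟩ ⟨y, hy⟩
  have inner_smul_eq := inner_eq_of_isFormalAdjoint hD (mem_pmapEigenspace.mp hx)
    (mem_pmapEigenspace.mp hy)
  rw [inner_smul_left, inner_smul_right, Complex.conj_ofReal, ← sub_eq_zero, ← sub_mul]
    at inner_smul_eq
  refine (mul_eq_zero.mp inner_smul_eq).resolve_left fun h => hst ?_
  exact_mod_cast sub_eq_zero.mp h

theorem eq_zero_of_mem_graph_neg (hD : D.IsFormalAdjoint D) {x y : E}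
    (h : (x, y) ∈ D.graph) (h' : (y, -x) ∈ D.graph) :
    x = 0 := by
  have norm_sq_eq := inner_eq_of_isFormalAdjoint hD h h'
  rw [inner_neg_right, inner_self_eq_norm_sq_to_K, inner_self_eq_norm_sq_to_K] at norm_sq_eq
  have norm_sq_eq' : ‖y‖ ^ 2 = -‖x‖ ^ 2 := by exact_mod_cast norm_sq_eq
  exact norm_eq_zero.mp (by nlinarith [sq_nonneg ‖y‖, sq_nonneg ‖x‖])

-- With `D x = y` and `D y = s² x`, the vectors `x ± y / s` are eigenvectors for `± s`.
theorem mem_iSup_pmapEigenspace_of_mul_self (hD : D.IsFormalAdjoint D) {x y : E} {s : ℝ}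
    (h : (x, y) ∈ D.graph)
    (h' : (y, ((s : ℂ) * s) • x) ∈ D.graph) : x ∈ ⨆ t, pmapEigenspace D t := by
  obtain rfl | hs := eq_or_ne s 0
  · have y_eq_zero : y = 0 := by
      have := inner_eq_of_isFormalAdjoint hD h h'
      rwa [Complex.ofReal_zero, zero_mul, zero_smul, inner_zero_right, inner_self_eq_zero] at this
    exact Submodule.mem_iSup_of_mem 0 (mem_pmapEigenspace.mpr (by simpa [y_eq_zero] using h))
  · have hs' : (s : ℂ) ≠ 0 := by exact_mod_cast hs
    have inv_smul_mem : ((s : ℂ)⁻¹ • y, (s : ℂ) • x) ∈ D.graph := by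
      simpa only [Prod.smul_mk, smul_smul, inv_mul_cancel_left₀ hs'] using
        D.graph.smul_mem (s : ℂ)⁻¹ h'
    have add_mem_eigenspace : x + (s : ℂ)⁻¹ • y ∈ pmapEigenspace D s := by
      rw [mem_pmapEigenspace, smul_add, smul_smul, mul_inv_cancel₀ hs', one_smul, add_comm (_ • x)]
      exact D.graph.add_mem h inv_smul_mem
    have sub_mem_eigenspace : x - (s : ℂ)⁻¹ • y ∈ pmapEigenspace D (-s) := by
      rw [mem_pmapEigenspace, smul_sub, smul_smul, Complex.ofReal_neg, neg_mul,
        mul_inv_cancel₀ hs', neg_smul, neg_smul, one_smul, sub_neg_eq_add, neg_add_eq_sub]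
      exact D.graph.sub_mem h inv_smul_mem
    have x_eq : x = (2⁻¹ : ℂ) • (x + (s : ℂ)⁻¹ • y) + (2⁻¹ : ℂ) • (x - (s : ℂ)⁻¹ • y) := by module
    rw [x_eq]
    exact Submodule.add_mem _ (Submodule.smul_mem _ _ (Submodule.mem_iSup_of_mem s
      add_mem_eigenspace)) (Submodule.smul_mem _ _ (Submodule.mem_iSup_of_mem (-s)
      sub_mem_eigenspace))

theorem mem_iSup_pmapEigenspace (hD : D.IsFormalAdjoint D) {x y : E} {c : ℂ} (h : (x, y) ∈ D.graph)
    (h' : (y, c • x) ∈ D.graph) : x ∈ ⨆ t, pmapEigenspace D t := by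
  obtain rfl | hx := eq_or_ne x 0
  · exact Submodule.zero_mem _
  have inner_eq := inner_eq_of_isFormalAdjoint hD h h'
  rw [inner_smul_right, inner_self_eq_norm_sq_to_K, inner_self_eq_norm_sq_to_K] at inner_eq
  have c_eq : c = ((‖y‖ / ‖x‖ : ℝ) : ℂ) * ((‖y‖ / ‖x‖ : ℝ) : ℂ) := by
    have hx' : (‖x‖ : ℂ) ≠ 0 := by exact_mod_cast norm_ne_zero_iff.mpr hx
    push_cast
    rw [div_mul_div_comm, eq_div_iff (mul_ne_zero hx' hx'), ← pow_two, ← pow_two]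
    exact inner_eq.symm
  exact mem_iSup_pmapEigenspace_of_mul_self hD h (c_eq ▸ h')

variable [CompleteSpace E] {S : E →L[ℂ] E}

theorem isFormalAdjoint_of_isSelfAdjoint (hD : IsSelfAdjoint D) : D.IsFormalAdjoint D := by
  have adjoint_isFormalAdjoint := LinearPMap.adjoint_isFormalAdjoint hD.dense_domain
  rwa [LinearPMap.isSelfAdjoint_def.mp hD] at adjoint_isFormalAdjoint

theorem IsInvSqrtOneAddSq.apply_apply_eigenvector (hS : IsInvSqrtOneAddSq D S)
    (hD : D.IsFormalAdjoint D) {t : ℝ} {x : E} (hx : x ∈ pmapEigenspace D t) :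
    S (S x) = (((1 + t ^ 2)⁻¹ : ℝ) : ℂ) • x := by
  obtain ⟨η, h, h'⟩ := (isInvSqrtOneAddSq_iff.mp hS).2 x
  set r : ℂ := (((1 + t ^ 2)⁻¹ : ℝ) : ℂ) with hr
  have mul_sq_eq : r * t * t = 1 - r := by
    have hpos : 1 + t ^ 2 ≠ 0 := by positivity
    rw [hr]
    norm_cast
    field_simp
    ring
  rw [mem_pmapEigenspace] at hx
  refine sub_eq_zero.mp (eq_zero_of_mem_graph_neg hD (y := η - (r * t) • x) ?_ ?_)
  · simpa only [Prod.smul_mk, Prod.mk_sub_mk, smul_smul] using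
      D.graph.sub_mem h (D.graph.smul_mem r hx)
  · convert D.graph.sub_mem h' (D.graph.smul_mem (r * t) hx) using 1
    rw [Prod.smul_mk, Prod.mk_sub_mk, smul_smul, mul_sq_eq, sub_smul, one_smul]
    congr 1
    abel

theorem IsInvSqrtOneAddSq.mem_iSup_pmapEigenspace (hS : IsInvSqrtOneAddSq D S)
    (hD : D.IsFormalAdjoint D) {m : ℂ} {x : E} (hx : S (S x) = m • x) :
    x ∈ ⨆ t, pmapEigenspace D t := by
  obtain ⟨η, h, h'⟩ := (isInvSqrtOneAddSq_iff.mp hS).2 x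
  rw [hx] at h h'
  obtain rfl | hm := eq_or_ne m 0
  · rw [zero_smul] at h h'
    rw [D.graph_fst_eq_zero_snd h rfl, sub_zero] at h'
    rw [D.graph_fst_eq_zero_snd h' rfl]
    exact Submodule.zero_mem _
  · refine _root_.mem_iSup_pmapEigenspace hD (y := m⁻¹ • η) (c := m⁻¹ - 1) ?_ ?_
    · simpa only [Prod.smul_mk, smul_smul, inv_mul_cancel₀ hm, one_smul] using
        D.graph.smul_mem m⁻¹ h
    · simpa only [Prod.smul_mk, smul_sub, smul_smul, inv_mul_cancel₀ hm, sub_smul] using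
        D.graph.smul_mem m⁻¹ h'

theorem exists_eigenbasis (hD : IsSelfAdjoint D)
    (hS : ∃ S : E →L[ℂ] E, IsInvSqrtOneAddSq D S ∧ IsCompactOperator S) :
    ∃ (ι : Type v) (b : HilbertBasis ι ℂ E) (μ : ι → ℝ), (∀ N : ℝ, {i | |μ i| ≤ N}.Finite) ∧
      ∀ i, (b i, (μ i : ℂ) • b i) ∈ D.graph := by
  obtain ⟨S, hS, hcpt⟩ := hS
  have hsym := isFormalAdjoint_of_isSelfAdjoint hD
  have hSS : IsCompactOperator (S * S) := hcpt.comp_clm S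
  have isSymmetric_mul_self : (S * S : E →L[ℂ] E).IsSymmetric := fun x y =>
    (hS.1.isSymmetric (S x) y).trans (hS.1.isSymmetric x (S y))
  have iSup_orthogonal : (⨆ t, pmapEigenspace D t)ᗮ = ⊥ := by
    rw [eq_bot_iff, ← ContinuousLinearMap.orthogonalComplement_iSup_eigenspaces_eq_bot hSS
      isSymmetric_mul_self]
    exact Submodule.orthogonal_le (iSup_le fun m x hx =>
      hS.mem_iSup_pmapEigenspace hsym (Module.End.mem_eigenspace_iff.mp hx))
  have completeSpace_eigenspace (t : ℝ) : CompleteSpace (pmapEigenspace D t) :=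
    (isClosed_pmapEigenspace hD.isClosed t).completeSpace_coe
  obtain ⟨ι, b, μ, hb⟩ := exists_hilbertBasis_of_orthogonalFamily
    (orthogonalFamily_pmapEigenspace hsym) iSup_orthogonal
  refine ⟨ι, b, μ, fun N => ?_, fun i => mem_pmapEigenspace.mp (hb i)⟩
  refine (finite_setOf_le_abs_eigenvalue hSS b.orthonormal (fun i =>
    hS.apply_apply_eigenvector hsym (hb i)) (c := (1 + N ^ 2)⁻¹) (by positivity)).subset ?_
  intro i (hi : |μ i| ≤ N)
  change _ ≤ |(1 + μ i ^ 2)⁻¹|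
  rw [abs_of_pos (by positivity)]
  gcongr (1 + ?_)⁻¹
  exact sq_le_sq' (abs_le.mp hi).1 (abs_le.mp hi).2

end CompactResolvent

/-! ### The length operator on `ℓ²(G) ⊗ V` -/

section L2

variable {G : Type u}

theorem norm_L2δ (x : G) : ‖L2.δ x‖ = 1 := by
  classical
  rw [L2.δ, lp.norm_single (by norm_num), norm_one]

open Classical in
theorem inner_L2δ (x y : G) :
    inner ℂ (L2.δ x) (L2.δ y) = if x = y then (1 : ℂ) else 0 := by
  rw [L2.δ, L2.δ, lp.inner_single_left, lp.single_apply]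
  by_cases h : x = y
  · subst h; simp
  · simp [h]

theorem dense_span_L2δ (G : Type u) :
    Dense (Submodule.span ℂ (Set.range (L2.δ (G := G))) : Set (L2 G)) := by
  classical
  have coe_basis : ⇑(HilbertBasis.ofRepr (LinearIsometryEquiv.refl ℂ (L2 G))) = L2.δ := by
    funext x
    rw [← HilbertBasis.repr_symm_single]
    rfl
  rw [← coe_basis]
  exact dense_span_range_hilbertBasis _

theorem weightedShift_single {ι : Type*} [DecidableEq ι] {E : Type*} [NormedAddCommGroup E]
    [InnerProductSpace ℂ E] (e : ι ≃ ι) (T : ι → E →L[ℂ] E) (C : ℝ) (hC : ∀ i, ‖T i‖ ≤ C) (i : ι)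
    (v : E) : weightedShift (E := fun _ : ι => E) e T C hC (lp.single 2 i v) =
      lp.single 2 (e.symm i) (T (e.symm i) v) := by
  ext j
  rw [weightedShift_apply, lp.single_apply, lp.single_apply]
  by_cases h : j = e.symm i
  · subst h; simp
  · have h' : e j ≠ i := fun h' => h (by rw [← h', Equiv.symm_apply_apply])
    simp [h, h']

theorem leftReg_L2δ [Group G] (g x : G) : leftReg g (L2.δ x) = L2.δ (g * x) := by
  classical
  rw [leftReg, L2.δ, weightedShift_single]
  simp [L2.δ]

end L2

section Fibred

open HilbertTensor

variable {G : Type u} {V : Type v} [NormedAddCommGroup V] [InnerProductSpace ℂ V]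

theorem fibreMap_single (m : G → V →ₗ[ℂ] V) (x : G) (v : V) :
    fibreMap m (Finsupp.single x v) = tmulL (L2.δ x) (m x v) := by
  rw [fibreMap, Finsupp.lsum_single]
  rfl

theorem mem_graph_lengthCore {ℓ : G → V →L[ℂ] V} {x y : HilbertTensor (L2 G) V} :
    (x, y) ∈ (lengthCore ℓ).graph ↔ ∃ f : G →₀ V, fibreMap (fun _ => LinearMap.id) f = x ∧
      fibreMap (fun x => (ℓ x).toLinearMap) f = y :=
  mem_graph_pmapOfParam _ _ _

variable [CompleteSpace V]

theorem isHilbertSum_fibres (G : Type u) (V : Type v) [NormedAddCommGroup V]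
    [InnerProductSpace ℂ V] [CompleteSpace V] :
    IsHilbertSum ℂ (fun _ : G => V) fun x => tmulLeft V (L2.δ x) (norm_L2δ x) := by
  classical
  refine IsHilbertSum.mk ?_ ?_
  · intro x y hxy v w
    change inner ℂ (tmulL (L2.δ x) v) (tmulL (L2.δ y) w) = 0
    rw [inner_tmulL, inner_L2δ, if_neg hxy, zero_mul]
  · refine (topologicalClosure_eq_top_of_tmulL_mem (dense_span_L2δ G) (t := Set.univ) (by simp)
      ?_).ge
    rintro _ ⟨x, rfl⟩ v -
    exact Submodule.mem_iSup_of_mem x ⟨v, rfl⟩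

/-- The identification `ℓ²(G) ⊗ V = ℓ²(G, V)`. -/
def fibreEquiv (G : Type u) (V : Type v) [NormedAddCommGroup V] [InnerProductSpace ℂ V]
    [CompleteSpace V] : HilbertTensor (L2 G) V ≃ₗᵢ[ℂ] lp (fun _ : G => V) 2 :=
  (isHilbertSum_fibres G V).linearIsometryEquiv

open Classical in
theorem fibreEquiv_symm_single (x : G) (v : V) :
    (fibreEquiv G V).symm (lp.single 2 x v) = tmulL (L2.δ x) v :=
  (isHilbertSum_fibres G V).linearIsometryEquiv_symm_apply_single v

open Classical in
theorem fibreEquiv_tmulL (x : G) (v : V) :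
    fibreEquiv G V (tmulL (L2.δ x) v) = lp.single 2 x v := by
  rw [← fibreEquiv_symm_single, LinearIsometryEquiv.apply_symm_apply]

end Fibred

section Length

open HilbertTensor

variable {G : Type u} {V : Type v} [NormedAddCommGroup V] [InnerProductSpace ℂ V]
  [CompleteSpace V] {ℓ : G → V →L[ℂ] V}

theorem isFormalAdjoint_lengthCore (hℓ : ∀ x, IsSelfAdjoint (ℓ x)) :
    (lengthCore ℓ).IsFormalAdjoint (lengthCore ℓ) := by
  classical
  intro p q
  obtain ⟨f, hf, hf'⟩ := mem_graph_lengthCore.mp ((lengthCore ℓ).mem_graph p)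
  obtain ⟨g, hg, hg'⟩ := mem_graph_lengthCore.mp ((lengthCore ℓ).mem_graph q)
  rw [← hf, ← hf', ← hg, ← hg']
  clear hf hf' hg hg'
  induction f using Finsupp.induction_linear with
  | zero => simp
  | add a b ha hb => simp only [map_add, inner_add_left, ha, hb]
  | single x v =>
    induction g using Finsupp.induction_linear with
    | zero => simp
    | add c d hc hd => simp only [map_add, inner_add_right, hc, hd]
    | single y w =>
      simp only [fibreMap_single, inner_tmulL, inner_L2δ, LinearMap.id_apply,
        ContinuousLinearMap.coe_coe]
      by_cases h : x = y
      · subst h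
        rw [if_pos rfl, one_mul, one_mul]
        exact (hℓ x).isSymmetric v w
      · simp [h]

/-- The commutator `[M_ℓ, λ_g ⊗ 1]`, which shifts the fibre over `x` to the fibre over `gx` with
weight `ℓ(gx) - ℓ(x)`; it is bounded because `ℓ` is translation bounded. -/
def lengthCommutator [Group G] (ℓ : G → V →L[ℂ] V) (g : G) (C : ℝ)
    (hC : ∀ x, ‖ℓ x - ℓ (g⁻¹ * x)‖ ≤ C) :
    HilbertTensor (L2 G) V →L[ℂ] HilbertTensor (L2 G) V :=
  (fibreEquiv G V).symm.toContinuousLinearEquiv.toContinuousLinearMap ∘L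
    weightedShift (E := fun _ : G => V) (Equiv.mulLeft g⁻¹) (fun x => ℓ x - ℓ (g⁻¹ * x)) C hC ∘L
    (fibreEquiv G V).toContinuousLinearEquiv.toContinuousLinearMap

theorem lengthCommutator_tmulL [Group G] (g : G) (C : ℝ)
    (hC : ∀ x, ‖ℓ x - ℓ (g⁻¹ * x)‖ ≤ C) (x : G) (v : V) :
    lengthCommutator ℓ g C hC (tmulL (L2.δ x) v) =
      tmulL (L2.δ (g * x)) (ℓ (g * x) v - ℓ x v) := by
  classical
  change (fibreEquiv G V).symm (weightedShift (E := fun _ : G => V) _ _ C hC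
    (fibreEquiv G V (tmulL (L2.δ x) v))) = _
  rw [fibreEquiv_tmulL, weightedShift_single, fibreEquiv_symm_single]
  simp only [Equiv.mulLeft_symm_apply, inv_inv, inv_mul_cancel_left, sub_apply]

theorem hasBoundedCommutator_lengthCore [Group G]
    (hℓ : ∀ y, ∃ C : ℝ, ∀ x, ‖ℓ x - ℓ (y⁻¹ * x)‖ ≤ C) (g : G) :
    HasBoundedCommutator (lengthCore ℓ) (tensorOp (leftReg g) (1 : V →L[ℂ] V)) := by
  obtain ⟨C, hC⟩ := hℓ g
  rw [hasBoundedCommutator_iff]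
  refine ⟨lengthCommutator ℓ g C hC, fun x y hxy => ?_⟩
  obtain ⟨f, rfl, rfl⟩ := mem_graph_lengthCore.mp hxy
  refine mem_graph_lengthCore.mpr ⟨Finsupp.lmapDomain V ℂ (g * ·) f, ?_, ?_⟩ <;> clear hxy
  · induction f using Finsupp.induction_linear with
    | zero => simp
    | add a b ha hb => simp only [map_add, ha, hb]
    | single x v =>
      rw [Finsupp.lmapDomain_apply, Finsupp.mapDomain_single, fibreMap_single, fibreMap_single,
        tensorOp_tmulL, leftReg_L2δ]
      rfl
  · induction f using Finsupp.induction_linear with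
    | zero => simp
    | add a b ha hb =>
      simp only [map_add, ha, hb]
      abel
    | single x v =>
      simp only [Finsupp.lmapDomain_apply, Finsupp.mapDomain_single, fibreMap_single,
        tensorOp_tmulL, leftReg_L2δ, lengthCommutator_tmulL, LinearMap.id_apply,
        one_apply_eq_self, map_sub, ContinuousLinearMap.coe_coe]
      abel

variable [FiniteDimensional ℂ V]

/-- The eigenvectors `δₓ ⊗ v` of the length operator. -/
def lengthEigenvector (hℓ : ∀ x, IsSelfAdjoint (ℓ x)) (p : G × Fin (Module.finrank ℂ V)) :
    HilbertTensor (L2 G) V :=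
  tmulL (L2.δ p.1) ((hℓ p.1).isSymmetric.eigenvectorBasis rfl p.2)

/-- The eigenvalues of the length operator. -/
def lengthEigenvalue (hℓ : ∀ x, IsSelfAdjoint (ℓ x)) (p : G × Fin (Module.finrank ℂ V)) : ℝ :=
  (hℓ p.1).isSymmetric.eigenvalues rfl p.2

theorem orthonormal_lengthEigenvector (hℓ : ∀ x, IsSelfAdjoint (ℓ x)) :
    Orthonormal ℂ (lengthEigenvector hℓ) := by
  classical
  rw [orthonormal_iff_ite]
  rintro ⟨x, i⟩ ⟨y, j⟩
  rw [lengthEigenvector, lengthEigenvector, inner_tmulL, inner_L2δ]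
  by_cases h : x = y
  · subst h
    simp [orthonormal_iff_ite.mp (OrthonormalBasis.orthonormal _)]
  · simp [h]

theorem topologicalClosure_span_lengthEigenvector (hℓ : ∀ x, IsSelfAdjoint (ℓ x)) :
    (Submodule.span ℂ (Set.range (lengthEigenvector hℓ))).topologicalClosure = ⊤ := by
  refine topologicalClosure_eq_top_of_tmulL_mem (dense_span_L2δ G) (t := Set.univ) (by simp) ?_
  rintro _ ⟨x, rfl⟩ v -
  rw [← ((hℓ x).isSymmetric.eigenvectorBasis rfl).sum_repr v, map_sum]
  refine Submodule.sum_mem _ fun i _ => ?_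
  rw [map_smul]
  exact Submodule.smul_mem _ _ (Submodule.subset_span ⟨(x, i), rfl⟩)

/-- The Hilbert basis of eigenvectors of the length operator. -/
def lengthEigenbasis (hℓ : ∀ x, IsSelfAdjoint (ℓ x)) :
    HilbertBasis (G × Fin (Module.finrank ℂ V)) ℂ (HilbertTensor (L2 G) V) :=
  HilbertBasis.mk (orthonormal_lengthEigenvector hℓ)
    (topologicalClosure_span_lengthEigenvector hℓ).ge

theorem lengthEigenbasis_mem_graph (hℓ : ∀ x, IsSelfAdjoint (ℓ x))
    (p : G × Fin (Module.finrank ℂ V)) :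
    (lengthEigenbasis hℓ p, (lengthEigenvalue hℓ p : ℂ) • lengthEigenbasis hℓ p) ∈
      (lengthCore ℓ).graph := by
  rw [lengthEigenbasis, HilbertBasis.coe_mk]
  refine mem_graph_lengthCore.mpr
    ⟨Finsupp.single p.1 ((hℓ p.1).isSymmetric.eigenvectorBasis rfl p.2), ?_, ?_⟩
  · rw [fibreMap_single]
    rfl
  · rw [fibreMap_single, (hℓ p.1).isSymmetric.apply_eigenvectorBasis, map_smul]
    rfl

theorem IsProperLength.finite_lengthEigenvalue [Group G] (hℓ : IsProperLength ℓ) (N : ℝ) :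
    {p | |lengthEigenvalue hℓ.selfAdjoint p| ≤ N}.Finite := by
  have hfin : (lengthSpectrum ℓ ∩ Set.Icc (-N) N).Finite :=
    (isCompact_Icc.inter_left hℓ.closed).finite (hℓ.discrete.mono Set.inter_subset_left)
  have hG : (⋃ t ∈ lengthSpectrum ℓ ∩ Set.Icc (-N) N, {x | (t : ℂ) ∈ spectrum ℂ (ℓ x)}).Finite :=
    hfin.biUnion fun t ht => hℓ.finite t ht.1
  refine (hG.prod (Set.finite_univ (α := Fin (Module.finrank ℂ V)))).subset ?_
  rintro ⟨x, i⟩ h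
  have hspec : ((lengthEigenvalue hℓ.selfAdjoint (x, i) : ℝ) : ℂ) ∈ spectrum ℂ (ℓ x) := by
    rw [ContinuousLinearMap.spectrum_eq]
    exact ((hℓ.selfAdjoint x).isSymmetric.hasEigenvalue_eigenvalues rfl i).mem_spectrum
  refine ⟨Set.mem_biUnion ⟨⟨x, hspec⟩, abs_le.mp h⟩ hspec, trivial⟩

theorem isClosable_lengthCore (hℓ : ∀ x, IsSelfAdjoint (ℓ x)) : (lengthCore ℓ).IsClosable :=
  isClosable_of_eigenbasis (isFormalAdjoint_lengthCore hℓ) (lengthEigenbasis_mem_graph hℓ)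

theorem lengthDirac_eq_diagOp (hℓ : ∀ x, IsSelfAdjoint (ℓ x)) :
    lengthDirac ℓ = diagOp (lengthEigenbasis hℓ) (lengthEigenvalue hℓ) :=
  closure_eq_diagOp (isFormalAdjoint_lengthCore hℓ) (lengthEigenbasis_mem_graph hℓ)

theorem isSelfAdjoint_lengthDirac (hℓ : ∀ x, IsSelfAdjoint (ℓ x)) :
    IsSelfAdjoint (lengthDirac ℓ) :=
  lengthDirac_eq_diagOp hℓ ▸ isSelfAdjoint_diagOp _ _

end Length

/-! ### Concrete C*-algebras and compressions to reducing subspaces -/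

section Generating

open scoped CStarAlgebra

variable {C : Type*} [CStarAlgebra C] {C' : Type*} [CStarAlgebra C']

/-- The C*-algebra `C` is generated by the set `g`, as a unital C*-algebra. -/
def IsGenerating (g : Set C) : Prop := (StarAlgebra.adjoin ℂ g).topologicalClosure = ⊤

theorem isGenerating_iff {g : Set C} :
    IsGenerating g ↔ ∀ B : StarSubalgebra ℂ C, IsClosed (B : Set C) → g ⊆ B → B = ⊤ :=
  ⟨fun hg _ hB h => top_le_iff.mp <| hg.ge.trans <|
      StarSubalgebra.topologicalClosure_minimal (StarAlgebra.adjoin_le h) hB,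
    fun h => h _ (StarSubalgebra.isClosed_topologicalClosure _) <|
      (StarAlgebra.subset_adjoin ℂ g).trans (StarSubalgebra.le_topologicalClosure _)⟩

namespace IsGenerating

variable {g : Set C}

theorem eq_top (hg : IsGenerating g) {B : StarSubalgebra ℂ C} (hB : IsClosed (B : Set C))
    (h : g ⊆ B) : B = ⊤ :=
  isGenerating_iff.mp hg B hB h

theorem mono (hg : IsGenerating g) {g' : Set C} (h : g ⊆ g') : IsGenerating g' :=
  isGenerating_iff.mpr fun _ hB hB' => hg.eq_top hB (h.trans hB')

theorem dense (hg : IsGenerating g) (W : Submodule ℂ C) (h1 : (1 : C) ∈ W)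
    (hmul : ∀ a ∈ W, ∀ b ∈ W, a * b ∈ W) (hstar : ∀ a ∈ W, star a ∈ W)
    (h : g ⊆ closure (W : Set C)) : Dense (W : Set C) := by
  let B : StarSubalgebra ℂ C :=
    { W with
      mul_mem' := fun {a b} ha hb => hmul a ha b hb
      one_mem' := h1
      algebraMap_mem' := fun c => by
        rw [Algebra.algebraMap_eq_smul_one]
        exact W.smul_mem c h1
      star_mem' := fun {a} ha => hstar a ha }
  have hB : B.topologicalClosure = ⊤ := hg.eq_top B.isClosed_topologicalClosure h
  exact fun x => (hB ▸ StarSubalgebra.mem_top : x ∈ B.topologicalClosure)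

theorem hom_ext (hg : IsGenerating g) {φ φ' : C →⋆ₐ[ℂ] C'} (h : ∀ x ∈ g, φ x = φ' x) : φ = φ' := by
  have heq : StarAlgHom.equalizer φ φ' = ⊤ :=
    hg.eq_top (isClosed_eq (map_continuous φ) (map_continuous φ')) h
  ext x
  exact (heq ▸ StarSubalgebra.mem_top : x ∈ StarAlgHom.equalizer φ φ')

theorem hom_mem (hg : IsGenerating g) (φ : C →⋆ₐ[ℂ] C') {B : StarSubalgebra ℂ C'}
    (hB : IsClosed (B : Set C')) (h : ∀ x ∈ g, φ x ∈ B) (x : C) : φ x ∈ B := by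
  have heq : B.comap φ = ⊤ := hg.eq_top (hB.preimage (map_continuous φ)) h
  exact (heq ▸ StarSubalgebra.mem_top : x ∈ B.comap φ)

end IsGenerating

end Generating

section OpAlgHom

variable {K : Type*} [NormedAddCommGroup K] [InnerProductSpace ℂ K] [CompleteSpace K]
  {L : Type*} [NormedAddCommGroup L] [InnerProductSpace ℂ L] [CompleteSpace L]
  {s : Set (K →L[ℂ] K)} {t : Set (L →L[ℂ] L)}

theorem cstarGen_le {B : StarSubalgebra ℂ (K →L[ℂ] K)} (hB : IsClosed (B : Set (K →L[ℂ] K)))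
    (h : s ⊆ B) : cstarGen s ≤ B :=
  StarSubalgebra.topologicalClosure_minimal (StarAlgebra.adjoin_le h) hB

theorem MinTensor.val_tmul (b : OpAlg s) (c : OpAlg t) :
    OpAlg.val _ (MinTensor.tmul b c) = tensorOp (OpAlg.val s b) (OpAlg.val t c) := rfl

namespace OpAlg

theorem val_injective (s : Set (K →L[ℂ] K)) : Function.Injective (val s) :=
  Subtype.val_injective

theorem isometry_val (s : Set (K →L[ℂ] K)) : Isometry (val s) := isometry_subtype_coe

theorem norm_val (x : OpAlg s) : ‖val s x‖ = ‖x‖ := rfl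

theorem val_mem (x : OpAlg s) : val s x ∈ cstarGen s := x.2

theorem isGenerating (s : Set (K →L[ℂ] K)) :
    IsGenerating {x : OpAlg s | ∃ T, ∃ hT : T ∈ s, x = gen T hT} := by
  refine isGenerating_iff.mpr fun B hB hgB => top_le_iff.mp fun x _ => ?_
  have hle : cstarGen s ≤ B.map (val s) :=
    cstarGen_le ((isometry_val s).isClosedEmbedding.isClosedMap _ hB) fun T hT =>
      ⟨gen T hT, hgB ⟨T, hT, rfl⟩, rfl⟩
  obtain ⟨y, hy, hyx⟩ := hle (val_mem x)
  rwa [← val_injective s hyx]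

theorem hom_ext {C : Type*} [CStarAlgebra C] {f g : OpAlg s →⋆ₐ[ℂ] C}
    (h : ∀ T (hT : T ∈ s), f (gen T hT) = g (gen T hT)) : f = g :=
  (isGenerating s).hom_ext (by rintro _ ⟨T, hT, rfl⟩; exact h T hT)

theorem hom_mem_cstarGen (f : OpAlg s →⋆ₐ[ℂ] (L →L[ℂ] L))
    (h : ∀ T (hT : T ∈ s), f (gen T hT) ∈ cstarGen t) (x : OpAlg s) : f x ∈ cstarGen t :=
  (isGenerating s).hom_mem f (isClosed_cstarGen t) (by rintro _ ⟨T, hT, rfl⟩; exact h T hT) x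

/-- A `*`-homomorphism to operators that maps the generators into a C*-algebra of operators. -/
def codRestrict (f : OpAlg s →⋆ₐ[ℂ] (L →L[ℂ] L))
    (h : ∀ T (hT : T ∈ s), f (gen T hT) ∈ cstarGen t) : OpAlg s →⋆ₐ[ℂ] OpAlg t :=
  StarAlgHom.codRestrict f (cstarGen t) (hom_mem_cstarGen f h)

end OpAlg

open ContinuousLinearMap

/-- The operators for which the range of the isometry `J` is a reducing subspace, encoded as the
commutant of the range projection `J J*`. -/
def reducingAlg (J : L →ₗᵢ[ℂ] K) : StarSubalgebra ℂ (K →L[ℂ] K) :=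
  StarSubalgebra.centralizer ℂ {J.toContinuousLinearMap ∘L adjoint J.toContinuousLinearMap}

theorem mem_reducingAlg_iff {J : L →ₗᵢ[ℂ] K} {T : K →L[ℂ] K} :
    T ∈ reducingAlg J ↔ Commute (J.toContinuousLinearMap ∘L adjoint J.toContinuousLinearMap) T := by
  have hsa : star (J.toContinuousLinearMap ∘L adjoint J.toContinuousLinearMap) =
      J.toContinuousLinearMap ∘L adjoint J.toContinuousLinearMap := by
    rw [star_eq_adjoint, adjoint_comp, adjoint_adjoint]
  simp only [reducingAlg, StarSubalgebra.mem_centralizer_iff, Set.mem_singleton_iff, forall_eq, hsa,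
    and_self, commute_iff_eq]

theorem isClosed_reducingAlg (J : L →ₗᵢ[ℂ] K) : IsClosed (reducingAlg J : Set (K →L[ℂ] K)) :=
  Set.isClosed_centralizer _

theorem adjoint_comp_comp_of_intertwines {J : L →ₗᵢ[ℂ] K} {T : K →L[ℂ] K} {Y : L →L[ℂ] L}
    (h : ∀ ξ, T (J ξ) = J (Y ξ)) :
    adjoint J.toContinuousLinearMap ∘L T ∘L J.toContinuousLinearMap = Y := by
  have hT : T ∘L J.toContinuousLinearMap = J.toContinuousLinearMap ∘L Y :=
    ContinuousLinearMap.ext h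
  rw [hT, ← ContinuousLinearMap.comp_assoc, J.adjoint_comp_self]
  rfl

theorem mem_reducingAlg_of_intertwines {J : L →ₗᵢ[ℂ] K} {T : K →L[ℂ] K} {Y Y' : L →L[ℂ] L}
    (h : ∀ ξ, T (J ξ) = J (Y ξ)) (h' : ∀ ξ, star T (J ξ) = J (Y' ξ)) : T ∈ reducingAlg J := by
  have hT : T ∘L J.toContinuousLinearMap = J.toContinuousLinearMap ∘L Y := ContinuousLinearMap.ext h
  have hT' : adjoint T ∘L J.toContinuousLinearMap = J.toContinuousLinearMap ∘L Y' :=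
    ContinuousLinearMap.ext h'
  have hadj : adjoint J.toContinuousLinearMap ∘L T =
      adjoint Y' ∘L adjoint J.toContinuousLinearMap := by
    simpa only [adjoint_comp, adjoint_adjoint] using congrArg adjoint hT'
  have hY : adjoint Y' = Y := by
    rw [← adjoint_comp_comp_of_intertwines h, ← ContinuousLinearMap.comp_assoc, hadj,
      ContinuousLinearMap.comp_assoc, J.adjoint_comp_self]
    rfl
  rw [mem_reducingAlg_iff, commute_iff_eq]
  change (J.toContinuousLinearMap ∘L adjoint J.toContinuousLinearMap) ∘L T =
    T ∘L J.toContinuousLinearMap ∘L adjoint J.toContinuousLinearMap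
  rw [ContinuousLinearMap.comp_assoc, hadj, hY, ← ContinuousLinearMap.comp_assoc,
    ← ContinuousLinearMap.comp_assoc, hT]

theorem apply_adjoint_apply_of_mem_reducingAlg {J : L →ₗᵢ[ℂ] K} {T : K →L[ℂ] K}
    (hT : T ∈ reducingAlg J) (ξ : L) :
    J (adjoint J.toContinuousLinearMap (T (J ξ))) = T (J ξ) :=
  calc J (adjoint J.toContinuousLinearMap (T (J ξ)))
      = T (J (adjoint J.toContinuousLinearMap (J ξ))) :=
        DFunLike.congr_fun (mem_reducingAlg_iff.mp hT).eq (J ξ)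
    _ = T (J ξ) := congrArg (fun η => T (J η)) (DFunLike.congr_fun J.adjoint_comp_self ξ)

theorem OpAlg.val_mem_reducingAlg {J : L →ₗᵢ[ℂ] K} (hs : s ⊆ reducingAlg J) (x : OpAlg s) :
    val s x ∈ reducingAlg J :=
  cstarGen_le (isClosed_reducingAlg J) hs x.val_mem

/-- The representation `T ↦ J* T J` of the C*-algebra generated by `s` on the domain of an isometry
`J` whose range reduces `s`. -/
def compression (J : L →ₗᵢ[ℂ] K) (hs : s ⊆ reducingAlg J) : OpAlg s →⋆ₐ[ℂ] (L →L[ℂ] L) where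
  toFun x := adjoint J.toContinuousLinearMap ∘L OpAlg.val s x ∘L J.toContinuousLinearMap
  map_one' := by
    rw [map_one]
    exact J.adjoint_comp_self
  map_mul' x y := by
    ext ξ
    rw [map_mul]
    exact congrArg (fun η => adjoint J.toContinuousLinearMap (OpAlg.val s x η))
      (apply_adjoint_apply_of_mem_reducingAlg (y.val_mem_reducingAlg hs) ξ).symm
  map_zero' := by rw [map_zero, zero_comp, comp_zero]
  map_add' x y := by rw [map_add, add_comp, comp_add]
  commutes' c := by
    rw [AlgHomClass.commutes, Algebra.algebraMap_eq_smul_one, Algebra.algebraMap_eq_smul_one,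
      smul_comp, comp_smul]
    exact congrArg (c • ·) J.adjoint_comp_self
  map_star' x := by
    rw [map_star, star_eq_adjoint, star_eq_adjoint, adjoint_comp, adjoint_comp, adjoint_adjoint,
      ContinuousLinearMap.comp_assoc]

theorem compression_apply (J : L →ₗᵢ[ℂ] K) (hs : s ⊆ reducingAlg J) (x : OpAlg s) (ξ : L) :
    J (compression J hs x ξ) = OpAlg.val s x (J ξ) :=
  apply_adjoint_apply_of_mem_reducingAlg (x.val_mem_reducingAlg hs) ξ

theorem compression_eq_of_intertwines (J : L →ₗᵢ[ℂ] K) (hs : s ⊆ reducingAlg J) (x : OpAlg s)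
    {Y : L →L[ℂ] L} (h : ∀ ξ, OpAlg.val s x (J ξ) = J (Y ξ)) : compression J hs x = Y :=
  adjoint_comp_comp_of_intertwines h

end OpAlgHom

section CompressionTensor

open HilbertTensor

variable {K : Type*} [NormedAddCommGroup K] [InnerProductSpace ℂ K]
  {L : Type*} [NormedAddCommGroup L] [InnerProductSpace ℂ L]
  {F : Type*} [NormedAddCommGroup F] [InnerProductSpace ℂ F]

theorem tensorOp_mapIsometry_id {J : L →ₗᵢ[ℂ] K} {T : K →L[ℂ] K} {Y : L →L[ℂ] L}
    (h : ∀ ξ, T (J ξ) = J (Y ξ)) (Z : F →L[ℂ] F) (ζ : HilbertTensor L F) :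
    tensorOp T Z (mapIsometry J LinearIsometry.id ζ) =
      mapIsometry J LinearIsometry.id (tensorOp Y Z ζ) := by
  suffices tensorOp T Z ∘L (mapIsometry J LinearIsometry.id).toContinuousLinearMap =
      (mapIsometry J LinearIsometry.id).toContinuousLinearMap ∘L tensorOp Y Z from
    DFunLike.congr_fun this ζ
  refine clm_ext fun x y => ?_
  change tensorOp T Z (mapIsometry J LinearIsometry.id (tmulL x y)) =
    mapIsometry J LinearIsometry.id (tensorOp Y Z (tmulL x y))
  rw [mapIsometry_tmulL, tensorOp_tmulL, tensorOp_tmulL, mapIsometry_tmulL, h]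
  rfl

variable [CompleteSpace K] [CompleteSpace L] [CompleteSpace F]
  {s : Set (K →L[ℂ] K)} {t : Set (F →L[ℂ] F)}

theorem tensorGen_subset_reducingAlg {J : L →ₗᵢ[ℂ] K} (hs : s ⊆ reducingAlg J) :
    tensorGen s t ⊆ reducingAlg (mapIsometry J (LinearIsometry.id : F →ₗᵢ[ℂ] F)) := by
  rintro _ ⟨b, c, rfl⟩
  refine mem_reducingAlg_of_intertwines
    (tensorOp_mapIsometry_id (fun ξ => (compression_apply J hs b ξ).symm) _) ?_
    (Y' := tensorOp (compression J hs (star b)) (star (OpAlg.val t c)))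
  intro ζ
  rw [← tensorOp_star, ← map_star]
  exact tensorOp_mapIsometry_id (fun ξ => (compression_apply J hs (star b) ξ).symm) _ ζ

theorem compression_tmul {J : L →ₗᵢ[ℂ] K} (hs : s ⊆ reducingAlg J) (b : OpAlg s) (c : OpAlg t) :
    compression (mapIsometry J LinearIsometry.id) (tensorGen_subset_reducingAlg (t := t) hs)
      (MinTensor.tmul b c) = tensorOp (compression J hs b) (OpAlg.val t c) :=
  compression_eq_of_intertwines _ _ _ fun ζ =>
    tensorOp_mapIsometry_id (fun ξ => (compression_apply J hs b ξ).symm) _ ζ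

end CompressionTensor

section SpanClosed

variable {R : Type*} [CommSemiring R] {C : Type*} [Semiring C] [Algebra R C] {g : Set C}

theorem mul_mem_span_of_mul_mem (h : ∀ a ∈ g, ∀ b ∈ g, a * b ∈ Submodule.span R g) {a b : C}
    (ha : a ∈ Submodule.span R g) (hb : b ∈ Submodule.span R g) : a * b ∈ Submodule.span R g := by
  have hle : Submodule.span R g * Submodule.span R g ≤ Submodule.span R g := by
    rw [Submodule.span_mul_span, Submodule.span_le]
    rintro _ ⟨a, ha, b, hb, rfl⟩
    exact h a ha b hb
  exact hle (Submodule.mul_mem_mul ha hb)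

theorem star_mem_span_of_star_mem {R : Type*} [Semiring R] [StarRing R] {M : Type*}
    [AddCommMonoid M] [StarAddMonoid M] [Module R M] [StarModule R M] {g : Set M}
    (h : ∀ a ∈ g, star a ∈ Submodule.span R g) {a : M} (ha : a ∈ Submodule.span R g) :
    star a ∈ Submodule.span R g := by
  induction ha using Submodule.span_induction with
  | mem a ha => exact h a ha
  | zero => simp
  | add a b _ _ ha hb =>
    rw [star_add]
    exact Submodule.add_mem _ ha hb
  | smul c a _ ha =>
    rw [star_smul]
    exact Submodule.smul_mem _ _ ha

end SpanClosed

/-! ### Families of elements `a δₓ` in a C*-algebra -/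

section Family

variable {A : Type*} [CStarAlgebra A] {G : Type*} [Group G] {S : TwistedSystem A G}
  {C : Type*} [CStarAlgebra C] {C' : Type*} [CStarAlgebra C']

/-- The elements `d a x` of a C*-algebra satisfy the relations of the elements `a δₓ` of a crossed
product. -/
structure IsCrossedFamily (S : TwistedSystem A G) (d : A → G → C) : Prop where
  add : ∀ a b x, d (a + b) x = d a x + d b x
  smul : ∀ (c : ℂ) a x, d (c • a) x = c • d a x
  one : d 1 1 = 1
  mul : ∀ a x b y, d a x * d b y = d (a * S.ρ x b * S.σ x y) (x * y)
  star : ∀ a x, star (d a x) = d (star (S.σ x⁻¹ x : A) * S.ρ x⁻¹ (star a)) x⁻¹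
  norm_le : ∀ a x, ‖d a x‖ ≤ ‖a‖

namespace IsCrossedFamily

variable {d : A → G → C} {d' : A → G → C'}

theorem map (h : IsCrossedFamily S d) (φ : C →⋆ₐ[ℂ] C') :
    IsCrossedFamily S fun a x => φ (d a x) where
  add a b x := by rw [h.add, map_add]
  smul c a x := by rw [h.smul, map_smul]
  one := by rw [h.one, map_one]
  mul a x b y := by rw [← map_mul, h.mul]
  star a x := by rw [← map_star, h.star]
  norm_le a x := (NonUnitalStarAlgHom.norm_apply_le φ _).trans (h.norm_le a x)

theorem of_map {φ : C →⋆ₐ[ℂ] C'} (hφ : Function.Injective φ)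
    (h : IsCrossedFamily S fun a x => φ (d a x)) : IsCrossedFamily S d where
  add a b x := hφ (by rw [h.add, map_add])
  smul c a x := hφ (by rw [h.smul, map_smul])
  one := hφ (by rw [h.one, map_one])
  mul a x b y := hφ (by rw [map_mul, h.mul])
  star a x := hφ (by rw [map_star, h.star])
  norm_le a x := by
    rw [← NonUnitalStarAlgHom.norm_map φ hφ]
    exact h.norm_le a x

/-- `a ↦ d a x` as a linear map. -/
def linearMap (h : IsCrossedFamily S d) (x : G) : A →ₗ[ℂ] C where
  toFun a := d a x
  map_add' a b := h.add a b x
  map_smul' c a := h.smul c a x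

/-- Finite sums of the elements `d a x`. -/
def sum (h : IsCrossedFamily S d) : (G →₀ A) →ₗ[ℂ] C := Finsupp.lsum ℂ h.linearMap

theorem sum_single (h : IsCrossedFamily S d) (x : G) (a : A) :
    h.sum (Finsupp.single x a) = d a x := by
  rw [sum, Finsupp.lsum_single]
  rfl

/-- The span of the elements `d a x`, for `a` in the subspace `𝒜`. -/
def span (d : A → G → C) (𝒜 : Submodule ℂ A) : Submodule ℂ C :=
  Submodule.span ℂ {t | ∃ a ∈ 𝒜, ∃ g, t = d a g}

variable {𝒜 : Submodule ℂ A}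

theorem one_mem_span (h : IsCrossedFamily S d) (h1 : (1 : A) ∈ 𝒜) : 1 ∈ span d 𝒜 :=
  Submodule.subset_span ⟨1, h1, 1, h.one.symm⟩

theorem mul_mem_span (h : IsCrossedFamily S d) (hmul : ∀ a ∈ 𝒜, ∀ b ∈ 𝒜, a * b ∈ 𝒜)
    (hS : S.IsSmooth 𝒜) {s t : C} (hs : s ∈ span d 𝒜) (ht : t ∈ span d 𝒜) :
    s * t ∈ span d 𝒜 := by
  refine mul_mem_span_of_mul_mem ?_ hs ht
  rintro _ ⟨a, ha, x, rfl⟩ _ ⟨b, hb, y, rfl⟩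
  rw [h.mul]
  exact Submodule.subset_span
    ⟨_, hmul _ (hmul _ ha _ (hS.1 x b hb)) _ (hS.2 x y), _, rfl⟩

theorem star_mem_span (h : IsCrossedFamily S d) (hmul : ∀ a ∈ 𝒜, ∀ b ∈ 𝒜, a * b ∈ 𝒜)
    (hstar : ∀ a ∈ 𝒜, Star.star a ∈ 𝒜) (hS : S.IsSmooth 𝒜) {s : C} (hs : s ∈ span d 𝒜) :
    Star.star s ∈ span d 𝒜 := by
  refine star_mem_span_of_star_mem ?_ hs
  rintro _ ⟨a, ha, x, rfl⟩
  rw [h.star]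
  exact Submodule.subset_span
    ⟨_, hmul _ (hstar _ (hS.2 _ _)) _ (hS.1 _ _ (hstar a ha)), _, rfl⟩

theorem continuous (h : IsCrossedFamily S d) (x : G) : Continuous fun a => d a x :=
  ((h.linearMap x).mkContinuous 1 fun a => by rw [one_mul]; exact h.norm_le a x).continuous

theorem dense_span (h : IsCrossedFamily S d) (h1 : (1 : A) ∈ 𝒜)
    (hmul : ∀ a ∈ 𝒜, ∀ b ∈ 𝒜, a * b ∈ 𝒜) (hstar : ∀ a ∈ 𝒜, Star.star a ∈ 𝒜)
    (hd : Dense (𝒜 : Set A)) (hS : S.IsSmooth 𝒜)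
    (hgen : IsGenerating {t | ∃ a x, t = d a x}) : Dense (span d 𝒜 : Set C) := by
  refine hgen.dense _ (h.one_mem_span h1) (fun a ha b hb => h.mul_mem_span hmul hS ha hb)
    (fun a ha => h.star_mem_span hmul hstar hS ha) ?_
  rintro _ ⟨a, x, rfl⟩
  exact map_mem_closure (f := fun a => d a x) (h.continuous x) (hd a) fun b hb =>
    Submodule.subset_span ⟨b, hb, x, rfl⟩

theorem denseRange_sum (h : IsCrossedFamily S d) (hgen : IsGenerating {t | ∃ a x, t = d a x}) :
    DenseRange h.sum := by
  have hd : Dense (span d (⊤ : Submodule ℂ A) : Set C) :=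
    h.dense_span Submodule.mem_top (fun _ _ _ _ => Submodule.mem_top)
      (fun _ _ => Submodule.mem_top) (by simp)
      ⟨fun _ _ _ => Submodule.mem_top, fun _ _ => Submodule.mem_top⟩ hgen
  have hle : span d ⊤ ≤ LinearMap.range h.sum := by
    refine Submodule.span_le.mpr ?_
    rintro _ ⟨a, -, x, rfl⟩
    exact ⟨Finsupp.single x a, h.sum_single x a⟩
  exact hd.mono hle

theorem map_sum_of_map_eq (h : IsCrossedFamily S d) (h' : IsCrossedFamily S d') {F : Type*}
    [FunLike F C C'] [LinearMapClass F ℂ C C'] (φ : F) (hφ : ∀ a x, φ (d a x) = d' a x)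
    (f : G →₀ A) : φ (h.sum f) = h'.sum f := by
  induction f using Finsupp.induction_linear with
  | zero => simp
  | add a b ha hb => simp only [map_add, ha, hb]
  | single x a => rw [h.sum_single, h'.sum_single, hφ]

theorem map_mul_of_map_eq (h : IsCrossedFamily S d) (h' : IsCrossedFamily S d')
    (hgen : IsGenerating {t | ∃ a x, t = d a x}) {φ : C →L[ℂ] C'}
    (hφ : ∀ a x, φ (d a x) = d' a x) (s t : C) : φ (s * t) = φ s * φ t := by
  refine (h.denseRange_sum hgen).induction_on₂ (isClosed_eq (by fun_prop) (by fun_prop))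
    (fun f g => ?_) s t
  induction f using Finsupp.induction_linear with
  | zero => simp
  | add a b ha hb => simp only [map_add, add_mul, ha, hb]
  | single x a =>
    induction g using Finsupp.induction_linear with
    | zero => simp
    | add a b ha hb => simp only [map_add, mul_add, ha, hb]
    | single y b => rw [h.sum_single, h.sum_single, h.mul, hφ, hφ, hφ, h'.mul]

theorem map_star_of_map_eq (h : IsCrossedFamily S d) (h' : IsCrossedFamily S d')
    (hgen : IsGenerating {t | ∃ a x, t = d a x}) {φ : C →L[ℂ] C'}
    (hφ : ∀ a x, φ (d a x) = d' a x) (s : C) : φ (Star.star s) = Star.star (φ s) := by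
  refine (h.denseRange_sum hgen).induction_on s (isClosed_eq (by fun_prop) (by fun_prop))
    (fun f => ?_)
  induction f using Finsupp.induction_linear with
  | zero => simp
  | add a b ha hb => simp only [map_add, star_add, ha, hb]
  | single x a => rw [h.sum_single, h.star, hφ, hφ, h'.star]

theorem exists_hom (h : IsCrossedFamily S d) (h' : IsCrossedFamily S d')
    (hgen : IsGenerating {t | ∃ a x, t = d a x}) (hle : ∀ f, ‖h'.sum f‖ ≤ ‖h.sum f‖) :
    ∃ φ : C →⋆ₐ[ℂ] C', ∀ a x, φ (d a x) = d' a x := by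
  set E : C →L[ℂ] C' := h'.sum.extendOfNorm h.sum
  have hE : ∀ a x, E (d a x) = d' a x := fun a x => by
    rw [← h.sum_single, ← h'.sum_single]
    exact LinearMap.extendOfNorm_eq (h.denseRange_sum hgen)
      ⟨1, fun f => by rw [one_mul]; exact hle f⟩ _
  have hE1 : E 1 = 1 := by rw [← h.one, hE, h'.one]
  exact ⟨{ toFun := E
           map_one' := hE1
           map_mul' := h.map_mul_of_map_eq h' hgen hE
           map_zero' := map_zero E
           map_add' := map_add E
           commutes' := fun c => by
             rw [Algebra.algebraMap_eq_smul_one, Algebra.algebraMap_eq_smul_one, map_smul, hE1]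
           map_star' := h.map_star_of_map_eq h' hgen hE }, hE⟩

end IsCrossedFamily

end Family

section Covariant

variable {A : Type*} [CStarAlgebra A] {G : Type*} [Group G] {S : TwistedSystem A G}
  {K : Type*} [NormedAddCommGroup K] [InnerProductSpace ℂ K] [CompleteSpace K]

namespace CovariantRep

variable (R : CovariantRep S K)

theorem U_one : (R.U 1 : K →L[ℂ] K) = 1 := by
  have h := R.mul 1 1
  rw [S.σ_one_left, OneMemClass.coe_one, map_one, one_mul, mul_one] at h
  have h' := congrArg (star (R.U 1 : K →L[ℂ] K) * ·) h
  simpa [← mul_assoc] using h'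

theorem U_mul_π (x : G) (a : A) :
    (R.U x : K →L[ℂ] K) * R.π a = R.π (S.ρ x a) * (R.U x : K →L[ℂ] K) := by
  rw [R.cov, mul_assoc, Unitary.coe_star_mul_self, mul_one]

theorem star_U (x : G) :
    star (R.U x : K →L[ℂ] K) = R.π (star (S.σ x⁻¹ x : A)) * (R.U x⁻¹ : K →L[ℂ] K) := by
  have h := R.mul x⁻¹ x
  rw [inv_mul_cancel, R.U_one, mul_one] at h
  have h1 : R.π (star (S.σ x⁻¹ x : A)) * R.π (S.σ x⁻¹ x : A) = 1 := by
    rw [← map_mul, Unitary.coe_star_mul_self, map_one]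
  calc star (R.U x : K →L[ℂ] K)
      = R.π (star (S.σ x⁻¹ x : A)) * R.π (S.σ x⁻¹ x : A) * star (R.U x : K →L[ℂ] K) := by
        rw [h1, one_mul]
    _ = R.π (star (S.σ x⁻¹ x : A)) * (R.U x⁻¹ : K →L[ℂ] K) *
          ((R.U x : K →L[ℂ] K) * star (R.U x : K →L[ℂ] K)) := by
        rw [← h, mul_assoc, mul_assoc, mul_assoc]
    _ = _ := by rw [Unitary.mul_star_self_of_mem (R.U x).2, mul_one]

theorem isCrossedFamily : IsCrossedFamily S R.op where
  add a b x := by rw [op, op, op, map_add, add_mul]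
  smul c a x := by rw [op, op, map_smul, smul_mul_assoc]
  one := by rw [op, map_one, one_mul, R.U_one]
  mul a x b y := by
    rw [op, op, op, mul_assoc, ← mul_assoc (R.U x : K →L[ℂ] K), U_mul_π, mul_assoc, R.mul, map_mul,
      map_mul]
    simp only [mul_assoc]
  star a x := by
    rw [op, op, star_mul, ← map_star, star_U, map_mul, mul_assoc, mul_assoc, U_mul_π]
  norm_le a x := R.norm_op_le a x

end CovariantRep

end Covariant

/-! ### Fell absorption -/

section LeftReg

theorem L2_clm_ext {G : Type u} {E : Type*} [NormedAddCommGroup E] [NormedSpace ℂ E]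
    {X Y : L2 G →L[ℂ] E} (h : ∀ x, X (L2.δ x) = Y (L2.δ x)) : X = Y :=
  ContinuousLinearMap.ext_on (dense_span_L2δ G) (by rintro _ ⟨x, rfl⟩; exact h x)

variable {G : Type u} [Group G]

theorem leftReg_mul (x y : G) : leftReg x * leftReg y = leftReg (x * y) :=
  L2_clm_ext fun z => by
    rw [mul_apply_eq_comp, leftReg_L2δ, leftReg_L2δ, leftReg_L2δ, mul_assoc]

theorem leftReg_one : leftReg (1 : G) = 1 :=
  L2_clm_ext fun z => by
    rw [leftReg_L2δ, one_mul]
    rfl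

theorem star_leftReg (x : G) : star (leftReg x) = leftReg x⁻¹ := by
  refine Eq.symm ((ContinuousLinearMap.eq_adjoint_iff _ _).mpr fun f g => ?_)
  rw [lp.inner_eq_tsum, lp.inner_eq_tsum, ← (Equiv.mulLeft x⁻¹).tsum_eq]
  refine tsum_congr fun z => ?_
  change inner ℂ (f (x⁻¹⁻¹ * (x⁻¹ * z))) (g (x⁻¹ * z)) = inner ℂ (f z) (g (x⁻¹ * z))
  rw [inv_mul_cancel_left]

theorem norm_leftReg_le (x : G) : ‖leftReg x‖ ≤ 1 := by
  refine ContinuousLinearMap.opNorm_le_bound _ zero_le_one fun f => ?_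
  have := norm_weightedShiftₗ_le (E := fun _ : G => ℂ) (Equiv.mulLeft x⁻¹)
    (fun _ => ContinuousLinearMap.id ℂ ℂ) 1 (fun _ => ContinuousLinearMap.norm_id_le) f
  rwa [abs_one] at this

end LeftReg

section Fell

open HilbertTensor

variable {A : Type*} [CStarAlgebra A] {G : Type*} [Group G] {S : TwistedSystem A G}
  {K : Type*} [NormedAddCommGroup K] [InnerProductSpace ℂ K] [CompleteSpace K]

/-- The operators `a δₓ` of the regular representation on `ℓ²(G, K)` induced by a representation
`π` on `K`. This is `regOp` with `A`, `G` and `K` in arbitrary universes: the universal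
representation lives one universe above the algebra. -/
def inducedOp (S : TwistedSystem A G) (π : A →⋆ₐ[ℂ] (K →L[ℂ] K)) (a : A) (x : G) :
    lp (fun _ : G => K) 2 →L[ℂ] lp (fun _ : G => K) 2 :=
  weightedShift (E := fun _ : G => K) (Equiv.mulLeft x⁻¹)
    (fun z => π (S.ρ z⁻¹ a * S.σ z⁻¹ x)) ‖a‖ (fun z => by
      refine (NonUnitalStarAlgHom.norm_apply_le π _).trans ?_
      rw [CStarRing.norm_mul_coe_unitary]
      exact NonUnitalStarAlgHom.norm_apply_le (S.ρ z⁻¹).toStarAlgHom a)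

theorem inducedOp_single [DecidableEq G] (π : A →⋆ₐ[ℂ] (K →L[ℂ] K)) (a : A) (x y : G) (k : K) :
    inducedOp S π a x (lp.single 2 y k) =
      lp.single 2 (x * y) (π (S.ρ (x * y)⁻¹ a * S.σ (x * y)⁻¹ x) k) := by
  rw [inducedOp, weightedShift_single]
  simp only [Equiv.mulLeft_symm_apply, inv_inv]

namespace CovariantRep

variable (R : CovariantRep S K)

theorem norm_star_U_apply (x : G) (k : K) : ‖star (R.U x : K →L[ℂ] K) k‖ = ‖k‖ :=
  ContinuousLinearMap.norm_map_of_mem_unitary (Unitary.star_mem (R.U x).2) k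

/-- The isometries `k ↦ U_{z⁻¹}* k ⊗ δ_z`. -/
def fellIncl (z : G) : K →ₗᵢ[ℂ] HilbertTensor K (L2 G) where
  toLinearMap := (tmulL.flip (L2.δ z) ∘L star (R.U z⁻¹ : K →L[ℂ] K)).toLinearMap
  norm_map' k := by
    change ‖tmulL (star (R.U z⁻¹ : K →L[ℂ] K) k) (L2.δ z)‖ = ‖k‖
    rw [norm_tmulL, norm_L2δ, mul_one, norm_star_U_apply]

theorem star_U_U_apply (x : G) (k : K) :
    (star (R.U x : K →L[ℂ] K)) ((R.U x : K →L[ℂ] K) k) = k :=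
  DFunLike.congr_fun (Unitary.star_mul_self_of_mem (R.U x).2) k

theorem isHilbertSum_fellIncl : IsHilbertSum ℂ (fun _ : G => K) R.fellIncl := by
  classical
  refine IsHilbertSum.mk ?_ ?_
  · intro x y hxy v w
    change inner ℂ (tmulL _ (L2.δ x)) (tmulL _ (L2.δ y)) = 0
    rw [inner_tmulL, inner_L2δ, if_neg hxy, mul_zero]
  · refine (topologicalClosure_eq_top_of_tmulL_mem (s := Set.univ) (by simp)
      (dense_span_L2δ G) ?_).ge
    rintro k - _ ⟨x, rfl⟩
    refine Submodule.mem_iSup_of_mem x ?_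
    refine ⟨(R.U x⁻¹ : K →L[ℂ] K) k, ?_⟩
    change tmulL (star (R.U x⁻¹ : K →L[ℂ] K) _) (L2.δ x) = _
    rw [star_U_U_apply]

/-- The unitary `k ⊗ δ_z ↦ U_{z⁻¹} k ⊗ δ_z` from `K ⊗ ℓ²(G)` to `ℓ²(G, K)`. -/
def fellEquiv : HilbertTensor K (L2 G) ≃ₗᵢ[ℂ] lp (fun _ : G => K) 2 :=
  R.isHilbertSum_fellIncl.linearIsometryEquiv

open Classical in
theorem fellEquiv_tmulL (k : K) (z : G) :
    R.fellEquiv (tmulL k (L2.δ z)) = lp.single 2 z ((R.U z⁻¹ : K →L[ℂ] K) k) := by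
  have h := R.isHilbertSum_fellIncl.linearIsometryEquiv_symm_apply_single
    (i := z) ((R.U z⁻¹ : K →L[ℂ] K) k)
  rw [fellEquiv, ← LinearIsometryEquiv.eq_symm_apply, h]
  change _ = tmulL (star (R.U z⁻¹ : K →L[ℂ] K) _) (L2.δ z)
  rw [star_U_U_apply]

theorem fellEquiv_conj (a : A) (x : G) :
    R.fellEquiv.conjStarAlgEquiv (tensorOp (R.op a x) (leftReg x)) = inducedOp S R.π a x := by
  classical
  have h : R.fellEquiv.toContinuousLinearEquiv.toContinuousLinearMap ∘L
      tensorOp (R.op a x) (leftReg x) =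
      inducedOp S R.π a x ∘L R.fellEquiv.toContinuousLinearEquiv.toContinuousLinearMap := by
    refine clm_ext_of_dense (s := Set.univ) (by simp) (dense_span_L2δ G) ?_
    rintro k - _ ⟨y, rfl⟩
    change R.fellEquiv (tensorOp _ _ _) = inducedOp S R.π a x (R.fellEquiv _)
    rw [tensorOp_tmulL, leftReg_L2δ, fellEquiv_tmulL, fellEquiv_tmulL, inducedOp_single]
    congr 1
    have := R.isCrossedFamily.mul 1 (x * y)⁻¹ a x
    have hxy : (x * y)⁻¹ * x = y⁻¹ := by group
    rw [op, map_one, one_mul, one_mul, hxy] at this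
    exact DFunLike.congr_fun this k
  ext1 f
  rw [LinearIsometryEquiv.conjStarAlgEquiv_apply_apply]
  refine (DFunLike.congr_fun h (R.fellEquiv.symm f)).trans ?_
  change inducedOp S R.π a x (R.fellEquiv (R.fellEquiv.symm f)) = _
  rw [LinearIsometryEquiv.apply_symm_apply]

theorem isCrossedFamily_absorbed :
    IsCrossedFamily S fun a x => tensorOp (R.op a x) (leftReg x : L2 G →L[ℂ] L2 G) where
  add a b x := by rw [R.isCrossedFamily.add, tensorOp_add_left]
  smul c a x := by rw [R.isCrossedFamily.smul, tensorOp_smul_left]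
  one := by rw [R.isCrossedFamily.one, leftReg_one, tensorOp_one]
  mul a x b y := by rw [← tensorOp_mul, R.isCrossedFamily.mul, leftReg_mul]
  star a x := by rw [← tensorOp_star, R.isCrossedFamily.star, star_leftReg]
  norm_le a x := by
    refine (norm_tensorOp_le _ _).trans ?_
    refine (mul_le_mul (R.norm_op_le a x) (norm_leftReg_le x) (norm_nonneg _)
      (norm_nonneg _)).trans ?_
    rw [mul_one]

theorem isCrossedFamily_induced : IsCrossedFamily S (inducedOp S R.π) := by
  have := R.isCrossedFamily_absorbed.map R.fellEquiv.conjStarAlgEquiv.toStarAlgHom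
  convert this using 3 with a x
  exact (R.fellEquiv_conj a x).symm

end CovariantRep

end Fell

/-! ### Matrices of operators on `ℓ²(G, K)` -/

section MatrixRep

variable {A : Type*} [CStarAlgebra A] {n : Type*} [Fintype n]
  {K : Type*} [NormedAddCommGroup K] [InnerProductSpace ℂ K] [CompleteSpace K]

/-- The operator on `Kⁿ` with the matrix `π(Mᵢⱼ)`. -/
def matrixOp (π : A →⋆ₐ[ℂ] (K →L[ℂ] K)) (M : CStarMatrix n n A) :
    PiLp 2 (fun _ : n => K) →L[ℂ] PiLp 2 (fun _ : n => K) :=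
  (PiLp.continuousLinearEquiv 2 ℂ fun _ : n => K).symm.toContinuousLinearMap ∘L
    ContinuousLinearMap.pi fun i => ∑ j, π (M i j) ∘L PiLp.proj 2 (fun _ : n => K) j

theorem matrixOp_apply (π : A →⋆ₐ[ℂ] (K →L[ℂ] K)) (M : CStarMatrix n n A)
    (ξ : PiLp 2 fun _ : n => K) (i : n) : matrixOp π M ξ i = ∑ j, π (M i j) (ξ j) := by
  change (∑ j, π (M i j) ∘L PiLp.proj 2 (fun _ : n => K) j) ξ = _
  rw [_root_.sum_apply]
  rfl

theorem matrixOp_star (π : A →⋆ₐ[ℂ] (K →L[ℂ] K)) (M : CStarMatrix n n A) :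
    matrixOp π (star M) = star (matrixOp π M) := by
  refine (ContinuousLinearMap.eq_adjoint_iff _ _).mpr fun ξ η => ?_
  simp only [PiLp.inner_apply, matrixOp_apply, sum_inner, inner_sum, CStarMatrix.star_apply,
    map_star, ContinuousLinearMap.star_eq_adjoint, ContinuousLinearMap.adjoint_inner_left]
  exact Finset.sum_comm

theorem matrixOp_mul (π : A →⋆ₐ[ℂ] (K →L[ℂ] K)) (M N : CStarMatrix n n A) :
    matrixOp π (M * N) = matrixOp π M * matrixOp π N := by
  ext ξ i
  rw [mul_apply_eq_comp]
  simp only [matrixOp_apply, CStarMatrix.mul_apply, map_sum, map_mul, _root_.sum_apply,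
    mul_apply_eq_comp]
  exact Finset.sum_comm

/-- The representation of matrices over `A` on `Kⁿ` given by a representation of `A` on `K`. -/
def matrixRep (π : A →⋆ₐ[ℂ] (K →L[ℂ] K)) :
    CStarMatrix n n A →⋆ₙₐ[ℂ] (PiLp 2 (fun _ : n => K) →L[ℂ] PiLp 2 (fun _ : n => K)) where
  toFun := matrixOp π
  map_smul' c M := by
    ext ξ i
    simp [matrixOp_apply, Finset.smul_sum]
  map_zero' := by
    ext ξ i
    simp [matrixOp_apply]
  map_add' M N := by
    ext ξ i
    simp [matrixOp_apply, Finset.sum_add_distrib]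
  map_mul' := matrixOp_mul π
  map_star' := matrixOp_star π

theorem matrixRep_injective {π : A →⋆ₐ[ℂ] (K →L[ℂ] K)} (hπ : Function.Injective π) :
    Function.Injective (matrixRep (n := n) π) := by
  classical
  intro M N h
  ext i j
  refine hπ ?_
  ext k
  have h' := congrArg (fun ξ : PiLp 2 (fun _ : n => K) => ξ i)
    (DFunLike.congr_fun h (WithLp.toLp 2 (Pi.single j k)))
  have key : ∀ M : CStarMatrix n n A,
      matrixOp π M (WithLp.toLp 2 (Pi.single j k)) i = π (M i j) k := fun M => by
    rw [matrixOp_apply, Finset.sum_eq_single j]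
    · simp
    · intro l _ hl
      simp [Pi.single_eq_of_ne hl]
    · simp
  rw [← key M, ← key N]
  exact h'

theorem norm_matrixOp_le {K' : Type*} [NormedAddCommGroup K'] [InnerProductSpace ℂ K']
    [CompleteSpace K'] {π : A →⋆ₐ[ℂ] (K →L[ℂ] K)} (hπ : Function.Injective π)
    (π' : A →⋆ₐ[ℂ] (K' →L[ℂ] K')) (M : CStarMatrix n n A) : ‖matrixOp π' M‖ ≤ ‖matrixOp π M‖ := by
  let := CStarAlgebra.spectralOrder A
  let := CStarAlgebra.spectralOrderedRing A
  calc ‖matrixRep π' M‖ ≤ ‖M‖ := NonUnitalStarAlgHom.norm_apply_le (matrixRep π') M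
    _ = ‖matrixRep π M‖ :=
      (NonUnitalStarAlgHom.norm_map (matrixRep π) (matrixRep_injective hπ) M).symm

end MatrixRep

section Corner

variable {G : Type*} {K : Type*} [NormedAddCommGroup K]

open Classical in
/-- The inclusion of the finitely supported functions with support in `F` in `ℓ²(G, K)`. -/
def corner (F : Finset G) (ξ : PiLp 2 fun _ : F => K) : lp (fun _ : G => K) 2 :=
  ∑ i : F, lp.single 2 (i : G) (ξ i)

theorem corner_apply (F : Finset G) (ξ : PiLp 2 fun _ : F => K) (i : F) :
    corner F ξ i = ξ i := by
  classical
  rw [corner, lp.coeFn_sum, Finset.sum_apply, Finset.sum_eq_single i]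
  · simp
  · intro j _ hj
    rw [lp.single_apply, Pi.single_eq_of_ne]
    exact fun h => hj (Subtype.ext h).symm
  · simp

theorem tendsto_corner (f : lp (fun _ : G => K) 2) :
    Filter.Tendsto (fun F : Finset G => corner F (WithLp.toLp 2 fun i : F => f i)) Filter.atTop
      (nhds f) := by
  classical
  have h := lp.hasSum_single (p := 2) (by simp) f
  refine h.congr fun F => ?_
  rw [corner, ← Finset.sum_coe_sort F]

variable [InnerProductSpace ℂ K]

theorem inner_corner_right (F : Finset G) (f : lp (fun _ : G => K) 2) (ξ : PiLp 2 fun _ : F => K) :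
    inner ℂ f (corner F ξ) = ∑ i : F, inner ℂ (f i) (ξ i) := by
  simp only [corner, inner_sum, lp.inner_single_right]

theorem norm_corner (F : Finset G) (ξ : PiLp 2 fun _ : F => K) : ‖corner F ξ‖ = ‖ξ‖ := by
  have h : inner ℂ (corner F ξ) (corner F ξ) = inner ℂ ξ ξ := by
    rw [inner_corner_right, PiLp.inner_apply]
    simp only [corner_apply]
  rw [inner_self_eq_norm_sq_to_K, inner_self_eq_norm_sq_to_K] at h
  have h' : ‖corner F ξ‖ ^ 2 = ‖ξ‖ ^ 2 := by exact_mod_cast h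
  exact (sq_eq_sq₀ (norm_nonneg _) (norm_nonneg _)).mp h'

variable {A : Type*} [CStarAlgebra A] [CompleteSpace K]

open Classical in
/-- The operator `X` on `ℓ²(G, K)` has the matrix `π(m z y)`. -/
def HasMatrix (π : A →⋆ₐ[ℂ] (K →L[ℂ] K)) (X : lp (fun _ : G => K) 2 →L[ℂ] lp (fun _ : G => K) 2)
    (m : G → G → A) : Prop :=
  ∀ y k z, X (lp.single 2 y k) z = π (m z y) k

/-- The finite corner of an infinite matrix. -/
def cornerMatrix (m : G → G → A) (F : Finset G) : CStarMatrix F F A :=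
  CStarMatrix.ofMatrix fun i j => m i j

theorem HasMatrix.inner_corner {π : A →⋆ₐ[ℂ] (K →L[ℂ] K)}
    {X : lp (fun _ : G => K) 2 →L[ℂ] lp (fun _ : G => K) 2} {m : G → G → A}
    (h : HasMatrix π X m) (F : Finset G) (ξ η : PiLp 2 fun _ : F => K) :
    inner ℂ (X (corner F ξ)) (corner F η) = inner ℂ (matrixOp π (cornerMatrix m F) ξ) η := by
  classical
  rw [inner_corner_right, PiLp.inner_apply]
  refine Finset.sum_congr rfl fun i _ => ?_
  congr 1
  rw [matrixOp_apply, corner, map_sum, lp.coeFn_sum, Finset.sum_apply]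
  refine Finset.sum_congr rfl fun j _ => ?_
  exact h j (ξ j) i

theorem HasMatrix.norm_matrixOp_le {π : A →⋆ₐ[ℂ] (K →L[ℂ] K)}
    {X : lp (fun _ : G => K) 2 →L[ℂ] lp (fun _ : G => K) 2} {m : G → G → A}
    (h : HasMatrix π X m) (F : Finset G) : ‖matrixOp π (cornerMatrix m F)‖ ≤ ‖X‖ := by
  refine ContinuousLinearMap.opNorm_le_of_re_inner_le (𝕜 := ℂ) (norm_nonneg _) fun ξ η hξ hη => ?_
  rw [← h.inner_corner]
  refine (RCLike.re_le_norm _).trans ((norm_inner_le_norm _ _).trans ?_)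
  rw [norm_corner, hη, mul_one]
  refine (X.le_opNorm _).trans ?_
  rw [norm_corner, hξ, mul_one]

theorem HasMatrix.norm_le {K' : Type*} [NormedAddCommGroup K'] [InnerProductSpace ℂ K']
    [CompleteSpace K'] {π : A →⋆ₐ[ℂ] (K →L[ℂ] K)} (hπ : Function.Injective π)
    {π' : A →⋆ₐ[ℂ] (K' →L[ℂ] K')}
    {X : lp (fun _ : G => K) 2 →L[ℂ] lp (fun _ : G => K) 2}
    {X' : lp (fun _ : G => K') 2 →L[ℂ] lp (fun _ : G => K') 2} {m : G → G → A}
    (h : HasMatrix π X m) (h' : HasMatrix π' X' m) : ‖X'‖ ≤ ‖X‖ := by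
  refine ContinuousLinearMap.opNorm_le_of_re_inner_le (𝕜 := ℂ) (norm_nonneg _) fun f g hf hg => ?_
  refine (RCLike.re_le_norm _).trans ?_
  have hle : ∀ F ξ η, ‖inner ℂ (X' (corner F ξ)) (corner F η)‖ ≤
      ‖X‖ * ‖corner F ξ‖ * ‖corner F η‖ := fun F ξ η => by
    rw [h'.inner_corner, norm_corner, norm_corner]
    calc ‖inner ℂ (matrixOp π' (cornerMatrix m F) ξ) η‖
        ≤ ‖matrixOp π' (cornerMatrix m F) ξ‖ * ‖η‖ := norm_inner_le_norm _ _
      _ ≤ ‖matrixOp π' (cornerMatrix m F)‖ * ‖ξ‖ * ‖η‖ := by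
        gcongr
        exact (matrixOp π' (cornerMatrix m F)).le_opNorm ξ
      _ ≤ ‖X‖ * ‖ξ‖ * ‖η‖ := by
        gcongr
        exact (_root_.norm_matrixOp_le hπ π' _).trans (h.norm_matrixOp_le F)
  have hl := (((X'.continuous.tendsto f).comp (tendsto_corner f)).inner (𝕜 := ℂ)
    (tendsto_corner g)).norm
  have hr := ((tendsto_corner f).norm.const_mul ‖X‖).mul (tendsto_corner g).norm
  rw [hf, hg, mul_one, mul_one] at hr
  exact le_of_tendsto_of_tendsto' hl hr fun F => hle F _ _

end Corner

section Comparison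

variable {A : Type*} [CStarAlgebra A] {G : Type*} [Group G] {S : TwistedSystem A G}
  {K : Type*} [NormedAddCommGroup K] [InnerProductSpace ℂ K] [CompleteSpace K]
  {K' : Type*} [NormedAddCommGroup K'] [InnerProductSpace ℂ K'] [CompleteSpace K']

theorem hasMatrix_inducedOp_sum {π : A →⋆ₐ[ℂ] (K →L[ℂ] K)}
    (h : IsCrossedFamily S (inducedOp S π)) (f : G →₀ A) :
    HasMatrix π (h.sum f) fun z y => S.ρ z⁻¹ (f (z * y⁻¹)) * S.σ z⁻¹ (z * y⁻¹) := by
  classical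
  intro y k z
  induction f using Finsupp.induction_linear with
  | zero => simp
  | add a b ha hb =>
    simp only [map_add, Finsupp.add_apply, add_mul, add_apply, lp.coeFn_add, Pi.add_apply, ha, hb]
  | single x a =>
    rw [h.sum_single, inducedOp_single, lp.single_apply]
    by_cases hz : z = x * y
    · subst hz
      simp
    · have hx : z * y⁻¹ ≠ x := by
        rintro rfl
        exact hz (by group)
      simp [Pi.single_eq_of_ne hz, Finsupp.single_eq_of_ne hx]

theorem CovariantRep.norm_absorbed_sum_le (R : CovariantRep S K) (hR : Function.Injective R.π)
    (R' : CovariantRep S K') (f : G →₀ A) :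
    ‖R'.isCrossedFamily_absorbed.sum f‖ ≤ ‖R.isCrossedFamily_induced.sum f‖ := by
  have h := R'.isCrossedFamily_absorbed.map_sum_of_map_eq R'.isCrossedFamily_induced
    R'.fellEquiv.conjStarAlgEquiv.toStarAlgHom R'.fellEquiv_conj f
  rw [← NonUnitalStarAlgHom.norm_map R'.fellEquiv.conjStarAlgEquiv.toStarAlgHom
    R'.fellEquiv.conjStarAlgEquiv.injective, h]
  exact (hasMatrix_inducedOp_sum R.isCrossedFamily_induced f).norm_le hR
    (hasMatrix_inducedOp_sum R'.isCrossedFamily_induced f)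

end Comparison

/-! ### `*`-homomorphisms with dense range -/

section ClosedRange

open scoped CStarAlgebra ComplexStarModule

variable {C : Type*} [CStarAlgebra C] {C' : Type*} [CStarAlgebra C']

theorem cfc_max_min_norm_eq_self {a : C} (ha : IsSelfAdjoint a) :
    cfc (fun t : ℝ => max (-‖a‖) (min t ‖a‖)) a = a := by
  conv_rhs => rw [← cfc_id' ℝ a]
  refine cfc_congr fun t ht => ?_
  rcases subsingleton_or_nontrivial C with _ | _
  · rw [spectrum.of_subsingleton] at ht
    exact ht.elim
  · have hta : |t| ≤ ‖a‖ := spectrum.norm_le_norm_of_mem ht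
    rw [abs_le] at hta
    change max (-‖a‖) (min t ‖a‖) = t
    rw [min_eq_left hta.2, max_eq_right hta.1]

theorem exists_map_eq_norm_le_of_isSelfAdjoint (φ : C →⋆ₐ[ℂ] C') {a : C} (ha : IsSelfAdjoint a) :
    ∃ b, φ b = φ a ∧ ‖b‖ ≤ ‖φ a‖ := by
  refine ⟨cfc (fun t : ℝ => max (-‖φ a‖) (min t ‖φ a‖)) a, ?_,
    norm_cfc_le (norm_nonneg _) fun t _ => ?_⟩
  · rw [StarAlgHom.map_cfc φ _ a (by fun_prop) (map_continuous φ) ha (ha.map φ),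
      cfc_max_min_norm_eq_self (ha.map φ)]
  · rw [Real.norm_eq_abs, abs_le]
    exact ⟨le_max_left _ _, max_le (by linarith [norm_nonneg (φ a)]) (min_le_right _ _)⟩

theorem exists_map_eq_norm_le (φ : C →⋆ₐ[ℂ] C') (a : C) : ∃ b, φ b = φ a ∧ ‖b‖ ≤ 2 * ‖φ a‖ := by
  obtain ⟨b, hb, hbn⟩ := exists_map_eq_norm_le_of_isSelfAdjoint φ (ℜ a).2
  obtain ⟨c, hc, hcn⟩ := exists_map_eq_norm_le_of_isSelfAdjoint φ (ℑ a).2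
  rw [map_realPart] at hb hbn
  rw [map_imaginaryPart] at hc hcn
  refine ⟨b + Complex.I • c, ?_, ?_⟩
  · rw [map_add, map_smul, hb, hc, realPart_add_I_smul_imaginaryPart]
  · calc ‖b + Complex.I • c‖ ≤ ‖b‖ + ‖Complex.I • c‖ := norm_add_le _ _
      _ = ‖b‖ + ‖c‖ := by rw [norm_smul, Complex.norm_I, one_mul]
      _ ≤ ‖φ a‖ + ‖φ a‖ := add_le_add (hbn.trans (realPart.norm_le (φ a)))
        (hcn.trans (imaginaryPart.norm_le (φ a)))
      _ = 2 * ‖φ a‖ := (two_mul _).symm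

theorem surjective_of_denseRange_starAlgHom (φ : C →⋆ₐ[ℂ] C') (h : DenseRange φ) :
    Function.Surjective φ := by
  let f : NormedAddGroupHom C C' := (φ : C →+ C').mkNormedAddGroupHom 1 fun a => by
    rw [one_mul]
    exact NonUnitalStarAlgHom.norm_apply_le φ a
  have hf : f.SurjectiveOnWith f.range 2 := by
    rintro _ ⟨a, rfl⟩
    exact exists_map_eq_norm_le φ a
  intro c
  obtain ⟨a, ha, -⟩ := controlled_closure_of_complete two_pos one_pos hf c (h c)
  exact ⟨a, ha⟩

end ClosedRange

/-! ### The universal covariant representation -/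

section Block

theorem norm_coe_unitary_le_one {C : Type*} [NormedRing C] [StarRing C] [CStarRing C]
    (U : unitary C) : ‖(U : C)‖ ≤ 1 := by
  rcases subsingleton_or_nontrivial C with _ | _
  · rw [Subsingleton.elim (U : C) 0, norm_zero]
    exact zero_le_one
  · exact (CStarRing.norm_coe_unitary U).le

variable {ι : Type*} {E : ι → Type*} [∀ i, NormedAddCommGroup (E i)]
  [∀ i, InnerProductSpace ℂ (E i)]

/-- The direct sum of a bounded family of operators. -/
def blockOp (T : ∀ i, E i →L[ℂ] E i) (C : ℝ) (hC : ∀ i, ‖T i‖ ≤ C) : lp E 2 →L[ℂ] lp E 2 :=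
  weightedShift (Equiv.refl ι) T C hC

theorem blockOp_apply (T : ∀ i, E i →L[ℂ] E i) (C : ℝ) (hC : ∀ i, ‖T i‖ ≤ C) (f : lp E 2) (i : ι) :
    blockOp T C hC f i = T i (f i) := rfl

theorem blockOp_single [DecidableEq ι] (T : ∀ i, E i →L[ℂ] E i) (C : ℝ) (hC : ∀ i, ‖T i‖ ≤ C)
    (i : ι) (v : E i) : blockOp T C hC (lp.single 2 i v) = lp.single 2 i (T i v) := by
  ext j
  rw [blockOp_apply]
  by_cases h : j = i
  · subst h
    rw [lp.single_apply_self, lp.single_apply_self]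
  · rw [lp.single_apply_ne _ _ _ h, lp.single_apply_ne _ _ _ h, map_zero]

variable [∀ i, CompleteSpace (E i)]

theorem star_blockOp (T T' : ∀ i, E i →L[ℂ] E i) (C C' : ℝ) (hC : ∀ i, ‖T i‖ ≤ C)
    (hC' : ∀ i, ‖T' i‖ ≤ C') (h : ∀ i, star (T i) = T' i) :
    star (blockOp T C hC) = blockOp T' C' hC' := by
  refine Eq.symm ((ContinuousLinearMap.eq_adjoint_iff _ _).mpr fun f g => ?_)
  rw [lp.inner_eq_tsum, lp.inner_eq_tsum]
  refine tsum_congr fun i => ?_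
  rw [blockOp_apply, blockOp_apply, ← h, ContinuousLinearMap.star_eq_adjoint,
    ContinuousLinearMap.adjoint_inner_left]

/-- The direct sum of a family of representations. -/
def blockRep {A : Type*} [CStarAlgebra A] (π : ∀ i, A →⋆ₐ[ℂ] (E i →L[ℂ] E i)) :
    A →⋆ₐ[ℂ] (lp E 2 →L[ℂ] lp E 2) where
  toFun a := blockOp (fun i => π i a) ‖a‖ fun i => NonUnitalStarAlgHom.norm_apply_le (π i) a
  map_one' := by
    ext f i
    rw [blockOp_apply, map_one]
    rfl
  map_mul' a b := by
    ext f i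
    rw [blockOp_apply, map_mul]
    rfl
  map_zero' := by
    ext f i
    rw [blockOp_apply, map_zero]
    rfl
  map_add' a b := by
    ext f i
    rw [blockOp_apply, map_add]
    rfl
  commutes' c := by
    ext f i
    rw [blockOp_apply, AlgHomClass.commutes]
    rfl
  map_star' a := (star_blockOp _ _ _ _ _ _ fun i => (map_star (π i) a).symm).symm

theorem star_blockOp_unitary_apply (U : ∀ i, unitary (E i →L[ℂ] E i)) (f : lp E 2) (i : ι) :
    star (blockOp (fun i => (U i : E i →L[ℂ] E i)) 1 fun i => norm_coe_unitary_le_one (U i)) f i =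
      star (U i : E i →L[ℂ] E i) (f i) := by
  rw [star_blockOp _ (fun i => star (U i : E i →L[ℂ] E i)) _ 1 _
    (fun i => norm_coe_unitary_le_one (star (U i))) fun i => rfl]
  rfl

/-- The direct sum of a family of unitaries. -/
def blockUnitary (U : ∀ i, unitary (E i →L[ℂ] E i)) : unitary (lp E 2 →L[ℂ] lp E 2) :=
  ⟨blockOp (fun i => (U i : E i →L[ℂ] E i)) 1 fun i => norm_coe_unitary_le_one (U i), by
    rw [Unitary.mem_iff]
    constructor
    · ext f i
      rw [mul_apply_eq_comp, star_blockOp_unitary_apply]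
      exact DFunLike.congr_fun (Unitary.star_mul_self_of_mem (U i).2) (f i)
    · ext f i
      rw [mul_apply_eq_comp, blockOp_apply, star_blockOp_unitary_apply]
      exact DFunLike.congr_fun (Unitary.mul_star_self_of_mem (U i).2) (f i)⟩

open Classical in
/-- The inclusion of a summand in a Hilbert space direct sum. -/
def blockIncl (E : ι → Type*) [∀ i, NormedAddCommGroup (E i)] [∀ i, InnerProductSpace ℂ (E i)]
    (i : ι) : E i →ₗᵢ[ℂ] lp E 2 where
  toLinearMap := lp.lsingle 2 i
  norm_map' v := lp.norm_single (by simp) i v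

end Block

section Universal

variable {A G : Type u} [CStarAlgebra A] [Group G] (S : TwistedSystem A G)

/-- The direct sum of all covariant representations. -/
def univRep : CovariantRep S (UnivSpace S) where
  π := blockRep fun R : SomeCovariantRep S => R.rep.π
  U x := blockUnitary fun R : SomeCovariantRep S => R.rep.U x
  mul x y := by
    ext f R
    exact DFunLike.congr_fun (R.rep.mul x y) (f R)
  cov x a := by
    ext f R
    refine (DFunLike.congr_fun (R.rep.cov x a) (f R)).trans ?_
    exact congrArg (fun k => (R.rep.U x : R.K →L[ℂ] R.K) (R.rep.π a k))
      (star_blockOp_unitary_apply (fun R : SomeCovariantRep S => R.rep.U x) f R).symm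

theorem univRep_op (a : A) (x : G) : (univRep S).op a x = univOp S a x := by
  ext f R
  rfl

end Universal

/-! ### The integrated form and the coaction -/

section Crossed

variable {A G : Type u} [CStarAlgebra A] [Group G] {S : TwistedSystem A G}
  {H : Type u} [NormedAddCommGroup H] [InnerProductSpace ℂ H] [CompleteSpace H]

theorem isCrossedFamily_univOp (S : TwistedSystem A G) : IsCrossedFamily S (univOp S) := by
  have h := (univRep S).isCrossedFamily
  rwa [show (univRep S).op = univOp S from funext₂ (univRep_op S)] at h

theorem isCrossedFamily_fullδ (S : TwistedSystem A G) : IsCrossedFamily S (fullδ S) :=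
  IsCrossedFamily.of_map (OpAlg.val_injective (univGen S)) (isCrossedFamily_univOp S)

theorem isCrossedFamily_tmul_fullδ (S : TwistedSystem A G) :
    IsCrossedFamily S fun a x => MinTensor.tmul (fullδ S a x) (grpδ x) := by
  refine IsCrossedFamily.of_map (OpAlg.val_injective (tensorGen (univGen S) (grpGen G))) ?_
  have h := (univRep S).isCrossedFamily_absorbed
  simp only [univRep_op] at h
  exact h

namespace CovariantRep

variable (R : CovariantRep S H)

theorem isCrossedFamily_repδ : IsCrossedFamily S (repδ R) :=
  IsCrossedFamily.of_map (OpAlg.val_injective (repGen R)) R.isCrossedFamily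

theorem isGenerating_repδ : IsGenerating {t | ∃ a x, t = repδ R a x} :=
  (OpAlg.isGenerating (repGen R)).mono (by rintro _ ⟨_, ⟨a, x, rfl⟩, rfl⟩; exact ⟨a, x, rfl⟩)

theorem isCrossedFamily_redδ : IsCrossedFamily S (redδ S R.π) :=
  IsCrossedFamily.of_map (OpAlg.val_injective (regGen S R.π)) R.isCrossedFamily_induced

theorem isGenerating_redδ : IsGenerating {t | ∃ a x, t = redδ S R.π a x} :=
  (OpAlg.isGenerating (regGen S R.π)).mono
    (by rintro _ ⟨_, ⟨a, x, rfl⟩, rfl⟩; exact ⟨a, x, rfl⟩)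

/-- The inclusion of the Hilbert space of a covariant representation in that of the universal
one. -/
def univIncl : H →ₗᵢ[ℂ] UnivSpace S :=
  blockIncl (fun R : SomeCovariantRep S => R.K) (SomeCovariantRep.mk H R)

theorem univOp_univIncl (a : A) (x : G) (ξ : H) :
    univOp S a x (R.univIncl ξ) = R.univIncl (R.op a x ξ) := by
  classical
  exact blockOp_single (E := fun R : SomeCovariantRep S => R.K) _ _
    (fun R => R.rep.norm_op_le a x) (SomeCovariantRep.mk H R) ξ

theorem univGen_subset_reducingAlg : univGen S ⊆ reducingAlg R.univIncl := by
  rintro _ ⟨a, x, rfl⟩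
  refine mem_reducingAlg_of_intertwines (R.univOp_univIncl a x)
    (Y' := R.op (star (S.σ x⁻¹ x : A) * S.ρ x⁻¹ (star a)) x⁻¹) fun ξ => ?_
  rw [(isCrossedFamily_univOp S).star]
  exact R.univOp_univIncl _ _ ξ

theorem compression_fullδ (a : A) (x : G) :
    compression R.univIncl R.univGen_subset_reducingAlg (fullδ S a x) = R.op a x :=
  compression_eq_of_intertwines _ _ _ (R.univOp_univIncl a x)

/-- The integrated form `π × U` of a covariant representation: the universal representation contains
`(π, U)` as a summand, and `π × U` is the compression to it. -/
def integratedForm : FullCrossed S →⋆ₐ[ℂ] RepAlg R :=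
  OpAlg.codRestrict (compression R.univIncl R.univGen_subset_reducingAlg) (by
    rintro _ ⟨a, x, rfl⟩
    exact (R.compression_fullδ a x).symm ▸ mem_cstarGen ⟨a, x, rfl⟩)

theorem integratedForm_fullδ (a : A) (x : G) : R.integratedForm (fullδ S a x) = repδ R a x :=
  OpAlg.val_injective _ (R.compression_fullδ a x)

theorem integratedForm_surjective : Function.Surjective R.integratedForm := by
  refine surjective_of_denseRange_starAlgHom R.integratedForm
    ((R.isCrossedFamily_repδ.denseRange_sum R.isGenerating_repδ).mono ?_)
  rintro _ ⟨f, rfl⟩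
  exact ⟨_, (isCrossedFamily_fullδ S).map_sum_of_map_eq R.isCrossedFamily_repδ R.integratedForm
    R.integratedForm_fullδ f⟩

/-- The map `(π × U) ⊗ id` on minimal tensor products, again as a compression. -/
def integratedFormTensor :
    MinTensor (univGen S) (grpGen G) →⋆ₐ[ℂ] MinTensor (repGen R) (grpGen G) :=
  OpAlg.codRestrict (compression (HilbertTensor.mapIsometry R.univIncl LinearIsometry.id)
    (tensorGen_subset_reducingAlg R.univGen_subset_reducingAlg)) (by
      rintro _ ⟨b, c, rfl⟩
      exact (compression_tmul R.univGen_subset_reducingAlg b c).symm ▸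
        mem_cstarGen ⟨R.integratedForm b, c, rfl⟩)

theorem integratedFormTensor_tmul (b : FullCrossed S) (c : ReducedGroupAlg G) :
    R.integratedFormTensor (MinTensor.tmul b c) = MinTensor.tmul (R.integratedForm b) c :=
  OpAlg.val_injective _ (compression_tmul R.univGen_subset_reducingAlg b c)

theorem exists_coaction (hR : Function.Injective R.π) :
    ∃ φ : ReducedCrossed S R.π →⋆ₐ[ℂ] MinTensor (univGen S) (grpGen G),
      ∀ a x, φ (redδ S R.π a x) = MinTensor.tmul (fullδ S a x) (grpδ x) := by
  refine R.isCrossedFamily_redδ.exists_hom (isCrossedFamily_tmul_fullδ S) R.isGenerating_redδ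
    fun f => ?_
  have h1 := (isCrossedFamily_tmul_fullδ S).map_sum_of_map_eq (univRep S).isCrossedFamily_absorbed
    (OpAlg.val (tensorGen (univGen S) (grpGen G))) (fun a x => by rw [univRep_op]; rfl) f
  have h2 := R.isCrossedFamily_redδ.map_sum_of_map_eq R.isCrossedFamily_induced
    (OpAlg.val (regGen S R.π)) (fun a x => rfl) f
  rw [← OpAlg.norm_val, h1, ← OpAlg.norm_val, h2]
  exact R.norm_absorbed_sum_le hR (univRep S) f

theorem injective_of_redδ (ψ : ReducedCrossed S R.π →⋆ₐ[ℂ] MinTensor (repGen R) (grpGen G))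
    (h : ∀ a x, ψ (redδ S R.π a x) = MinTensor.tmul (repδ R a x) (grpδ x)) :
    Function.Injective ψ := by
  have key : (R.fellEquiv.conjStarAlgEquiv.toStarAlgHom.comp (OpAlg.val _)).comp ψ =
      OpAlg.val (regGen S R.π) := by
    refine OpAlg.hom_ext ?_
    rintro _ ⟨a, x, rfl⟩
    change R.fellEquiv.conjStarAlgEquiv (OpAlg.val _ (ψ (redδ S R.π a x))) = regOp S R.π a x
    rw [h]
    exact R.fellEquiv_conj a x
  refine Function.Injective.of_comp (f := R.fellEquiv.conjStarAlgEquiv.toStarAlgHom.comp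
    (OpAlg.val (tensorGen (repGen R) (grpGen G)))) ?_
  rw [← StarAlgHom.coe_comp, key]
  exact OpAlg.val_injective _

end CovariantRep

end Crossed

/-! ### The representation of the exterior product -/

section DoubleHom

variable {E : Type*} [NormedAddCommGroup E] [InnerProductSpace ℂ E]

theorem stdGrading_mul_self : stdGrading E * stdGrading E = 1 := by
  ext p
  refine WithLp.ofLp_injective 2 (Prod.ext rfl ?_)
  exact neg_neg _

theorem doubleOp_mul_stdGrading (T : E →L[ℂ] E) :
    doubleOp T * stdGrading E = stdGrading E * doubleOp T := by
  ext p
  refine WithLp.ofLp_injective 2 (Prod.ext rfl ?_)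
  exact map_neg T _

variable [CompleteSpace E]

theorem star_doubleOp (T : E →L[ℂ] E) : star (doubleOp T) = doubleOp (star T) := by
  refine Eq.symm ((ContinuousLinearMap.eq_adjoint_iff _ _).mpr fun p q => ?_)
  rw [WithLp.prod_inner_apply, WithLp.prod_inner_apply]
  change inner ℂ (star T p.fst) q.fst + inner ℂ (star T p.snd) q.snd =
    inner ℂ p.fst (T q.fst) + inner ℂ p.snd (T q.snd)
  rw [ContinuousLinearMap.star_eq_adjoint, ContinuousLinearMap.adjoint_inner_left,
    ContinuousLinearMap.adjoint_inner_left]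

/-- `T ↦ T ⊕ T` as a unital `*`-homomorphism. -/
def doubleHom (E : Type*) [NormedAddCommGroup E] [InnerProductSpace ℂ E] [CompleteSpace E] :
    (E →L[ℂ] E) →⋆ₐ[ℂ] (Double E →L[ℂ] Double E) where
  toFun := doubleOp
  map_one' := rfl
  map_mul' _ _ := rfl
  map_zero' := rfl
  map_add' _ _ := rfl
  commutes' _ := rfl
  map_star' T := (star_doubleOp T).symm

theorem isSelfAdjoint_stdGrading : IsSelfAdjoint (stdGrading E) := by
  refine Eq.symm ((ContinuousLinearMap.eq_adjoint_iff _ _).mpr fun p q => ?_)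
  rw [WithLp.prod_inner_apply, WithLp.prod_inner_apply]
  change inner ℂ p.fst q.fst + inner ℂ (-p.snd) q.snd =
    inner ℂ p.fst q.fst + inner ℂ p.snd (-q.snd)
  rw [inner_neg_left, inner_neg_right]

theorem IsGenerating.map_mul_stdGrading {C : Type*} [CStarAlgebra C] {g : Set C}
    (hg : IsGenerating g) {rep : C →⋆ₐ[ℂ] (Double E →L[ℂ] Double E)}
    (hrep : ∀ x ∈ g, ∃ T, rep x = doubleOp T) (x : C) :
    rep x * stdGrading E = stdGrading E * rep x := by
  let Z := StarSubalgebra.centralizer ℂ {stdGrading E}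
  have isClosed_Z : IsClosed (Z : Set (Double E →L[ℂ] Double E)) := by
    rw [StarSubalgebra.coe_centralizer]
    exact Set.isClosed_centralizer _
  have hx : rep x ∈ Z := by
    refine hg.hom_mem rep isClosed_Z (fun y hy => ?_) x
    obtain ⟨T, hT⟩ := hrep y hy
    rw [hT, StarSubalgebra.mem_centralizer_iff]
    rintro _ rfl
    rw [isSelfAdjoint_stdGrading.star_eq, doubleOp_mul_stdGrading]
    exact ⟨rfl, rfl⟩
  exact ((StarSubalgebra.mem_centralizer_iff ℂ).mp hx _ rfl).1.symm

end DoubleHom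

section ElementaryTensors

variable {K : Type*} [NormedAddCommGroup K] [InnerProductSpace ℂ K] [CompleteSpace K]
  {L : Type*} [NormedAddCommGroup L] [InnerProductSpace ℂ L] [CompleteSpace L]
  {s : Set (K →L[ℂ] K)} {t : Set (L →L[ℂ] L)}

namespace MinTensor

theorem tmul_one_one : tmul (1 : OpAlg s) (1 : OpAlg t) = 1 :=
  OpAlg.val_injective _ (by rw [val_tmul, map_one, map_one, map_one, tensorOp_one])

theorem tmul_mul_tmul (b b' : OpAlg s) (c c' : OpAlg t) :
    tmul b c * tmul b' c' = tmul (b * b') (c * c') :=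
  OpAlg.val_injective _ (by
    rw [map_mul, val_tmul, val_tmul, val_tmul, map_mul, map_mul, tensorOp_mul])

theorem star_tmul (b : OpAlg s) (c : OpAlg t) : star (tmul b c) = tmul (star b) (star c) :=
  OpAlg.val_injective _ (by rw [map_star, val_tmul, val_tmul, map_star, map_star, tensorOp_star])

theorem continuous_tmul : Continuous fun p : OpAlg s × OpAlg t => tmul p.1 p.2 := by
  refine (OpAlg.isometry_val (tensorGen s t)).isUniformInducing.isInducing.continuous_iff.mpr ?_
  have hval : Continuous fun p : OpAlg s × OpAlg t => (OpAlg.val s p.1, OpAlg.val t p.2) :=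
    (OpAlg.isometry_val s).continuous.prodMap (OpAlg.isometry_val t).continuous
  simpa only [Function.comp_def, val_tmul] using continuous_tensorOp.comp hval

/-- The algebraic tensor product of two subspaces, as a subspace of the minimal tensor product. -/
def algTensor (𝒞 : Submodule ℂ (OpAlg s)) (𝒟 : Submodule ℂ (OpAlg t)) :
    Submodule ℂ (MinTensor s t) :=
  Submodule.span ℂ {x | ∃ b ∈ 𝒞, ∃ c ∈ 𝒟, x = tmul b c}

variable {𝒞 : Submodule ℂ (OpAlg s)} {𝒟 : Submodule ℂ (OpAlg t)}

theorem one_mem_algTensor (h : 1 ∈ 𝒞) (h' : 1 ∈ 𝒟) : 1 ∈ algTensor 𝒞 𝒟 :=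
  Submodule.subset_span ⟨1, h, 1, h', tmul_one_one.symm⟩

theorem mul_mem_algTensor (h : ∀ a ∈ 𝒞, ∀ b ∈ 𝒞, a * b ∈ 𝒞) (h' : ∀ a ∈ 𝒟, ∀ b ∈ 𝒟, a * b ∈ 𝒟)
    {x y : MinTensor s t} (hx : x ∈ algTensor 𝒞 𝒟) (hy : y ∈ algTensor 𝒞 𝒟) :
    x * y ∈ algTensor 𝒞 𝒟 := by
  refine mul_mem_span_of_mul_mem ?_ hx hy
  rintro _ ⟨b, hb, c, hc, rfl⟩ _ ⟨b', hb', c', hc', rfl⟩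
  rw [tmul_mul_tmul]
  exact Submodule.subset_span ⟨_, h b hb b' hb', _, h' c hc c' hc', rfl⟩

theorem star_mem_algTensor (h : ∀ a ∈ 𝒞, star a ∈ 𝒞) (h' : ∀ a ∈ 𝒟, star a ∈ 𝒟)
    {x : MinTensor s t} (hx : x ∈ algTensor 𝒞 𝒟) : star x ∈ algTensor 𝒞 𝒟 := by
  refine star_mem_span_of_star_mem ?_ hx
  rintro _ ⟨b, hb, c, hc, rfl⟩
  rw [star_tmul]
  exact Submodule.subset_span ⟨_, h b hb, _, h' c hc, rfl⟩

theorem dense_algTensor (h1 : 1 ∈ 𝒞) (h1' : 1 ∈ 𝒟) (hm : ∀ a ∈ 𝒞, ∀ b ∈ 𝒞, a * b ∈ 𝒞)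
    (hm' : ∀ a ∈ 𝒟, ∀ b ∈ 𝒟, a * b ∈ 𝒟) (hs : ∀ a ∈ 𝒞, star a ∈ 𝒞) (hs' : ∀ a ∈ 𝒟, star a ∈ 𝒟)
    (hd : Dense (𝒞 : Set (OpAlg s))) (hd' : Dense (𝒟 : Set (OpAlg t))) :
    Dense (algTensor 𝒞 𝒟 : Set (MinTensor s t)) := by
  refine (OpAlg.isGenerating (tensorGen s t)).dense _ (one_mem_algTensor h1 h1')
    (fun a ha b hb => mul_mem_algTensor hm hm' ha hb) (fun a ha => star_mem_algTensor hs hs' ha) ?_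
  rintro _ ⟨_, ⟨b, c, rfl⟩, rfl⟩
  exact map_mem_closure₂ (f := tmul) continuous_tmul (hd b) (hd' c) fun b' hb' c' hc' =>
    Submodule.subset_span ⟨b', hb', c', hc', rfl⟩

end MinTensor

end ElementaryTensors

/-! ### Spectral triples -/

section Triples

theorem hasBoundedCommutator_of_mem_span {C : Type*} [CStarAlgebra C] {E : Type*}
    [NormedAddCommGroup E] [InnerProductSpace ℂ E] [CompleteSpace E] {D : E →ₗ.[ℂ] E}
    (π : C →⋆ₐ[ℂ] (E →L[ℂ] E)) {g : Set C} (h : ∀ a ∈ g, HasBoundedCommutator D (π a)) {a : C}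
    (ha : a ∈ Submodule.span ℂ g) : HasBoundedCommutator D (π a) := by
  have hle : Submodule.span ℂ g ≤ (boundedCommutators D).comap π.toAlgHom.toLinearMap :=
    Submodule.span_le.mpr h
  exact hle ha

variable {A : Type u} [CStarAlgebra A] {H : Type v} [NormedAddCommGroup H]
    [InnerProductSpace ℂ H] [CompleteSpace H]

theorem IsEvenSpectralTriple.pullback {A' : Type w} [CStarAlgebra A'] {ψ : A' →⋆ₐ[ℂ] A}
    {P : EvenTripleData A H} {Q : EvenTripleData A' H} (hP : IsEvenSpectralTriple P)
    (h : IsPullback ψ P Q) (one_mem : (1 : A') ∈ Q.alg)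
    (mul_mem : ∀ a ∈ Q.alg, ∀ b ∈ Q.alg, a * b ∈ Q.alg)
    (star_mem : ∀ a ∈ Q.alg, star a ∈ Q.alg) (dense : Dense (Q.alg : Set A')) :
    IsEvenSpectralTriple Q := by
  obtain ⟨⟨alg, rep, dirac⟩, grading⟩ := Q
  obtain ⟨smooth, rep_eq, dirac_eq, grading_eq⟩ := h
  dsimp only at smooth rep_eq dirac_eq grading_eq one_mem mul_mem star_mem dense
  subst rep_eq dirac_eq grading_eq
  exact
    { one_mem, mul_mem, star_mem, dense
      selfAdjoint := hP.selfAdjoint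
      compact := hP.compact
      commutator := fun a ha => hP.commutator (ψ a) (smooth a ha)
      grading_selfAdjoint := hP.grading_selfAdjoint
      grading_sq := hP.grading_sq
      grading_comm := fun a => hP.grading_comm (ψ a)
      grading_dirac := hP.grading_dirac }

end Triples

section Group

variable {G : Type u} [Group G]

theorem grpδ_one : grpδ (1 : G) = 1 :=
  OpAlg.val_injective (grpGen G) leftReg_one

theorem grpδ_mul (x y : G) : grpδ x * grpδ y = grpδ (x * y) :=
  OpAlg.val_injective (grpGen G) (leftReg_mul x y)

theorem star_grpδ (x : G) : star (grpδ x) = grpδ x⁻¹ :=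
  OpAlg.val_injective (grpGen G) (star_leftReg x)

theorem one_mem_span_grpδ : (1 : ReducedGroupAlg G) ∈ Submodule.span ℂ (Set.range grpδ) :=
  Submodule.subset_span ⟨1, grpδ_one⟩

theorem mul_mem_span_grpδ {a b : ReducedGroupAlg G} (ha : a ∈ Submodule.span ℂ (Set.range grpδ))
    (hb : b ∈ Submodule.span ℂ (Set.range grpδ)) : a * b ∈ Submodule.span ℂ (Set.range grpδ) := by
  refine mul_mem_span_of_mul_mem ?_ ha hb
  rintro _ ⟨x, rfl⟩ _ ⟨y, rfl⟩
  exact Submodule.subset_span ⟨x * y, (grpδ_mul x y).symm⟩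

theorem star_mem_span_grpδ {a : ReducedGroupAlg G} (ha : a ∈ Submodule.span ℂ (Set.range grpδ)) :
    star a ∈ Submodule.span ℂ (Set.range grpδ) := by
  refine star_mem_span_of_star_mem ?_ ha
  rintro _ ⟨x, rfl⟩
  exact Submodule.subset_span ⟨x⁻¹, (star_grpδ x).symm⟩

theorem dense_span_grpδ :
    Dense ((Submodule.span ℂ (Set.range grpδ) : Submodule ℂ (ReducedGroupAlg G)) :
      Set (ReducedGroupAlg G)) := by
  refine (OpAlg.isGenerating (grpGen G)).dense _ one_mem_span_grpδ
    (fun _ ha _ hb => mul_mem_span_grpδ ha hb) (fun _ ha => star_mem_span_grpδ ha) ?_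
  rintro _ ⟨_, ⟨x, rfl⟩, rfl⟩
  exact subset_closure (Submodule.subset_span ⟨x, rfl⟩)

variable {V : Type v} [NormedAddCommGroup V] [InnerProductSpace ℂ V] [FiniteDimensional ℂ V]
  [CompleteSpace V] {ℓ : G → V →L[ℂ] V}

theorem isSpectralTriple_groupTriple (hℓ : IsProperLength ℓ) :
    IsSpectralTriple (groupTriple (V := V) ℓ) where
  one_mem := one_mem_span_grpδ
  mul_mem _ ha _ hb := mul_mem_span_grpδ ha hb
  star_mem _ ha := star_mem_span_grpδ ha
  dense := dense_span_grpδ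
  selfAdjoint := isSelfAdjoint_lengthDirac hℓ.selfAdjoint
  compact := by
    change ∃ S, IsInvSqrtOneAddSq (lengthDirac ℓ) S ∧ _
    rw [lengthDirac_eq_diagOp hℓ.selfAdjoint]
    exact exists_isInvSqrtOneAddSq_diagOp _ _ hℓ.finite_lengthEigenvalue
  commutator a ha := by
    refine hasBoundedCommutator_of_mem_span _ ?_ ha
    rintro _ ⟨x, rfl⟩
    exact (hasBoundedCommutator_lengthCore hℓ.translation x).closure
      (isClosable_lengthCore hℓ.selfAdjoint)

end Group

section Rep

variable {A G H : Type u} [CStarAlgebra A] [Group G] [NormedAddCommGroup H]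
  [InnerProductSpace ℂ H] [CompleteSpace H] {S : TwistedSystem A G}

theorem isSpectralTriple_repTriple {T : TripleData A H} (hT : IsSpectralTriple T)
    (R : CovariantRep S H) (hπ : T.rep = R.π) (hsmooth : S.IsSmooth T.alg)
    (hequiv : ∀ g, HasBoundedCommutator T.dirac (R.U g : H →L[ℂ] H)) :
    IsSpectralTriple (repTriple R T.alg T.dirac) where
  one_mem := R.isCrossedFamily_repδ.one_mem_span hT.one_mem
  mul_mem _ ha _ hb := R.isCrossedFamily_repδ.mul_mem_span hT.mul_mem hsmooth ha hb
  star_mem _ ha := R.isCrossedFamily_repδ.star_mem_span hT.mul_mem hT.star_mem hsmooth ha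
  dense := R.isCrossedFamily_repδ.dense_span hT.one_mem hT.mul_mem hT.star_mem hT.dense hsmooth
    R.isGenerating_repδ
  selfAdjoint := hT.selfAdjoint
  compact := hT.compact
  commutator _ hb := by
    refine hasBoundedCommutator_of_mem_span _ ?_ hb
    rintro _ ⟨a, ha, g, rfl⟩
    exact (hπ ▸ hT.commutator a ha : HasBoundedCommutator T.dirac (R.π a)).mul (hequiv g)

end Rep

section Exterior

variable {H₁ : Type u} [NormedAddCommGroup H₁] [InnerProductSpace ℂ H₁] [CompleteSpace H₁]
  {H₂ : Type v} [NormedAddCommGroup H₂] [InnerProductSpace ℂ H₂] [CompleteSpace H₂]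
  {K₁ : Type w} [NormedAddCommGroup K₁] [InnerProductSpace ℂ K₁] [CompleteSpace K₁]
  {K₂ : Type w'} [NormedAddCommGroup K₂] [InnerProductSpace ℂ K₂] [CompleteSpace K₂]
  {s₁ : Set (K₁ →L[ℂ] K₁)} {s₂ : Set (K₂ →L[ℂ] K₂)}

theorem IsExteriorProduct.isEvenSpectralTriple
    {T₁ : TripleData (OpAlg s₁) H₁} {T₂ : TripleData (OpAlg s₂) H₂}
    {P : EvenTripleData (MinTensor s₁ s₂) (Double (HilbertTensor H₁ H₂))}
    (hP : IsExteriorProduct T₁ T₂ P) (h₁ : IsSpectralTriple T₁) (h₂ : IsSpectralTriple T₂) :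
    IsEvenSpectralTriple P := by
  obtain ⟨⟨alg, rep, dirac⟩, grading⟩ := P
  obtain ⟨alg_eq, rep_tmul, dirac_eq, grading_eq⟩ := hP
  dsimp only at alg_eq rep_tmul dirac_eq grading_eq
  subst alg_eq dirac_eq grading_eq
  obtain ⟨ι, b, μ, hμ, hb⟩ := exists_eigenbasis h₁.selfAdjoint h₁.compact
  obtain ⟨κ, c, ν, hν, hc⟩ := exists_eigenbasis h₂.selfAdjoint h₂.compact
  have hD₁ := isFormalAdjoint_of_isSelfAdjoint h₁.selfAdjoint
  have hD₂ := isFormalAdjoint_of_isSelfAdjoint h₂.selfAdjoint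
  have hcl := isClosable_prodDiracCore hD₁ hD₂ hb hc
  have dirac_eq_diagOp := prodDirac_eq_diagOp hD₁ hD₂ hb hc
  exact
    { one_mem := MinTensor.one_mem_algTensor h₁.one_mem h₂.one_mem
      mul_mem := fun x hx y hy => MinTensor.mul_mem_algTensor h₁.mul_mem h₂.mul_mem hx hy
      star_mem := fun x hx => MinTensor.star_mem_algTensor h₁.star_mem h₂.star_mem hx
      dense := MinTensor.dense_algTensor h₁.one_mem h₂.one_mem h₁.mul_mem h₂.mul_mem h₁.star_mem
        h₂.star_mem h₁.dense h₂.dense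
      selfAdjoint := dirac_eq_diagOp ▸ isSelfAdjoint_diagOp _ _
      compact := dirac_eq_diagOp ▸
        exists_isInvSqrtOneAddSq_diagOp _ _ (finite_prodEigenvalue μ ν hμ hν)
      commutator := by
        refine fun x hx => hasBoundedCommutator_of_mem_span _ ?_ hx
        rintro _ ⟨b, hb, c, hc, rfl⟩
        rw [rep_tmul]
        exact (h₁.commutator b hb).prodDirac (h₂.commutator c hc) hcl
      grading_selfAdjoint := isSelfAdjoint_stdGrading
      grading_sq := stdGrading_mul_self
      grading_comm := by
        refine (OpAlg.isGenerating (tensorGen s₁ s₂)).map_mul_stdGrading ?_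
        rintro _ ⟨_, ⟨b, c, rfl⟩, rfl⟩
        exact ⟨_, rep_tmul b c⟩
      grading_dirac := stdGrading_anticommutes_prodDirac hcl }

end Exterior

/-! ### The equivariant triple as a restriction of the exterior product -/

theorem prodDirac_lengthCore {G : Type u} {H : Type w} [NormedAddCommGroup H]
    [InnerProductSpace ℂ H] [CompleteSpace H] {V : Type v} [NormedAddCommGroup V]
    [InnerProductSpace ℂ V] [FiniteDimensional ℂ V] [CompleteSpace V] {D : H →ₗ.[ℂ] H}
    (hD : IsSelfAdjoint D)
    (hS : ∃ S : H →L[ℂ] H, IsInvSqrtOneAddSq D S ∧ IsCompactOperator S) {ℓ : G → V →L[ℂ] V}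
    (hℓ : ∀ x, IsSelfAdjoint (ℓ x)) :
    prodDirac D (lengthCore ℓ) = prodDirac D (lengthDirac ℓ) := by
  obtain ⟨ι, b, μ, -, hb⟩ := exists_eigenbasis hD hS
  have hD' := isFormalAdjoint_of_isSelfAdjoint hD
  have hM := isFormalAdjoint_of_isSelfAdjoint (isSelfAdjoint_lengthDirac hℓ)
  -- The eigenbasis of `M_ℓ` lies in its core, so both operators are diagonal in the same basis.
  rw [prodDirac_eq_diagOp hD' (isFormalAdjoint_lengthCore hℓ) hb (lengthEigenbasis_mem_graph hℓ),
    prodDirac_eq_diagOp hD' hM hb fun p =>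
      LinearPMap.le_graph_of_le (LinearPMap.le_closure _) (lengthEigenbasis_mem_graph hℓ p)]

section Equivariant

variable {A G H : Type u} [CStarAlgebra A] [Group G] [NormedAddCommGroup H]
  [InnerProductSpace ℂ H] [CompleteSpace H] {S : TwistedSystem A G} {R : CovariantRep S H}
  {V : Type v} [NormedAddCommGroup V] [InnerProductSpace ℂ V] [CompleteSpace V]

/-- The exterior product of the triple `(ℬ, H, D)` on `B` with the length triple on `C*_r(G)`. -/
def exteriorTriple (R : CovariantRep S H) (𝒜 : Submodule ℂ A) (D : H →ₗ.[ℂ] H)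
    (ℓ : G → V →L[ℂ] V) : EvenTripleData (MinTensor (repGen R) (grpGen G))
      (Double (HilbertTensor H (HilbertTensor (L2 G) V))) where
  alg := MinTensor.algTensor (repTriple R 𝒜 D).alg (groupTriple ℓ).alg
  rep := (doubleHom _).comp ((assocHom H (L2 G) V).comp (OpAlg.val _))
  dirac := prodDirac D (lengthDirac ℓ)
  grading := stdGrading _

theorem isExteriorProduct_exteriorTriple (R : CovariantRep S H) (𝒜 : Submodule ℂ A)
    (D : H →ₗ.[ℂ] H) (ℓ : G → V →L[ℂ] V) :
    IsExteriorProduct (repTriple R 𝒜 D) (groupTriple ℓ) (exteriorTriple R 𝒜 D ℓ) where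
  alg := rfl
  rep _ _ := congrArg doubleOp (assocHom_tensorOp _ _)
  dirac := rfl
  grading := rfl

/-- The triple on `A ⋊_r G` given by the equivariant construction, with representation induced by a
`*`-homomorphism `ψ` to `B ⊗ C*_r(G)`, which is meant to be `a δ_g ↦ π(a) U_g ⊗ δ_g`. -/
def equivariantTriple (ψ : ReducedCrossed S R.π →⋆ₐ[ℂ] MinTensor (repGen R) (grpGen G))
    (𝒜 : Submodule ℂ A) (D : H →ₗ.[ℂ] H) (ℓ : G → V →L[ℂ] V) :
    EvenTripleData (ReducedCrossed S R.π)
      (Double (HilbertTensor H (HilbertTensor (L2 G) V))) where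
  alg := IsCrossedFamily.span (redδ S R.π) 𝒜
  rep := (exteriorTriple R 𝒜 D ℓ).rep.comp ψ
  dirac := prodDirac D (lengthCore ℓ)
  grading := stdGrading _

variable {ψ : ReducedCrossed S R.π →⋆ₐ[ℂ] MinTensor (repGen R) (grpGen G)}
  {ℓ : G → V →L[ℂ] V}

theorem isEquivariantTriple_equivariantTriple
    (hψ : ∀ a g, ψ (redδ S R.π a g) = MinTensor.tmul (repδ R a g) (grpδ g))
    (𝒜 : Submodule ℂ A) (D : H →ₗ.[ℂ] H) (ℓ : G → V →L[ℂ] V) :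
    IsEquivariantTriple R 𝒜 D ℓ (equivariantTriple ψ 𝒜 D ℓ) where
  alg := rfl
  rep a g := (congrArg (exteriorTriple R 𝒜 D ℓ).rep (hψ a g)).trans
    ((isExteriorProduct_exteriorTriple R 𝒜 D ℓ).rep _ _)
  dirac := rfl
  grading := rfl

theorem isPullback_equivariantTriple [FiniteDimensional ℂ V]
    (hψ : ∀ a g, ψ (redδ S R.π a g) = MinTensor.tmul (repδ R a g) (grpδ g))
    {T : TripleData A H} (hT : IsSpectralTriple T) (hℓ : ∀ x, IsSelfAdjoint (ℓ x)) :
    IsPullback ψ (exteriorTriple R T.alg T.dirac ℓ) (equivariantTriple ψ T.alg T.dirac ℓ) where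
  smooth t ht := by
    have hle : IsCrossedFamily.span (redδ S R.π) T.alg ≤
        (exteriorTriple R T.alg T.dirac ℓ).alg.comap ψ.toAlgHom.toLinearMap := by
      refine Submodule.span_le.mpr ?_
      rintro _ ⟨a, ha, g, rfl⟩
      exact Submodule.subset_span ⟨_, Submodule.subset_span ⟨a, ha, g, rfl⟩, _,
        Submodule.subset_span ⟨g, rfl⟩, hψ a g⟩
    exact hle ht
  rep := rfl
  dirac := prodDirac_lengthCore hT.selfAdjoint hT.compact hℓ
  grading := rfl

theorem isEvenSpectralTriple_equivariantTriple {T : TripleData A H} (hT : IsSpectralTriple T)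
    (hsmooth : S.IsSmooth T.alg)
    (hext : IsEvenSpectralTriple (exteriorTriple R T.alg T.dirac ℓ))
    (hpull : IsPullback ψ (exteriorTriple R T.alg T.dirac ℓ)
      (equivariantTriple ψ T.alg T.dirac ℓ)) :
    IsEvenSpectralTriple (equivariantTriple ψ T.alg T.dirac ℓ) := by
  have hred := R.isCrossedFamily_redδ
  exact hext.pullback hpull (hred.one_mem_span hT.one_mem)
    (fun a ha b hb => hred.mul_mem_span hT.mul_mem hsmooth ha hb)
    (fun a ha => hred.star_mem_span hT.mul_mem hT.star_mem hsmooth ha)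
    (hred.dense_span hT.one_mem hT.mul_mem hT.star_mem hT.dense hsmooth R.isGenerating_redδ)

end Equivariant

end

theorem proposition3p8 {A G H : Type u} [CStarAlgebra A] [Group G]
    [NormedAddCommGroup H] [InnerProductSpace ℂ H] [CompleteSpace H]
    {V : Type v} [NormedAddCommGroup V] [InnerProductSpace ℂ V] [FiniteDimensional ℂ V]
    [CompleteSpace V]
    (S : TwistedSystem A G)
    -- an odd twisted equivariant spectral triple `(𝒜, H, D, π)` on `A`, with `π = R.π` faithful
    (T : TripleData A H) (hT : IsSpectralTriple T)
    (R : CovariantRep S H) (hπ : T.rep = R.π) (hfaithful : Function.Injective R.π)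
    (hsmooth : S.IsSmooth T.alg)
    (hequiv : ∀ g, HasBoundedCommutator T.dirac (R.U g : H →L[ℂ] H))
    (ℓ : G → V →L[ℂ] V) (hℓ : IsProperLength ℓ) :
    -- `Φ = π × U` is the integrated form, with image `B`; `Θ = Φ ⊗ id`; `Q` is the equivariant triple;
    -- `P` is the exterior product
    ∃ (Φ : FullCrossed S →⋆ₐ[ℂ] RepAlg R)
      (φ : ReducedCrossed S R.π →⋆ₐ[ℂ] MinTensor (univGen S) (grpGen G))
      (Θ : MinTensor (univGen S) (grpGen G) →⋆ₐ[ℂ]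
        MinTensor (repGen R) (grpGen G))
      (ψ : ReducedCrossed S R.π →⋆ₐ[ℂ] MinTensor (repGen R) (grpGen G))
      (Q : EvenTripleData (ReducedCrossed S R.π)
        (Double (HilbertTensor H (HilbertTensor (L2 G) V))))
      (P : EvenTripleData (MinTensor (repGen R) (grpGen G))
        (Double (HilbertTensor H (HilbertTensor (L2 G) V)))),
      (∀ a g, Φ (fullδ S a g) = repδ R a g) ∧ Function.Surjective Φ ∧
      Function.Injective φ ∧
      (∀ a g, φ (redδ S R.π a g) = MinTensor.tmul (fullδ S a g) (grpδ g)) ∧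
      -- `ψ = (Φ ⊗ id) ∘ φ`
      (∀ f c, Θ (MinTensor.tmul f c) = MinTensor.tmul (Φ f) c) ∧ ψ = Θ.comp φ ∧
      IsEquivariantTriple R T.alg T.dirac ℓ Q ∧ IsEvenSpectralTriple Q ∧
      IsSpectralTriple (repTriple R T.alg T.dirac) ∧ IsSpectralTriple (groupTriple (V := V) ℓ) ∧
      IsExteriorProduct (repTriple R T.alg T.dirac) (groupTriple ℓ) P ∧ IsEvenSpectralTriple P ∧
      IsRestriction ψ P Q := by
  obtain ⟨φ, hφ⟩ := R.exists_coaction hfaithful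
  let ψ := R.integratedFormTensor.comp φ
  have hψ (a g) : ψ (redδ S R.π a g) = MinTensor.tmul (repδ R a g) (grpδ g) := by
    rw [StarAlgHom.comp_apply, hφ, R.integratedFormTensor_tmul, R.integratedForm_fullδ]
  have ψ_injective : Function.Injective ψ := R.injective_of_redδ ψ hψ
  have φ_injective : Function.Injective φ := .of_comp (f := R.integratedFormTensor) ψ_injective
  have hrep := isSpectralTriple_repTriple hT R hπ hsmooth hequiv
  have hgrp := isSpectralTriple_groupTriple hℓ
  have hext := isExteriorProduct_exteriorTriple R T.alg T.dirac ℓ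
  have hP := hext.isEvenSpectralTriple hrep hgrp
  have hpull := isPullback_equivariantTriple hψ hT hℓ.selfAdjoint
  exact ⟨R.integratedForm, φ, R.integratedFormTensor, ψ, equivariantTriple ψ T.alg T.dirac ℓ,
    exteriorTriple R T.alg T.dirac ℓ, R.integratedForm_fullδ, R.integratedForm_surjective,
    φ_injective, hφ, R.integratedFormTensor_tmul, rfl,
    isEquivariantTriple_equivariantTriple hψ T.alg T.dirac ℓ,
    isEvenSpectralTriple_equivariantTriple hT hsmooth hP hpull, hrep, hgrp, hext, hP,
    ψ_injective, hpull⟩
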